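/- **Setting.** Let $d\ge 2$, let $\Omega\subset\mathbb R^d$ be a bounded Lipschitz domain, $T>0$, and let $A,B$ be nonempty compact metric spaces. Let $(\alpha,\beta)\mapsto(a^{\alpha\beta},b^{\alpha\beta},c^{\alpha\beta},f^{\alpha\beta})$ be a continuous map from $A\times B$ to $C(\overline\Omega)\times C(\overline\Omega,\mathbb R^d)\times C(\overline\Omega)\times C(\overline\Omega)$ with $a^{\alpha\beta}\ge 0$ on $\Omega$. Let $g\in W^{1,\infty}(\mathbb R^d)$ with $\Delta g\in L^\infty(\Omega)$, and $v_T\in C(\overline\Omega)\cap H^1(\Omega)$ with $v_T=g$ on $\partial\Omega$. Consider the Isaacs problem $$-\partial_t v+\inf_{\beta\in B}\sup_{\alpha\in A}\bigl(-a^{\alpha\beta}\Delta v-b^{\alpha\beta}\cdot\nabla v+c^{\alpha\beta}v-f^{\alpha\beta}\bigr)=0\ \text{ in }(0,T)\times\Omega,\quad v=g\ \text{ on }(0,T)\times\partial\Omega,\quad v=v_T\ \text{ on }\{T\}\times\overline\Omega. \tag{1}$$ For $t\in[0,T]$, $x\in\overline\Omega$, $q,r,s\in\mathbb R$, $p\in\mathbb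 R^d$ let $F(t,x,q,p,r,s)$ be $-r+\inf_\beta\sup_\alpha(-a^{\alpha\beta}(x)q-b^{\alpha\beta}(x)\cdot p+c^{\alpha\beta}(x)s-f^{\alpha\beta}(x))$ if $t<T,\ x\in\Omega$; $s-g(x)$ if $t<T,\ x\in\partial\Omega$; and $s-v_T(x)$ if $t=T$. Upper and lower stars denote upper and lower semicontinuous envelopes, relative to $[0,T]\times\overline\Omega$ for functions of $(t,x)$, and relative to the domain of $F$ for $F$. A bounded function $w$ on $[0,T]\times\overline\Omega$ satisfies the Dirichlet condition at $x$ *strongly* if $w^*(t,x)=w_*(t,x)=g(x)$ for all $t\in[0,T]$, and the final time condition at $x$ *strongly* if $w^*(T,x)=w_*(T,x)=v_T(x)$. For $\omega\subseteq\partial\Omega$, a bounded $v:[0,T]\times\overline\Omega\to\mathbb R$ is a *viscosity subsolution of (1) strongly on $\omega$* if $$F_*\bigl(t,x,\Delta\psi(t,x),\nabla\psi(t,x),\partial_t\psi(t,x),v^*(t,x)\bigr)\le 0$$ whenever $\psi\in C^2(\mathbb R\times\mathbb R^d)$ and $v^*-\psi$ has a local maximum relative to $[0,T)\times\overline\Omega$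 at $(t,x)\in[0,T)\times\overline\Omega$, and if $v^*$ satisfies the Dirichlet condition strongly at every point of $\omega$ and the final time condition strongly at every point of $\overline\Omega$. *Viscosity supersolutions strongly on $\omega$* are defined with $v_*$, local minima and $F^*(\dots,v_*(t,x))\ge 0$. **Numerical method.** Let $V_i$ ($i\in\mathbb N$) be the spaces of continuous piecewise affine functions on a shape-regular sequence of finite conforming simplicial meshes of $\overline\Omega$ whose mesh sizes tend to $0$, and let $V_i^0\subset V_i$ be the functions that vanish on $\partial\Omega$. For a node $y$ let $\phi_y$ be the hat function and $\hat\phi_y=\phi_y/\|\phi_y\|_{L^1(\Omega)}$; a node is internal if it lies in $\Omega$. Let $h_i>0$, $h_i\to0$, $K_i:=T/h_i\in\mathbb N$, $s_i^k=kh_i$. Write $\langle\cdot,\cdot\rangle$ for the $L^2(\Omega)$ inner product. Assume: 1. *Projections.* The maps $P_i:C(\overline\Omega)\cap H^1(\Omega)\to V_i$ are linear, $\langle\nabla P_iw,\nabla\phi\rangle=\langle\nabla w,\nabla\phi\rangle$ for all $\phi\in V_i^0$, there is $C$ with $\|P_iw\|_{W^{1,\infty}(\Omega)}\le C\|w\|_{W^{1,\infty}(\Omega)}$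 and $\|P_iw-w\|_{W^{1,\infty}(\Omega)}\to0$ for all $w\in C^\infty(\mathbb R^d)$ (with $C$ independent of $i$ and $w$), and $\|P_ig-g\|_{L^\infty(\Omega)}\to0$, $\|P_iv_T-v_T\|_{L^\infty(\Omega)}\to0$. 2. *Consistency.* There are coefficients $\bar a_i^{\alpha\beta},\bar{\bar a}_i^{\alpha\beta}$ (with values at the internal nodes that depend continuously on $(\alpha,\beta)$) and $\bar b_i^{\alpha\beta},\bar{\bar b}_i^{\alpha\beta},\bar c_i^{\alpha\beta},\bar{\bar c}_i^{\alpha\beta},f_i^{\alpha\beta}$ (continuous in $(\alpha,\beta)$ with values in $L^\infty(\Omega)$) with $\bar c_i^{\alpha\beta},\bar{\bar c}_i^{\alpha\beta}\ge0$, $\|\bar c_i^{\alpha\beta}\|_{L^\infty}+\|\bar{\bar c}_i^{\alpha\beta}\|_{L^\infty}\le\gamma$ for some $\gamma$ and all $i,\alpha,\beta$, and $$\lim_{i\to\infty}\sup_{\alpha,\beta}\Bigl(\sup_{y\text{ internal node}}\|a^{\alpha\beta}-(\bar a_i^{\alpha\beta}(y)+\bar{\bar a}_i^{\alpha\beta}(y))\|_{L^\infty(\operatorname{supp}\phi_y)}+\|b^{\alpha\beta}-(\bar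 b_i^{\alpha\beta}+\bar{\bar b}_i^{\alpha\beta})\|_{L^\infty(\Omega)}+\|c^{\alpha\beta}-(\bar c_i^{\alpha\beta}+\bar{\bar c}_i^{\alpha\beta})\|_{L^\infty(\Omega)}+\|f^{\alpha\beta}-f_i^{\alpha\beta}\|_{L^\infty(\Omega)}\Bigr)=0 .$$ For internal nodes $y$ put $(E_i^{\alpha\beta}w)_y=\bar a_i^{\alpha\beta}(y)\langle\nabla w,\nabla\hat\phi_y\rangle+\langle-\bar b_i^{\alpha\beta}\cdot\nabla w+\bar c_i^{\alpha\beta}w,\hat\phi_y\rangle$, define $(I_i^{\alpha\beta}w)_y$ in the same way with $\bar{\bar a},\bar{\bar b},\bar{\bar c}$, and put $(F_i^{\alpha\beta})_y=\langle f_i^{\alpha\beta},\hat\phi_y\rangle$. 3. *Monotonicity.* For all $i,\alpha,\beta$, all internal nodes $y$ and all nodes $z$: $(E_i^{\alpha\beta}\phi_z)_y\le0$ if $z\ne y$; $h_i(E_i^{\alpha\beta}\phi_z)_y-\phi_z(y)\le0$; and $(I_i^{\alpha\beta}u)_y\le0$ for every $u\in V_i$ that has a non-positive local minimum at $y$. The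 numerical solution $v_i(s_i^k,\cdot)\in V_i$, $k=K_i,\dots,0$, is given by $v_i(T,\cdot)=P_iv_T$ and, for $k<K_i$, by $v_i(s_i^k,\cdot)=P_ig$ on $\partial\Omega$ and $$-\frac{v_i(s_i^{k+1},y)-v_i(s_i^k,y)}{h_i}+\inf_{\beta}\sup_{\alpha}\bigl(E_i^{\alpha\beta}v_i(s_i^{k+1},\cdot)+I_i^{\alpha\beta}v_i(s_i^k,\cdot)-F_i^{\alpha\beta}\bigr)_y=0\qquad\text{for all internal nodes }y .$$ 4. *Barriers.* $\omega\subseteq\partial\Omega$, and for all $y\in\omega$, $\varepsilon>0$ there are $\zeta_{y,\varepsilon},\xi_{y,\varepsilon}\in W^{1,\infty}([0,T]\times\overline\Omega)$ with $\max_{k}\|P_i\zeta_{y,\varepsilon}(s_i^k,\cdot)-\zeta_{y,\varepsilon}(s_i^k,\cdot)\|_{L^\infty(\Omega)}\to0$ as $i\to\infty$, likewise for $\xi_{y,\varepsilon}$, such that: for all large $i$ (depending on $y,\varepsilon$) and all $k$, the function $v_i(s_i^k,\cdot)-P_i\zeta_{y,\varepsilon}(s_i^k,\cdot)$ has a minimiser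 over $\overline\Omega$ that lies on $\partial\Omega$, and $v_i(s_i^k,\cdot)-P_i\xi_{y,\varepsilon}(s_i^k,\cdot)$ has a maximiser over $\overline\Omega$ that lies on $\partial\Omega$; and for each $t\in[0,T]$ one can select minimisers $q_\varepsilon$ of $g-\zeta_{y,\varepsilon}(t,\cdot)$ over $\partial\Omega$ and maximisers $r_\varepsilon$ of $g-\xi_{y,\varepsilon}(t,\cdot)$ over $\partial\Omega$ with $q_\varepsilon\to y$, $r_\varepsilon\to y$, $\lim_{\varepsilon\to0}(\zeta_{y,\varepsilon}(t,y)-\zeta_{y,\varepsilon}(t,q_\varepsilon))\ge0$ and $\lim_{\varepsilon\to0}(\xi_{y,\varepsilon}(t,y)-\xi_{y,\varepsilon}(t,r_\varepsilon))\le0$, where both limits exist. **Theorem.** The envelopes $$\overline v(t,x)=\limsup_{\substack{i\to\infty\\(s_i^k,y)\to(t,x)}}v_i(s_i^k,y),\qquad\underline v(t,x)=\liminf_{\substack{i\to\infty\\(s_i^k,y)\to(t,x)}}v_i(s_i^k,y)\qquad((t,x)\in[0,T]\times\overline\Omega),$$ where $s_i^k$ runs through the time steps and $y$ through the nodes of level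 $i$, are finite and bounded on $[0,T]\times\overline\Omega$; $\overline v$ is a viscosity subsolution and $\underline v$ a viscosity supersolution of (1), strongly on $\omega$. -/

import Mathlib

open Set Filter Topology MeasureTheory
open scoped NNReal ENNReal

noncomputable section

namespace IsaacsFEM

/-- The Euclidean space of dimension `d`. -/
abbrev Eu (d : ℕ) := EuclideanSpace ℝ (Fin d)

/-! ## Domains and function spaces -/

/-- Bounded Lipschitz domain: a nonempty, bounded, connected open set that near each of its boundary
points is, in suitable orthonormal coordinates with last axis `n`, the region strictly below the
graph of a Lipschitz function `φ` of the other coordinates. -/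
structure IsLipschitzDomain {d : ℕ} (Ω : Set (Eu d)) : Prop where
  isOpen : IsOpen Ω
  isConnected : IsConnected Ω
  isBounded : Bornology.IsBounded Ω
  graph : ∀ x ∈ frontier Ω, ∃ (n : Eu d) (r : ℝ) (L : ℝ≥0) (φ : Eu d → ℝ),
    ‖n‖ = 1 ∧ 0 < r ∧ LipschitzWith L φ ∧ (∀ (y : Eu d) (s : ℝ), φ (y + s • n) = φ y) ∧
    ∀ y ∈ Metric.ball x r, (y ∈ Ω ↔ inner ℝ n y < φ y)

/-- Smooth functions with compact support in `Ω`. -/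
def IsTest {d : ℕ} (Ω : Set (Eu d)) (φ : Eu d → ℝ) : Prop :=
  ContDiff ℝ (⊤ : ℕ∞) φ ∧ HasCompactSupport φ ∧ tsupport φ ⊆ Ω

/-- `G` is the weak gradient of `w` on `Ω`. -/
def HasWeakGradient {d : ℕ} (Ω : Set (Eu d)) (w : Eu d → ℝ) (G : Eu d → Eu d) : Prop :=
  ∀ φ, IsTest Ω φ → ∫ x in Ω, w x • gradient φ x = - ∫ x in Ω, φ x • G x

/-- `G` is the weak Laplacian of `w` on `Ω`. -/
def HasWeakLaplacian {d : ℕ} (Ω : Set (Eu d)) (w G : Eu d → ℝ) : Prop :=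
  ∀ φ, IsTest Ω φ → ∫ x in Ω, w x * Laplacian.laplacian φ x = ∫ x in Ω, φ x * G x

/-- The space `C(closure Ω) ∩ H¹(Ω)`. -/
def contH1 {d : ℕ} (Ω : Set (Eu d)) : Set (Eu d → ℝ) :=
  {w | ContinuousOn w (closure Ω) ∧ MemLp w 2 (volume.restrict Ω) ∧
    ∃ G : Eu d → Eu d, MemLp G 2 (volume.restrict Ω) ∧ HasWeakGradient Ω w G}

/-- The norm of `L^∞(Ω)`. -/
def supNorm {d : ℕ} {F : Type*} [NormedAddCommGroup F] (Ω : Set (Eu d)) (w : Eu d → F) : ℝ≥0∞ :=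
  eLpNorm w ⊤ (volume.restrict Ω)

/-- The norm of `W^{1,∞}(Ω)`. It is used only for linear combinations of smooth and of continuous piecewise
affine functions, whose weak gradient is the classical one, which exists almost everywhere. -/
def w1infNorm {d : ℕ} (Ω : Set (Eu d)) (w : Eu d → ℝ) : ℝ≥0∞ :=
  supNorm Ω w + supNorm Ω (gradient w)

/-! ## Semicontinuous envelopes -/

/-- Upper semicontinuous envelope `f^*` of `f` relative to `D`. The point itself is included in the
upper limit. -/
def upperEnv {X : Type*} [TopologicalSpace X] (D : Set X) (f : X → ℝ) (x : X) : ℝ :=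
  limsup f (𝓝[D] x)

/-- Lower semicontinuous envelope `f_*` of `f` relative to `D`. -/
def lowerEnv {X : Type*} [TopologicalSpace X] (D : Set X) (f : X → ℝ) (x : X) : ℝ :=
  liminf f (𝓝[D] x)

/-! ## The Isaacs problem -/

/-- The data of the final boundary value problem
`-∂ₜ v + inf_β sup_α (- a Δv - b ⋅ ∇v + c v - f) = 0` in `(0,T) × Ω`, `v = g` on `(0,T) × ∂Ω`,
`v = vT` on `{T} × closure Ω`, with the standing assumptions on them. Joint continuity on
`A × B × closure Ω` is continuity of the map from `A × B` to `C(closure Ω)`, as `A`, `B` and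
`closure Ω` are compact; it contains the equicontinuity of the families of coefficients. -/
structure IsaacsProblem (d : ℕ) (A B : Type*) [MetricSpace A] [MetricSpace B] where
  /-- the spatial domain -/
  Ω : Set (Eu d)
  domain : IsLipschitzDomain Ω
  /-- the final time -/
  T : ℝ
  T_pos : 0 < T
  /-- diffusion coefficient -/
  a : A → B → Eu d → ℝ
  /-- drift -/
  b : A → B → Eu d → Eu d
  /-- reaction coefficient -/
  c : A → B → Eu d → ℝ
  /-- source term -/
  f : A → B → Eu d → ℝ
  continuous_a : ContinuousOn (fun p : (A × B) × Eu d => a p.1.1 p.1.2 p.2) (univ ×ˢ closure Ω)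
  continuous_b : ContinuousOn (fun p : (A × B) × Eu d => b p.1.1 p.1.2 p.2) (univ ×ˢ closure Ω)
  continuous_c : ContinuousOn (fun p : (A × B) × Eu d => c p.1.1 p.1.2 p.2) (univ ×ˢ closure Ω)
  continuous_f : ContinuousOn (fun p : (A × B) × Eu d => f p.1.1 p.1.2 p.2) (univ ×ˢ closure Ω)
  a_nonneg : ∀ α β, ∀ x ∈ Ω, 0 ≤ a α β x
  /-- boundary data, in `W^{1,∞}(ℝᵈ)` with Laplacian in `L^∞(Ω)` -/
  g : Eu d → ℝ
  g_bounded : ∃ M, ∀ x, |g x| ≤ M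
  g_lipschitz : ∃ L, LipschitzWith L g
  g_laplacian : ∃ G, MemLp G ⊤ (volume.restrict Ω) ∧ HasWeakLaplacian Ω g G
  /-- final data -/
  vT : Eu d → ℝ
  vT_mem : vT ∈ contH1 Ω
  vT_eq_g : ∀ x ∈ frontier Ω, vT x = g x

section Viscosity

variable {d : ℕ} {A B : Type*} [MetricSpace A] [MetricSpace B] (𝓜 : IsaacsProblem d A B)

/-- The closed space-time cylinder `[0,T] × closure Ω`. -/
def cyl : Set (ℝ × Eu d) := Icc 0 𝓜.T ×ˢ closure 𝓜.Ω

/-- The set `[0,T) × closure Ω`. -/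
def cyl' : Set (ℝ × Eu d) := Ico 0 𝓜.T ×ˢ closure 𝓜.Ω

/-- `inf_β sup_α (- a q - b ⋅ p + c s - f)` at the point `x`. -/
def hamiltonian (x : Eu d) (q : ℝ) (p : Eu d) (s : ℝ) : ℝ :=
  ⨅ β : B, ⨆ α : A,
    (- 𝓜.a α β x * q - inner ℝ (𝓜.b α β x) p + 𝓜.c α β x * s - 𝓜.f α β x)

open Classical in
/-- The operator `F(t,x,q,p,r,s)` that contains the equation, the boundary condition and the
final time condition. -/
def opF : ℝ × Eu d × ℝ × Eu d × ℝ × ℝ → ℝ := fun ⟨t, x, q, p, r, s⟩ =>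
  if t < 𝓜.T then
    if x ∈ 𝓜.Ω then - r + hamiltonian 𝓜 x q p s else s - 𝓜.g x
  else s - 𝓜.vT x

/-- The domain of `F`. -/
def domF : Set (ℝ × Eu d × ℝ × Eu d × ℝ × ℝ) :=
  {z | z.1 ∈ Icc 0 𝓜.T ∧ z.2.1 ∈ closure 𝓜.Ω}

/-- `(t, x, Δψ(t,x), ∇ψ(t,x), ∂ₜψ(t,x), s)`. -/
def jet (ψ : ℝ × Eu d → ℝ) (z : ℝ × Eu d) (s : ℝ) : ℝ × Eu d × ℝ × Eu d × ℝ × ℝ :=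
  (z.1, z.2, Laplacian.laplacian (fun y => ψ (z.1, y)) z.2, gradient (fun y => ψ (z.1, y)) z.2,
    deriv (fun t => ψ (t, z.2)) z.1, s)

/-- `u` satisfies the Dirichlet condition at `x` strongly. -/
def StrongDirichlet (u : ℝ × Eu d → ℝ) (x : Eu d) : Prop :=
  ∀ t ∈ Icc 0 𝓜.T,
    upperEnv (cyl 𝓜) u (t, x) = 𝓜.g x ∧ lowerEnv (cyl 𝓜) u (t, x) = 𝓜.g x

/-- `u` satisfies the final time condition at `x` strongly. -/
def StrongFinal (u : ℝ × Eu d → ℝ) (x : Eu d) : Prop :=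
  upperEnv (cyl 𝓜) u (𝓜.T, x) = 𝓜.vT x ∧ lowerEnv (cyl 𝓜) u (𝓜.T, x) = 𝓜.vT x

/-- Viscosity subsolutions of the Isaacs problem, strongly on `ω`. -/
structure IsViscositySubsolution (ω : Set (Eu d)) (v : ℝ × Eu d → ℝ) : Prop where
  bounded : ∃ M, ∀ z ∈ cyl 𝓜, |v z| ≤ M
  viscosity : ∀ ψ : ℝ × Eu d → ℝ, ContDiff ℝ 2 ψ → ∀ z ∈ cyl' 𝓜,
    IsLocalMaxOn (fun y => upperEnv (cyl 𝓜) v y - ψ y) (cyl' 𝓜) z →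
      lowerEnv (domF 𝓜) (opF 𝓜) (jet ψ z (upperEnv (cyl 𝓜) v z)) ≤ 0
  dirichlet : ∀ x ∈ ω, StrongDirichlet 𝓜 (upperEnv (cyl 𝓜) v) x
  final : ∀ x ∈ closure 𝓜.Ω, StrongFinal 𝓜 (upperEnv (cyl 𝓜) v) x

/-- Viscosity supersolutions of the Isaacs problem, strongly on `ω`. -/
structure IsViscositySupersolution (ω : Set (Eu d)) (v : ℝ × Eu d → ℝ) : Prop where
  bounded : ∃ M, ∀ z ∈ cyl 𝓜, |v z| ≤ M
  viscosity : ∀ ψ : ℝ × Eu d → ℝ, ContDiff ℝ 2 ψ → ∀ z ∈ cyl' 𝓜,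
    IsLocalMinOn (fun y => lowerEnv (cyl 𝓜) v y - ψ y) (cyl' 𝓜) z →
      0 ≤ upperEnv (domF 𝓜) (opF 𝓜) (jet ψ z (lowerEnv (cyl 𝓜) v z))
  dirichlet : ∀ x ∈ ω, StrongDirichlet 𝓜 (lowerEnv (cyl 𝓜) v) x
  final : ∀ x ∈ closure 𝓜.Ω, StrongFinal 𝓜 (lowerEnv (cyl 𝓜) v) x

end Viscosity

/-! ## Piecewise linear finite elements -/

section P1

variable {d : ℕ}

/-- The finite element space of the mesh `K`: functions that are affine on each simplex. Only the
values on the union of the simplices matter, where such a function is automatically continuous. -/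
def IsP1 (K : Geometry.SimplicialComplex ℝ (Eu d)) (u : Eu d → ℝ) : Prop :=
  ∀ s ∈ K.faces, ∃ L : Eu d →ᵃ[ℝ] ℝ, EqOn u L (convexHull ℝ (s : Set (Eu d)))

/-- The hat function of the node `y`: its value at `x` is the barycentric coordinate of `x` with
respect to `y` in any simplex of the mesh that contains `x` (it is `0` if `y` is not a vertex of
that simplex, and off the mesh). For `x` in the mesh the set below has exactly one element. -/
def hat (K : Geometry.SimplicialComplex ℝ (Eu d)) (y x : Eu d) : ℝ :=
  sSup {c | ∃ s ∈ K.faces, ∃ w : Eu d → ℝ, (∀ z ∈ s, 0 ≤ w z) ∧ (∀ z, z ∉ s → w z = 0) ∧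
    ∑ z ∈ s, w z = 1 ∧ ∑ z ∈ s, w z • z = x ∧ c = w y}

/-- The hat function normalised in `L¹(Ω)`. -/
def nhat (Ω : Set (Eu d)) (K : Geometry.SimplicialComplex ℝ (Eu d)) (y x : Eu d) : ℝ :=
  hat K y x / ∫ z in Ω, |hat K y z|

/-- `a(y) ⟨∇w, ∇φ⟩ + ⟨- b ⋅ ∇w + c w, φ⟩` with `φ` the `L¹`-normalised hat function of `y`. -/
def galerkin (Ω : Set (Eu d)) (K : Geometry.SimplicialComplex ℝ (Eu d)) (a : Eu d → ℝ)
    (b : Eu d → Eu d) (c : Eu d → ℝ) (w : Eu d → ℝ) (y : Eu d) : ℝ :=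
  a y * (∫ x in Ω, inner ℝ (gradient w x) (gradient (nhat Ω K y) x)) +
    ∫ x in Ω, (- inner ℝ (b x) (gradient w x) + c x * w x) * nhat Ω K y x

end P1

/-! ## The numerical scheme -/

/-- The data of the numerical method, for all refinement levels `i : ℕ`. -/
structure Discretisation (d : ℕ) (A B : Type*) where
  /-- the meshes -/
  mesh : ℕ → Geometry.SimplicialComplex ℝ (Eu d)
  /-- the projections `Pᵢ`; only their values on `C(closure Ω) ∩ H¹(Ω)` are relevant -/
  P : ℕ → (Eu d → ℝ) → (Eu d → ℝ)
  /-- the time step sizes -/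
  h : ℕ → ℝ
  /-- the number of time steps -/
  steps : ℕ → ℕ
  /-- diffusion, drift and reaction coefficient of the explicit part -/
  aE : ℕ → A → B → Eu d → ℝ
  bE : ℕ → A → B → Eu d → Eu d
  cE : ℕ → A → B → Eu d → ℝ
  /-- diffusion, drift and reaction coefficient of the implicit part -/
  aI : ℕ → A → B → Eu d → ℝ
  bI : ℕ → A → B → Eu d → Eu d
  cI : ℕ → A → B → Eu d → ℝ
  /-- approximate source term -/
  f : ℕ → A → B → Eu d → ℝ

section Scheme

variable {d : ℕ} {A B : Type*} [MetricSpace A] [MetricSpace B]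
  (𝓜 : IsaacsProblem d A B) (𝓓 : Discretisation d A B)

/-- All nodes of the `i`-th mesh. -/
def nodes (i : ℕ) : Set (Eu d) := (𝓓.mesh i).vertices

/-- The internal nodes of the `i`-th mesh. -/
def innerNodes (i : ℕ) : Set (Eu d) := (𝓓.mesh i).vertices ∩ 𝓜.Ω

/-- The explicit operator `E` at the internal node `y`. -/
def opE (i : ℕ) (α : A) (β : B) (w : Eu d → ℝ) (y : Eu d) : ℝ :=
  galerkin 𝓜.Ω (𝓓.mesh i) (𝓓.aE i α β) (𝓓.bE i α β) (𝓓.cE i α β) w y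

/-- The implicit operator `I` at the internal node `y`. -/
def opI (i : ℕ) (α : A) (β : B) (w : Eu d → ℝ) (y : Eu d) : ℝ :=
  galerkin 𝓜.Ω (𝓓.mesh i) (𝓓.aI i α β) (𝓓.bI i α β) (𝓓.cI i α β) w y

/-- The source term at the internal node `y`. -/
def srcF (i : ℕ) (α : A) (β : B) (y : Eu d) : ℝ :=
  ∫ x in 𝓜.Ω, 𝓓.f i α β x * nhat 𝓜.Ω (𝓓.mesh i) y x

/-- The meshes are finite conforming simplicial triangulations of `closure Ω`, shape-regular, and
the mesh sizes and time step sizes tend to zero. -/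
structure IsMeshSequence : Prop where
  finite : ∀ i, (𝓓.mesh i).faces.Finite
  space : ∀ i, (𝓓.mesh i).space = closure 𝓜.Ω
  shapeRegular : ∃ κ : ℝ, 0 < κ ∧ ∀ i, ∀ s ∈ (𝓓.mesh i).faces, s.card = d + 1 →
    ∃ x, Metric.ball x (κ * Metric.diam (convexHull ℝ (s : Set (Eu d)))) ⊆
      convexHull ℝ (s : Set (Eu d))
  meshSize : Tendsto
    (fun i => ⨆ s ∈ (𝓓.mesh i).faces, Metric.ediam (convexHull ℝ (s : Set (Eu d)))) atTop (𝓝 0)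
  h_pos : ∀ i, 0 < 𝓓.h i
  steps_mul_h : ∀ i, 𝓓.steps i * 𝓓.h i = 𝓜.T
  h_tendsto : Tendsto 𝓓.h atTop (𝓝 0)

/-- The assumptions on the projections `Pᵢ`: linear mappings from `C(closure Ω) ∩ H¹(Ω)` to `Vᵢ`
that preserve the Dirichlet form against `Vᵢ⁰`, are stable and convergent in `W^{1,∞}(Ω)` on smooth
functions, and reproduce the data `g` and `vT` in the limit, uniformly on `Ω`. -/
structure IsEllipticProjection : Prop where
  isP1 : ∀ i, ∀ w ∈ contH1 𝓜.Ω, IsP1 (𝓓.mesh i) (𝓓.P i w)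
  linear : ∀ i, ∀ w₁ ∈ contH1 𝓜.Ω, ∀ w₂ ∈ contH1 𝓜.Ω, ∀ r : ℝ,
    EqOn (𝓓.P i (w₁ + r • w₂)) (𝓓.P i w₁ + r • 𝓓.P i w₂) (closure 𝓜.Ω)
  orthogonal : ∀ i, ∀ w ∈ contH1 𝓜.Ω, ∀ G : Eu d → Eu d,
    MemLp G 2 (volume.restrict 𝓜.Ω) → HasWeakGradient 𝓜.Ω w G →
    ∀ φ, IsP1 (𝓓.mesh i) φ → (∀ x ∈ frontier 𝓜.Ω, φ x = 0) →
      ∫ x in 𝓜.Ω, inner ℝ (gradient (𝓓.P i w) x) (gradient φ x) =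
        ∫ x in 𝓜.Ω, inner ℝ (G x) (gradient φ x)
  stable : ∃ C : ℝ≥0, ∀ w : Eu d → ℝ, ContDiff ℝ (⊤ : ℕ∞) w → ∀ i,
    w1infNorm 𝓜.Ω (𝓓.P i w) ≤ C * w1infNorm 𝓜.Ω w
  convergent : ∀ w : Eu d → ℝ, ContDiff ℝ (⊤ : ℕ∞) w →
    Tendsto (fun i => w1infNorm 𝓜.Ω (𝓓.P i w - w)) atTop (𝓝 0)
  convergent_g : Tendsto (fun i => supNorm 𝓜.Ω (𝓓.P i 𝓜.g - 𝓜.g)) atTop (𝓝 0)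
  convergent_vT : Tendsto (fun i => supNorm 𝓜.Ω (𝓓.P i 𝓜.vT - 𝓜.vT)) atTop (𝓝 0)

/-- Continuity of a family of essentially bounded functions on `Ω` as a map to `L^∞(Ω)`. -/
def LinftyContinuous {F : Type*} [NormedAddCommGroup F] (Ω : Set (Eu d))
    (u : A → B → Eu d → F) : Prop :=
  (∀ α β, MemLp (u α β) ⊤ (volume.restrict Ω)) ∧
    ∀ p : A × B, Tendsto (fun q : A × B => supNorm Ω (u q.1 q.2 - u p.1 p.2)) (𝓝 p) (𝓝 0)

/-- The consistency assumptions on the splitting of the operators. The diffusion coefficients `aE`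
and `aI` enter the scheme only through their values at the internal nodes. -/
structure IsConsistent : Prop where
  consistent : Tendsto (fun i => ⨆ (α : A) (β : B),
    ((⨆ y ∈ innerNodes 𝓜 𝓓 i, supNorm (tsupport (hat (𝓓.mesh i) y))
        (fun x => 𝓜.a α β x - (𝓓.aE i α β y + 𝓓.aI i α β y))) +
      supNorm 𝓜.Ω (𝓜.b α β - (𝓓.bE i α β + 𝓓.bI i α β)) +
      supNorm 𝓜.Ω (𝓜.c α β - (𝓓.cE i α β + 𝓓.cI i α β)) +
      supNorm 𝓜.Ω (𝓜.f α β - 𝓓.f i α β))) atTop (𝓝 0)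
  cE_nonneg : ∀ i α β, ∀ᵐ x ∂(volume.restrict 𝓜.Ω), 0 ≤ 𝓓.cE i α β x
  cI_nonneg : ∀ i α β, ∀ᵐ x ∂(volume.restrict 𝓜.Ω), 0 ≤ 𝓓.cI i α β x
  c_bounded : ∃ γ : ℝ≥0, ∀ i α β, supNorm 𝓜.Ω (𝓓.cE i α β) + supNorm 𝓜.Ω (𝓓.cI i α β) ≤ γ
  continuous_aE : ∀ i, ∀ y ∈ innerNodes 𝓜 𝓓 i, Continuous fun p : A × B => 𝓓.aE i p.1 p.2 y
  continuous_aI : ∀ i, ∀ y ∈ innerNodes 𝓜 𝓓 i, Continuous fun p : A × B => 𝓓.aI i p.1 p.2 y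
  continuous_bE : ∀ i, LinftyContinuous 𝓜.Ω (𝓓.bE i)
  continuous_bI : ∀ i, LinftyContinuous 𝓜.Ω (𝓓.bI i)
  continuous_cE : ∀ i, LinftyContinuous 𝓜.Ω (𝓓.cE i)
  continuous_cI : ∀ i, LinftyContinuous 𝓜.Ω (𝓓.cI i)
  continuous_f : ∀ i, LinftyContinuous 𝓜.Ω (𝓓.f i)

/-- The monotonicity assumptions: `E` has non-positive off-diagonal entries, `h E - Id` has
non-positive entries, and `I` has the local monotonicity property. The rows of `E` that belong to
boundary nodes are zero. -/
structure IsMonotone : Prop where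
  offDiagonal : ∀ i α β, ∀ y ∈ innerNodes 𝓜 𝓓 i, ∀ z ∈ nodes 𝓓 i, z ≠ y →
    opE 𝓜 𝓓 i α β (hat (𝓓.mesh i) z) y ≤ 0
  timeStep : ∀ i α β, ∀ y ∈ innerNodes 𝓜 𝓓 i, ∀ z ∈ nodes 𝓓 i,
    𝓓.h i * opE 𝓜 𝓓 i α β (hat (𝓓.mesh i) z) y - hat (𝓓.mesh i) z y ≤ 0
  localMonotonicity : ∀ i α β, ∀ u, IsP1 (𝓓.mesh i) u → ∀ y ∈ innerNodes 𝓜 𝓓 i,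
    u y ≤ 0 → IsLocalMin u y → opI 𝓜 𝓓 i α β u y ≤ 0

/-- `v i k` is the numerical solution on the `i`-th level at time `k h_i`: it belongs to `Vᵢ`, is the
projection of `vT` at the final time, attains `Pᵢ g` on the boundary at all earlier times, and solves
the discrete Isaacs equation at all internal nodes. At boundary nodes the scheme
has no time derivative and says that `v i k` equals `Pᵢ g`. -/
structure IsNumericalSolution (v : ℕ → ℕ → Eu d → ℝ) : Prop where
  isP1 : ∀ i, ∀ k ≤ 𝓓.steps i, IsP1 (𝓓.mesh i) (v i k)
  final : ∀ i, EqOn (v i (𝓓.steps i)) (𝓓.P i 𝓜.vT) (closure 𝓜.Ω)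
  boundary : ∀ i, ∀ k < 𝓓.steps i, EqOn (v i k) (𝓓.P i 𝓜.g) (frontier 𝓜.Ω)
  equation : ∀ i, ∀ k < 𝓓.steps i, ∀ y ∈ innerNodes 𝓜 𝓓 i,
    - ((v i (k + 1) y - v i k y) / 𝓓.h i) +
      (⨅ β : B, ⨆ α : A,
        (opE 𝓜 𝓓 i α β (v i (k + 1)) y + opI 𝓜 𝓓 i α β (v i k) y - srcF 𝓜 𝓓 i α β y)) = 0

/-- The filter on triples `(i, k, y)` of `i → ∞`, `(k h_i, y) → (t, x)`, where `k h_i` runs through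
the time steps and `y` through the nodes of the `i`-th level. -/
def nodeFilter (z : ℝ × Eu d) : Filter (ℕ × ℕ × Eu d) :=
  comap (fun q : ℕ × ℕ × Eu d => q.1) atTop ⊓
    comap (fun q : ℕ × ℕ × Eu d => ((q.2.1 * 𝓓.h q.1, q.2.2) : ℝ × Eu d)) (𝓝 z) ⊓
    𝓟 {q | q.2.1 ≤ 𝓓.steps q.1 ∧ q.2.2 ∈ nodes 𝓓 q.1}

/-- The upper envelope of the numerical solutions, with values in the extended reals. -/
def upperEnvelope (v : ℕ → ℕ → Eu d → ℝ) (z : ℝ × Eu d) : EReal :=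
  limsup (fun q : ℕ × ℕ × Eu d => (v q.1 q.2.1 q.2.2 : EReal)) (nodeFilter 𝓓 z)

/-- The lower envelope of the numerical solutions, with values in the extended reals. -/
def lowerEnvelope (v : ℕ → ℕ → Eu d → ℝ) (z : ℝ × Eu d) : EReal :=
  liminf (fun q : ℕ × ℕ × Eu d => (v q.1 q.2.1 q.2.2 : EReal)) (nodeFilter 𝓓 z)

/-- What upper and lower barriers have in common: a family of Lipschitz functions on
`[0,T] × closure Ω`, indexed by `ε > 0`, that are reproduced by the projections in the limit,
uniformly over the time steps and over `Ω`. -/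
structure IsBarrierFamily (ζ : ℝ → ℝ → Eu d → ℝ) : Prop where
  lipschitz : ∀ ε > 0, ∃ L, LipschitzOnWith L (fun z : ℝ × Eu d => ζ ε z.1 z.2) (cyl 𝓜)
  convergent : ∀ ε > 0, Tendsto (fun i => ⨆ (k : ℕ) (_ : k ≤ 𝓓.steps i),
    supNorm 𝓜.Ω (𝓓.P i (ζ ε (k * 𝓓.h i)) - ζ ε (k * 𝓓.h i))) atTop (𝓝 0)

/-- `ζ` is a family of upper barriers at the boundary point `y` for the numerical solutions `v`. -/
structure IsUpperBarrier (v : ℕ → ℕ → Eu d → ℝ) (y : Eu d) (ζ : ℝ → ℝ → Eu d → ℝ) : Prop where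
  family : IsBarrierFamily 𝓜 𝓓 ζ
  minimiser : ∀ ε > 0, ∃ i₀, ∀ i ≥ i₀, ∀ k ≤ 𝓓.steps i, ∃ z ∈ frontier 𝓜.Ω,
    IsMinOn (fun x => v i k x - 𝓓.P i (ζ ε (k * 𝓓.h i)) x) (closure 𝓜.Ω) z
  limit : ∀ t ∈ Icc 0 𝓜.T, ∃ q : ℝ → Eu d,
    (∀ ε > 0, q ε ∈ frontier 𝓜.Ω ∧ IsMinOn (fun x => 𝓜.g x - ζ ε t x) (frontier 𝓜.Ω) (q ε)) ∧
    Tendsto q (𝓝[>] 0) (𝓝 y) ∧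
    ∃ l ≥ 0, Tendsto (fun ε => ζ ε t y - ζ ε t (q ε)) (𝓝[>] 0) (𝓝 l)

/-- `ξ` is a family of lower barriers at the boundary point `y` for the numerical solutions `v`. -/
structure IsLowerBarrier (v : ℕ → ℕ → Eu d → ℝ) (y : Eu d) (ξ : ℝ → ℝ → Eu d → ℝ) : Prop where
  family : IsBarrierFamily 𝓜 𝓓 ξ
  maximiser : ∀ ε > 0, ∃ i₀, ∀ i ≥ i₀, ∀ k ≤ 𝓓.steps i, ∃ z ∈ frontier 𝓜.Ω,
    IsMaxOn (fun x => v i k x - 𝓓.P i (ξ ε (k * 𝓓.h i)) x) (closure 𝓜.Ω) z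
  limit : ∀ t ∈ Icc 0 𝓜.T, ∃ r : ℝ → Eu d,
    (∀ ε > 0, r ε ∈ frontier 𝓜.Ω ∧ IsMaxOn (fun x => 𝓜.g x - ξ ε t x) (frontier 𝓜.Ω) (r ε)) ∧
    Tendsto r (𝓝[>] 0) (𝓝 y) ∧
    ∃ l ≤ 0, Tendsto (fun ε => ξ ε t y - ξ ε t (r ε)) (𝓝[>] 0) (𝓝 l)

/-- Every point of `ω ⊆ ∂Ω` has families of upper and of lower barriers. -/
structure HasBarriers (ω : Set (Eu d)) (v : ℕ → ℕ → Eu d → ℝ) : Prop where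
  subset : ω ⊆ frontier 𝓜.Ω
  upper : ∀ y ∈ ω, ∃ ζ, IsUpperBarrier 𝓜 𝓓 v y ζ
  lower : ∀ y ∈ ω, ∃ ξ, IsLowerBarrier 𝓜 𝓓 v y ξ

end Scheme

end IsaacsFEM

end

open Set Filter Topology MeasureTheory
open scoped NNReal ENNReal

noncomputable section

namespace IsaacsFEM

/-! ## Barycentric coordinates and hat functions -/

section Barycentric

variable {d : ℕ}

/-! The proof is the method of half-relaxed limits of Barles and Souganidis: stability, monotonicity
and consistency of the scheme force the envelopes of its solutions to be viscosity sub- and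
supersolutions. A sign `σ = ±1` merges the two halves. The functions `σ • v` solve an equation with
`inf sup` or `sup inf` (`signedInfSup`), and the lower envelope of `v` is minus the upper envelope
of `-v`, so only upper envelopes need to be studied.

Consistency (`IsStableScheme.consistency`) rests on the elliptic projection. Tested with the hat
function of an internal node, the Dirichlet form of `P η` equals that of `η`, and Green's formula
turns it into minus an average of `Δη` near the node. This is available because such a hat function
vanishes outside `Ω`, where the Lipschitz boundary enters. Since the diffusion coefficient is frozen
at the node, no second derivative of `P η` is required; the lower order terms converge because `P η
→ η` in the `W^{1,∞}` norm.

Monotonicity enters through `IsSignedSolution.touching`: a discrete function that touches the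
solution from above inherits the discrete inequality. This yields a comparison principle, and
comparison with `P η + C (T - t)` gives both stability (constant `η`) and the bound at the final
time (`η` slightly above `σ vT`).

For the viscosity inequality, a local maximum of `u - ψ` is replaced by a strict global one for a
test function of the form `θ(t) + η(x)`, with Young's inequality absorbing the mixed second
derivatives. Thus `P` is applied to a time-independent smooth function only. Discrete maximisers
converge to the strict maximum, `touching` and consistency apply there, and the operator is at most
`e` arbitrarily near the jet. At a boundary point either `u ≤ σ g`, which is the inequality wanted,
or the nearby maximisers are internal nodes.

The Dirichlet condition on `ω` follows by moving the extremum of `v - P ζ` to the boundary, where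
`v` is close to `g`, and letting `ε → 0`. Upper bounds for both signs squeeze the two envelopes
together, which gives the strong conditions (`IsUpperLimit.env_eq`). -/

lemma affineMap_apply_sum (L : Eu d →ᵃ[ℝ] ℝ) {s : Finset (Eu d)} {w : Eu d → ℝ}
    (hw : ∑ z ∈ s, w z = 1) : L (∑ z ∈ s, w z • z) = ∑ z ∈ s, w z * L z := by
  have h : ∀ x, L x = L.linear x + L 0 := fun x => congrFun L.decomp x
  have h' : ∑ z ∈ s, w z * L z = ∑ z ∈ s, (w z * L.linear z + w z * L 0) :=
    Finset.sum_congr rfl fun z _ => by rw [h z, mul_add]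
  rw [h, map_sum, h', Finset.sum_add_distrib, ← Finset.sum_mul, hw, one_mul]
  simp only [map_smul, smul_eq_mul]

/-- Extending the vertices to an affine basis of the whole space makes the barycentric coordinate a
globally defined, hence continuous, affine map. -/
lemma exists_affine_coord {s : Finset (Eu d)} (hs : AffineIndependent ℝ ((↑) : s → Eu d))
    {y : Eu d} (hy : y ∈ s) :
    ∃ L : Eu d →ᵃ[ℝ] ℝ, L y = 1 ∧ ∀ z ∈ s, z ≠ y → L z = 0 := by
  obtain ⟨t, hst, ht, htop⟩ := exists_subset_affineIndependent_affineSpan_eq_top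
    (k := ℝ) (s := (s : Set (Eu d))) hs
  let b : AffineBasis t ℝ (Eu d) := ⟨((↑) : t → Eu d), ht, by rw [Subtype.range_coe]; exact htop⟩
  have hb : ∀ z : t, b z = z := fun _ => rfl
  refine ⟨b.coord ⟨y, hst hy⟩, ?_, fun z hz hzy => ?_⟩
  · have := b.coord_apply_eq ⟨y, hst hy⟩
    rwa [hb] at this
  · have := b.coord_apply_ne (i := ⟨y, hst hy⟩) (j := ⟨z, hst hz⟩)
      (fun h => hzy (congrArg Subtype.val h).symm)
    rwa [hb] at this

/-- `w` is the family of barycentric coordinates of `x` in the simplex with vertices `s`. -/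
structure IsBary (s : Finset (Eu d)) (w : Eu d → ℝ) (x : Eu d) : Prop where
  nonneg : ∀ z ∈ s, 0 ≤ w z
  support : ∀ z, z ∉ s → w z = 0
  sum_one : ∑ z ∈ s, w z = 1
  sum_smul : ∑ z ∈ s, w z • z = x

lemma exists_isBary {s : Finset (Eu d)} {x : Eu d} (hx : x ∈ convexHull ℝ (s : Set (Eu d))) :
    ∃ w, IsBary s w x := by
  classical
  obtain ⟨w, h0, h1, h2⟩ := Finset.mem_convexHull'.1 hx
  refine ⟨fun z => if z ∈ s then w z else 0, fun z hz => by simpa [hz] using h0 z hz,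
    fun z hz => by simp [hz], ?_, ?_⟩
  · rw [← h1]; exact Finset.sum_congr rfl fun z hz => by simp [hz]
  · rw [← h2]; exact Finset.sum_congr rfl fun z hz => by simp [hz]

lemma IsBary.mem_convexHull {s : Finset (Eu d)} {w : Eu d → ℝ} {x : Eu d} (h : IsBary s w x) :
    x ∈ convexHull ℝ (s : Set (Eu d)) :=
  Finset.mem_convexHull'.2 ⟨w, h.nonneg, h.sum_one, h.sum_smul⟩

lemma IsBary.apply_coord {s : Finset (Eu d)} {w : Eu d → ℝ} {x : Eu d} (h : IsBary s w x)
    {y : Eu d} (hy : y ∈ s) {L : Eu d →ᵃ[ℝ] ℝ} (h1 : L y = 1) (h0 : ∀ z ∈ s, z ≠ y → L z = 0) :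
    L x = w y := by
  rw [← h.sum_smul, affineMap_apply_sum L h.sum_one, Finset.sum_eq_single_of_mem y hy, h1, mul_one]
  intro z hz hzy
  rw [h0 z hz hzy, mul_zero]

lemma IsBary.unique {s : Finset (Eu d)} (hs : AffineIndependent ℝ ((↑) : s → Eu d))
    {w w' : Eu d → ℝ} {x : Eu d} (h : IsBary s w x) (h' : IsBary s w' x) : w = w' := by
  funext y
  by_cases hy : y ∈ s
  · obtain ⟨L, h1, h0⟩ := exists_affine_coord hs hy
    rw [← h.apply_coord hy h1 h0, h'.apply_coord hy h1 h0]
  · rw [h.support y hy, h'.support y hy]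

lemma IsBary.mono {s t : Finset (Eu d)} {w : Eu d → ℝ} {x : Eu d} (h : IsBary s w x)
    (hst : s ⊆ t) : IsBary t w x where
  nonneg z _ := by
    by_cases hz : z ∈ s
    · exact h.nonneg z hz
    · exact (h.support z hz).ge
  support z hz := h.support z fun h' => hz (hst h')
  sum_one := by
    rw [← h.sum_one]
    exact (Finset.sum_subset hst fun z _ hz => h.support z hz).symm
  sum_smul := by
    rw [← h.sum_smul]
    exact (Finset.sum_subset hst fun z _ hz => by rw [h.support z hz, zero_smul]).symm

variable {K : Geometry.SimplicialComplex ℝ (Eu d)}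

/-- This is conformity of the mesh: two simplices meet in the hull of their common vertices, and
coordinates with respect to these, extended by zero, serve in both simplices. -/
lemma isBary_eq_of_faces {s t : Finset (Eu d)} (hs : s ∈ K.faces) (ht : t ∈ K.faces)
    {w w' : Eu d → ℝ} {x : Eu d} (h : IsBary s w x) (h' : IsBary t w' x) : w = w' := by
  classical
  have hx := K.inter_subset_convexHull hs ht ⟨h.mem_convexHull, h'.mem_convexHull⟩
  rw [← Finset.coe_inter] at hx
  obtain ⟨u, hu⟩ := exists_isBary hx
  rw [h.unique (K.indep hs) (hu.mono Finset.inter_subset_left),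
    h'.unique (K.indep ht) (hu.mono Finset.inter_subset_right)]

/-- Independence of the face makes the set in the definition a singleton, so its supremum is a
genuine value. -/
lemma hat_eq {s : Finset (Eu d)} (hs : s ∈ K.faces) {w : Eu d → ℝ} {x : Eu d}
    (h : IsBary s w x) (y : Eu d) : hat K y x = w y := by
  have : {c | ∃ s ∈ K.faces, ∃ w : Eu d → ℝ, (∀ z ∈ s, 0 ≤ w z) ∧ (∀ z, z ∉ s → w z = 0) ∧
      ∑ z ∈ s, w z = 1 ∧ ∑ z ∈ s, w z • z = x ∧ c = w y} = {w y} := by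
    ext c
    constructor
    · rintro ⟨t, ht, w', h0, h1, h2, h3, rfl⟩
      rw [mem_singleton_iff, isBary_eq_of_faces hs ht h ⟨h0, h1, h2, h3⟩]
    · rintro rfl
      exact ⟨s, hs, w, h.nonneg, h.support, h.sum_one, h.sum_smul, rfl⟩
  rw [hat, this, csSup_singleton]

lemma hat_eq_zero_of_notMem_space {x : Eu d} (hx : x ∉ K.space) (y : Eu d) : hat K y x = 0 := by
  have : {c | ∃ s ∈ K.faces, ∃ w : Eu d → ℝ, (∀ z ∈ s, 0 ≤ w z) ∧ (∀ z, z ∉ s → w z = 0) ∧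
      ∑ z ∈ s, w z = 1 ∧ ∑ z ∈ s, w z • z = x ∧ c = w y} = ∅ := by
    refine eq_empty_of_forall_notMem ?_
    rintro c ⟨t, ht, w', h0, h1, h2, h3, rfl⟩
    exact hx (Geometry.SimplicialComplex.mem_space_iff.2
      ⟨t, ht, IsBary.mem_convexHull ⟨h0, h1, h2, h3⟩⟩)
  rw [hat, this, Real.sSup_empty]

lemma isBary_hat {s : Finset (Eu d)} (hs : s ∈ K.faces) {x : Eu d}
    (hx : x ∈ convexHull ℝ (s : Set (Eu d))) : IsBary s (fun y => hat K y x) x := by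
  obtain ⟨w, hw⟩ := exists_isBary hx
  rwa [show (fun y => hat K y x) = w from funext fun y => hat_eq hs hw y]

lemma hat_nonneg (y x : Eu d) : 0 ≤ hat K y x := by
  by_cases hx : x ∈ K.space
  · obtain ⟨s, hs, hxs⟩ := Geometry.SimplicialComplex.mem_space_iff.1 hx
    have h := isBary_hat hs hxs
    by_cases hy : y ∈ s
    · exact h.nonneg y hy
    · exact (h.support y hy).ge
  · exact (hat_eq_zero_of_notMem_space hx y).ge

lemma hat_affine {s : Finset (Eu d)} (hs : s ∈ K.faces) (y : Eu d) :
    ∃ L : Eu d →ᵃ[ℝ] ℝ, EqOn (hat K y) L (convexHull ℝ (s : Set (Eu d))) := by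
  by_cases hy : y ∈ s
  · obtain ⟨L, h1, h0⟩ := exists_affine_coord (K.indep hs) hy
    exact ⟨L, fun x hx => ((isBary_hat hs hx).apply_coord hy h1 h0).symm⟩
  · exact ⟨AffineMap.const ℝ _ 0, fun x hx => (isBary_hat hs hx).support y hy⟩

lemma isP1_hat (y : Eu d) : IsP1 K (hat K y) := fun _ hs => hat_affine hs y

lemma hat_self {y : Eu d} (hy : y ∈ K.vertices) : hat K y y = 1 := by
  have h := isBary_hat (x := y) (K.mem_vertices.1 hy) (subset_convexHull ℝ _ (by simp))
  simpa using h.sum_one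

lemma mem_vertices_of_mem_face {s : Finset (Eu d)} (hs : s ∈ K.faces) {y : Eu d} (hy : y ∈ s) :
    y ∈ K.vertices := by
  rw [Geometry.SimplicialComplex.vertices_eq]
  exact mem_biUnion hs hy

lemma finite_vertices (hK : K.faces.Finite) : K.vertices.Finite := by
  rw [Geometry.SimplicialComplex.vertices_eq]
  exact hK.biUnion fun s _ => s.finite_toSet

/-- Through this expansion, sign conditions on the matrix entries of `E` become statements about `E`
on all of `Vᵢ`. -/
lemma sum_hat_eq (N : Finset (Eu d)) (hN : ∀ z, z ∈ N ↔ z ∈ K.vertices) {u : Eu d → ℝ}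
    (hu : IsP1 K u) {x : Eu d} (hx : x ∈ K.space) : u x = ∑ z ∈ N, u z * hat K z x := by
  obtain ⟨s, hs, hxs⟩ := Geometry.SimplicialComplex.mem_space_iff.1 hx
  obtain ⟨L, hL⟩ := hu s hs
  have h := isBary_hat hs hxs
  have hsN : s ⊆ N := fun z hz => (hN z).2 (mem_vertices_of_mem_face hs hz)
  rw [← Finset.sum_subset hsN fun z _ hz => by rw [h.support z hz, mul_zero], hL hxs]
  conv_lhs => rw [← h.sum_smul]
  rw [affineMap_apply_sum L h.sum_one]
  refine Finset.sum_congr rfl fun z hz => ?_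
  rw [hL (subset_convexHull ℝ _ hz), mul_comm]

lemma IsP1.add {u v : Eu d → ℝ} (hu : IsP1 K u) (hv : IsP1 K v) : IsP1 K (u + v) := by
  intro s hs
  obtain ⟨L, hL⟩ := hu s hs
  obtain ⟨M, hM⟩ := hv s hs
  exact ⟨L + M, fun x hx => by simp [hL hx, hM hx]⟩

lemma IsP1.smul {u : Eu d → ℝ} (hu : IsP1 K u) (r : ℝ) : IsP1 K (r • u) := by
  intro s hs
  obtain ⟨L, hL⟩ := hu s hs
  exact ⟨r • L, fun x hx => by simp [hL hx]⟩

lemma isP1_const (r : ℝ) : IsP1 K (fun _ => r) :=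
  fun _ _ => ⟨AffineMap.const ℝ _ r, fun _ _ => rfl⟩

/-- On a simplex both functions are convex combinations of their vertex values with the same
weights. Extrema over the nodes thereby become the local extrema that `localMonotonicity` asks for.
-/
lemma IsP1.le_of_vertices {u v : Eu d → ℝ} (hu : IsP1 K u) (hv : IsP1 K v)
    (h : ∀ z ∈ K.vertices, u z ≤ v z) {x : Eu d} (hx : x ∈ K.space) : u x ≤ v x := by
  obtain ⟨s, hs, hxs⟩ := Geometry.SimplicialComplex.mem_space_iff.1 hx
  obtain ⟨L, hL⟩ := hu s hs
  obtain ⟨M, hM⟩ := hv s hs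
  have hb := isBary_hat hs hxs
  rw [hL hxs, hM hxs, ← hb.sum_smul, affineMap_apply_sum L hb.sum_one,
    affineMap_apply_sum M hb.sum_one]
  refine Finset.sum_le_sum fun z hz => mul_le_mul_of_nonneg_left ?_ (hb.nonneg z hz)
  rw [← hL (subset_convexHull ℝ _ hz), ← hM (subset_convexHull ℝ _ hz)]
  exact h z (mem_vertices_of_mem_face hs hz)

lemma isCompact_face (s : Finset (Eu d)) : IsCompact (convexHull ℝ (s : Set (Eu d))) :=
  s.finite_toSet.isCompact_convexHull ℝ

lemma IsP1.continuousOn (hK : K.faces.Finite) {u : Eu d → ℝ} (hu : IsP1 K u) :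
    ContinuousOn u K.space := by
  have : K.space = ⋃ s : K.faces, convexHull ℝ ((s : Finset (Eu d)) : Set (Eu d)) := by
    simp [Geometry.SimplicialComplex.space, iUnion_subtype]
  rw [this]
  have : Finite K.faces := hK
  refine (locallyFinite_of_finite _).continuousOn_iUnion
    (fun s => (isCompact_face (s : Finset (Eu d))).isClosed) fun s => ?_
  obtain ⟨L, hL⟩ := hu s s.2
  exact L.continuous_of_finiteDimensional.continuousOn.congr hL

lemma dist_le_of_hat_ne_zero {δ : ℝ}
    (hδ : ∀ s ∈ K.faces, Metric.diam (convexHull ℝ (s : Set (Eu d))) ≤ δ)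
    {x y : Eu d} (h : hat K y x ≠ 0) : dist x y ≤ δ := by
  have hx : x ∈ K.space := by
    by_contra hx
    exact h (hat_eq_zero_of_notMem_space hx y)
  obtain ⟨s, hs, hxs⟩ := Geometry.SimplicialComplex.mem_space_iff.1 hx
  have hy : y ∈ s := by
    by_contra hy
    exact h ((isBary_hat hs hxs).support y hy)
  exact (Metric.dist_le_diam_of_mem (isCompact_face s).isBounded hxs
    (subset_convexHull ℝ _ hy)).trans (hδ s hs)

end Barycentric

/-! ## Meshes of Lipschitz domains -/

section Mesh

variable {d : ℕ}

/-- `Ω` lies on one side of its boundary: moving from `x` along the axis `n` keeps `φ` fixed and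
raises the height, so arbitrarily close points lie strictly above the graph and thus outside the
closure. -/
lemma IsLipschitzDomain.notMem_interior_closure {Ω : Set (Eu d)} (hΩ : IsLipschitzDomain Ω)
    {x : Eu d} (hx : x ∈ frontier Ω) : x ∉ interior (closure Ω) := by
  intro hi
  obtain ⟨n, r, L, φ, hn, hr, hφ, hinv, hgraph⟩ := hΩ.graph x hx
  have hxΩ : x ∉ Ω := fun h => (hΩ.isOpen.frontier_eq ▸ hx).2 h
  have hφx : φ x ≤ inner ℝ n x := by
    by_contra h
    exact hxΩ ((hgraph x (Metric.mem_ball_self hr)).2 (not_le.1 h))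
  have hout : ∀ y ∈ Metric.ball x r, φ y < inner ℝ n y → y ∉ closure Ω := by
    intro y hy hlt hcl
    have hev : ∀ᶠ z in 𝓝 y, z ∈ Metric.ball x r ∧ φ z < inner ℝ n z :=
      (Eventually.and (Metric.isOpen_ball.mem_nhds hy)
        ((hφ.continuous.tendsto y).eventually_lt ((by fun_prop :
          Continuous fun z : Eu d => (inner ℝ n z : ℝ)).tendsto y) hlt))
    obtain ⟨z, ⟨hz1, hz2⟩, hz3⟩ := mem_closure_iff_nhds.1 hcl _ hev
    exact lt_asymm hz2 ((hgraph z hz1).1 hz3)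
  have htend : Tendsto (fun s : ℝ => x + s • n) (𝓝[>] 0) (𝓝 x) := by
    have : Tendsto (fun s : ℝ => x + s • n) (𝓝 0) (𝓝 (x + (0 : ℝ) • n)) :=
      Continuous.tendsto (by fun_prop) 0
    rw [zero_smul, add_zero] at this
    exact this.mono_left nhdsWithin_le_nhds
  obtain ⟨s, ⟨hs1, hs2⟩, hs0⟩ := (((htend.eventually (mem_interior_iff_mem_nhds.1 hi)).and
    (htend.eventually (Metric.ball_mem_nhds x hr))).and self_mem_nhdsWithin).exists
  refine hout _ hs2 ?_ hs1
  rw [hinv, inner_add_right, inner_smul_right, real_inner_self_eq_norm_sq, hn]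
  have : (0 : ℝ) < s := hs0
  linarith

variable {K : Geometry.SimplicialComplex ℝ (Eu d)}

/-- The open star of a vertex in the interior of a mesh is contained in the interior. -/
lemma mem_interior_space_of_hat_ne_zero (hK : K.faces.Finite) {x y : Eu d}
    (hy : y ∈ interior K.space) (hxy : hat K y x ≠ 0) :
    x ∈ interior K.space := by
  have hxs : x ∈ K.space := by
    by_contra h
    exact hxy (hat_eq_zero_of_notMem_space h y)
  obtain ⟨s, hs, hxs⟩ := Geometry.SimplicialComplex.mem_space_iff.1 hxs
  have hb := isBary_hat hs hxs
  set w : Eu d → ℝ := fun z => hat K z x with hw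
  have hys : y ∈ s := by
    by_contra h
    exact hxy (hb.support y h)
  -- a point of the segment from `x` to `y` that is close to `y`
  have htend : Tendsto (fun l : ℝ => (1 - l) • x + l • y) (𝓝[<] 1) (𝓝 y) := by
    have : Tendsto (fun l : ℝ => (1 - l) • x + l • y) (𝓝 1) (𝓝 (((1 : ℝ) - 1) • x + (1 : ℝ) • y)) :=
      Continuous.tendsto (by fun_prop) 1
    rw [sub_self, zero_smul, zero_add, one_smul] at this
    exact this.mono_left nhdsWithin_le_nhds
  obtain ⟨l, hl, hl0, hl1⟩ := ((htend.eventually (isOpen_interior.mem_nhds hy)).and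
    (Ioo_mem_nhdsLT (zero_lt_one' ℝ))).exists
  set q₀ := (1 - l) • x + l • y with hq₀
  classical
  set wl : Eu d → ℝ := fun z => (1 - l) * w z + if z = y then l else 0 with hwl
  have hbl : IsBary s wl q₀ := by
    refine ⟨fun z hz => ?_, fun z hz => ?_, ?_, ?_⟩
    · have := hb.nonneg z hz
      have h1 : 0 ≤ (1 - l) * w z := mul_nonneg (by linarith) this
      simp only [hwl]; split_ifs <;> linarith
    · have : z ≠ y := fun h => hz (h ▸ hys)
      simp [hwl, hb.support z hz, this]
    · simp only [hwl, Finset.sum_add_distrib, ← Finset.mul_sum, hb.sum_one]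
      simp [hys]
    · simp only [hwl, add_smul, Finset.sum_add_distrib, mul_smul, ← Finset.smul_sum, hb.sum_smul]
      simp [ite_smul, hys, hq₀]
  rw [mem_interior_iff_mem_nhds]
  -- the translation that maps `x` to `q₀`
  have hmap : Tendsto (fun p : Eu d => p + (q₀ - x)) (𝓝 x) (𝓝 q₀) := by
    have : Tendsto (fun p : Eu d => p + (q₀ - x)) (𝓝 x) (𝓝 (x + (q₀ - x))) :=
      Continuous.tendsto (by fun_prop) x
    rwa [add_sub_cancel] at this
  -- Translation by `q₀ - x` carries a neighbourhood of `x` into the mesh. It remains to see, face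
  -- by face, that membership of the translate in `t` can be pulled back to `p`.
  have hstep : ∀ t ∈ K.faces, ∀ᶠ p in 𝓝 x,
      p + (q₀ - x) ∈ convexHull ℝ (t : Set (Eu d)) → p ∈ convexHull ℝ (t : Set (Eu d)) := by
    intro t ht
    by_cases hqt : q₀ ∈ convexHull ℝ (t : Set (Eu d))
    · have hbt : IsBary t wl q₀ := by
        obtain ⟨w', hw'⟩ := exists_isBary hqt
        rwa [isBary_eq_of_faces hs ht hbl hw']
      -- The coordinates of `q₀` are positive wherever those of `x` are, so a face that contains
      -- `q₀` contains every vertex that carries `x`.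
      have hwt : ∀ z, z ∉ t → w z = 0 := by
        intro z hz
        by_cases hzs : z ∈ s
        · have h0 := hbt.support z hz
          have h1 := hb.nonneg z hzs
          simp only [hwl] at h0
          have h2 : 0 ≤ (1 - l) * w z := mul_nonneg (by linarith) h1
          have h3 : (1 - l) * w z = 0 := by split_ifs at h0 <;> linarith
          exact (mul_eq_zero.1 h3).resolve_left (by linarith)
        · exact hb.support z hzs
      have hyt : y ∈ t := by
        by_contra h
        exact hxy (hwt y h)
      have hbx : IsBary t w x := by
        refine ⟨fun z _ => hat_nonneg z x, hwt, ?_, ?_⟩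
        · have h1 := hbt.sum_one
          simp only [hwl, Finset.sum_add_distrib, ← Finset.mul_sum, Finset.sum_ite_eq', hyt,
            if_true] at h1
          have : (1 - l) * (∑ z ∈ t, w z - 1) = 0 := by linarith
          linarith [(mul_eq_zero.1 this).resolve_left (by linarith)]
        · have h1 := hbt.sum_smul
          simp only [hwl, add_smul, Finset.sum_add_distrib, mul_smul, ← Finset.smul_sum, ite_smul,
            zero_smul, Finset.sum_ite_eq', hyt, if_true, hq₀] at h1
          have h2 : (1 - l) • (∑ z ∈ t, w z • z) = (1 - l) • x := add_right_cancel h1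
          exact smul_right_injective _ (by linarith : (1 - l) ≠ 0) h2
      -- The candidate coordinates of `p` are those of its translate, minus those of `q₀`, plus
      -- those of `x`. If `w z = 0` then also `wl z = 0`, because `z ≠ y`; if `w z > 0`, continuity
      -- of the coordinate leaves room.
      have hpos : ∀ z ∈ t, ∀ᶠ p in 𝓝 x, p + (q₀ - x) ∈ convexHull ℝ (t : Set (Eu d)) →
          ∀ a, IsBary t a (p + (q₀ - x)) → 0 ≤ a z - wl z + w z := by
        intro z hz
        obtain ⟨L, h1, h0⟩ := exists_affine_coord (K.indep ht) hz
        have hLx : L x = w z := hbx.apply_coord hz h1 h0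
        have hLq : L q₀ = wl z := hbt.apply_coord hz h1 h0
        rcases (hat_nonneg z x).eq_or_lt with hz0 | hz0
        · refine Eventually.of_forall fun p _ a ha => ?_
          have hzy : z ≠ y := by
            rintro rfl
            exact hxy hz0.symm
          have : wl z = 0 ∧ w z = 0 := by
            have : w z = 0 := hz0.symm
            simp [hwl, this, hzy]
          rw [this.1, this.2, sub_zero, add_zero]
          exact ha.nonneg z hz
        · have hcont : Continuous fun p => L p := L.continuous_of_finiteDimensional
          have h2 : Tendsto (fun p => L (p + (q₀ - x))) (𝓝 x) (𝓝 (L q₀)) :=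
            (hcont.tendsto q₀).comp hmap
          have h3 : ∀ᶠ p in 𝓝 x, L q₀ - w z < L (p + (q₀ - x)) :=
            h2.eventually (lt_mem_nhds (by linarith [show 0 < w z from hz0]))
          filter_upwards [h3] with p hp _ a ha
          rw [ha.apply_coord hz h1 h0, hLq] at hp
          linarith
      have hall := (Filter.eventually_all_finset t).2 hpos
      filter_upwards [hall] with p hp hpt
      obtain ⟨a, ha⟩ := exists_isBary hpt
      refine IsBary.mem_convexHull (w := fun z => a z - wl z + w z)
        ⟨fun z hz => hp z hz hpt a ha, fun z hz => ?_, ?_, ?_⟩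
      · rw [ha.support z hz, hbt.support z hz, hwt z hz]; ring
      · simp only [Finset.sum_add_distrib, Finset.sum_sub_distrib, ha.sum_one, hbt.sum_one,
          hbx.sum_one]; ring
      · simp only [add_smul, sub_smul, Finset.sum_add_distrib, Finset.sum_sub_distrib, ha.sum_smul,
          hbt.sum_smul, hbx.sum_smul]; abel
    · have : ∀ᶠ q in 𝓝 q₀, q ∉ convexHull ℝ (t : Set (Eu d)) :=
        (isCompact_face t).isClosed.isOpen_compl.mem_nhds hqt
      filter_upwards [hmap.eventually this] with p hp h
      exact absurd h hp
  have hall := (Filter.eventually_all_finite hK).2 hstep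
  filter_upwards [hall, hmap.eventually (mem_interior_iff_mem_nhds.1 hl)] with p hp hpq
  obtain ⟨t, ht, hpt⟩ := Geometry.SimplicialComplex.mem_space_iff.1 hpq
  exact Geometry.SimplicialComplex.mem_space_iff.2 ⟨t, ht, hp t ht hpt⟩

lemma hat_eq_zero_of_notMem {Ω : Set (Eu d)} (hΩ : IsLipschitzDomain Ω) (hK : K.faces.Finite)
    (hsp : K.space = closure Ω) {x y : Eu d} (hy : y ∈ Ω) (hx : x ∉ Ω) : hat K y x = 0 := by
  by_contra h
  have hyi : y ∈ interior K.space := by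
    rw [hsp]
    exact interior_mono subset_closure (hΩ.isOpen.interior_eq.symm ▸ hy)
  have hxi := mem_interior_space_of_hat_ne_zero hK hyi h
  rw [hsp] at hxi
  exact hΩ.notMem_interior_closure ⟨interior_subset hxi, fun h' => hx (interior_subset h')⟩ hxi

/-- Along the segment from `x` to `y`, one of the finitely many closed pieces recurs immediately to
the right of each time and contains the point at that time. This bounds the lower right slope, and
the mean value inequality for such slopes concludes. The pieces need not be convex. -/
lemma LipschitzWith.of_finite_closed_cover {E ι : Type*} [NormedAddCommGroup E] [NormedSpace ℝ E]
    [Finite ι] {S : ι → Set E} (hS : ∀ j, IsClosed (S j)) (hcov : ∀ x, ∃ j, x ∈ S j) {f : E → ℝ}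
    (hf : Continuous f) {C : ℝ≥0} (hC : ∀ j, LipschitzOnWith C f (S j)) : LipschitzWith C f := by
  refine LipschitzWith.of_le_add_mul C fun y x => ?_
  let c : ℝ → E := fun t => x + t • (y - x)
  have hc : Continuous c := by fun_prop
  have key := image_le_of_liminf_slope_right_le_deriv_boundary (f := f ∘ c) (a := 0) (b := 1)
    (B := fun t => f x + t * (C * dist y x)) (B' := fun _ => C * dist y x)
    (hf.comp hc).continuousOn (by simp [c]) (by fun_prop)
    (fun t _ => by
      simpa using (((hasDerivAt_id t).mul_const ((C : ℝ) * dist y x)).const_add (f x)).hasDerivWithinAt)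
    (fun t _ r hr => ?_)
  · simpa [c] using key (right_mem_Icc.2 zero_le_one)
  · have hex : ∃ᶠ z in 𝓝[>] t, ∃ j, c z ∈ S j :=
      (Eventually.of_forall fun z => hcov (c z)).frequently
    obtain ⟨j, hj⟩ := Filter.frequently_exists.1 hex
    have hjt : c t ∈ S j := by
      have : t ∈ closure {z | c z ∈ S j} := mem_closure_iff_frequently.2
        (hj.filter_mono nhdsWithin_le_nhds)
      exact ((hS j).preimage hc).closure_subset this
    refine (hj.and_eventually self_mem_nhdsWithin).mono fun z ⟨hz, hzt⟩ => ?_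
    have hzt : 0 < z - t := sub_pos.2 hzt
    refine lt_of_le_of_lt ?_ hr
    rw [slope_def_field, div_le_iff₀ hzt]
    have h1 := (hC j).dist_le_mul _ hz _ hjt
    have h2 : dist (c z) (c t) = (z - t) * dist y x := by
      simp only [c, dist_eq_norm, add_sub_add_left_eq_sub, ← sub_smul, norm_smul, Real.norm_eq_abs,
        abs_of_pos hzt]
    rw [h2] at h1
    have h3 := (le_abs_self _).trans ((Real.dist_eq _ _).symm.trans_le h1)
    simp only [Function.comp_apply]
    linarith

lemma AffineMap.exists_lipschitzWith (L : Eu d →ᵃ[ℝ] ℝ) : ∃ C, LipschitzWith C L := by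
  refine ⟨‖L.linear.toContinuousLinearMap‖₊, LipschitzWith.of_dist_le_mul fun x y => ?_⟩
  have := L.linear.toContinuousLinearMap.le_opNorm (x - y)
  rw [dist_eq_norm, dist_eq_norm]
  refine (le_of_eq ?_).trans this
  congr 1
  simpa using (L.linearMap_vsub x y).symm

/-- The simplices and the complement of `Ω` form a finite closed cover. A Lipschitz bound on the
whole space is what integration by parts without boundary terms requires. -/
lemma IsP1.exists_lipschitzWith {Ω : Set (Eu d)} (hΩ : IsOpen Ω) (hK : K.faces.Finite)
    (hsp : K.space = closure Ω) {u : Eu d → ℝ} (hu : IsP1 K u) (h0 : ∀ x, x ∉ Ω → u x = 0) :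
    ∃ C, LipschitzWith C u := by
  classical
  have hex : ∀ s : K.faces, ∃ C, LipschitzOnWith C u (convexHull ℝ ((s : Finset (Eu d)) : Set _)) := by
    intro s
    obtain ⟨L, hL⟩ := hu s s.2
    obtain ⟨C, hC⟩ := AffineMap.exists_lipschitzWith L
    exact ⟨C, fun x hx y hy => by rw [hL hx, hL hy]; exact hC x y⟩
  choose C hC using hex
  have : Fintype K.faces := hK.fintype
  let S : Option K.faces → Set (Eu d) := fun o =>
    o.elim Ωᶜ fun s => convexHull ℝ ((s : Finset (Eu d)) : Set _)
  have hclosed : ∀ o, IsClosed (S o) := by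
    rintro (_ | s)
    · exact hΩ.isClosed_compl
    · exact (isCompact_face _).isClosed
  have hcov : ∀ x, ∃ o, x ∈ S o := by
    intro x
    by_cases hx : x ∈ Ω
    · obtain ⟨s, hs, hxs⟩ := Geometry.SimplicialComplex.mem_space_iff.1
        (show x ∈ K.space from hsp ▸ subset_closure hx)
      exact ⟨some ⟨s, hs⟩, hxs⟩
    · exact ⟨none, hx⟩
  have hlip : ∀ o, LipschitzOnWith (∑ s, C s) u (S o) := by
    rintro (_ | s)
    · intro x hx y hy
      rw [h0 x hx, h0 y hy, edist_self]
      exact zero_le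
    · exact (hC s).weaken (Finset.single_le_sum (fun _ _ => zero_le) (Finset.mem_univ s))
  refine ⟨∑ s, C s, LipschitzWith.of_finite_closed_cover hclosed hcov ?_ hlip⟩
  have huniv : (⋃ o, S o) = univ := eq_univ_of_forall fun x => mem_iUnion.2 (hcov x)
  rw [← continuousOn_univ, ← huniv]
  exact (locallyFinite_of_finite S).continuousOn_iUnion hclosed fun o => (hlip o).continuousOn

/-- The frontier of a convex set is a null set. Faces of lower dimension need no separate treatment,
as they are contained in their frontier. -/
lemma ae_mem_interior_face {Ω : Set (Eu d)} (hΩ : IsOpen Ω) (hK : K.faces.Finite)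
    (hsp : K.space = closure Ω) :
    ∀ᵐ x ∂volume.restrict Ω, ∃ s ∈ K.faces, x ∈ interior (convexHull ℝ (s : Set (Eu d))) := by
  have h : ∀ s ∈ K.faces, ∀ᵐ x ∂volume.restrict Ω, x ∉ frontier (convexHull ℝ (s : Set (Eu d))) :=
    fun s _ => ae_restrict_of_ae (measure_eq_zero_iff_ae_notMem.1
      ((convex_convexHull ℝ (s : Set (Eu d))).addHaar_frontier volume))
  filter_upwards [(ae_ball_iff hK.countable).2 h, ae_restrict_mem hΩ.measurableSet] with x hx hxΩ
  obtain ⟨s, hs, hxs⟩ := Geometry.SimplicialComplex.mem_space_iff.1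
    (show x ∈ K.space from hsp ▸ subset_closure hxΩ)
  refine ⟨s, hs, ?_⟩
  by_contra hi
  exact hx s hs ⟨subset_closure hxs, hi⟩

end Mesh

/-! ## Almost everywhere differentiable functions and the Galerkin form -/

section Admissible

variable {d : ℕ}

lemma measurable_gradient (w : Eu d → ℝ) : Measurable (gradient w) :=
  (InnerProductSpace.toDual ℝ (Eu d)).symm.continuous.measurable.comp (measurable_fderiv ℝ w)

lemma gradient_add_smul {w₁ w₂ : Eu d → ℝ} {x : Eu d} (h₁ : DifferentiableAt ℝ w₁ x)
    (h₂ : DifferentiableAt ℝ w₂ x) (r : ℝ) :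
    gradient (w₁ + r • w₂) x = gradient w₁ x + r • gradient w₂ x := by
  simp only [gradient]
  rw [fderiv_add h₁ (h₂.const_smul r), fderiv_const_smul h₂, map_add, map_smulₛₗ]
  simp

/-- Essentially bounded functions that are almost everywhere differentiable, with essentially
bounded gradient. -/
structure AdmissibleOn (Ω : Set (Eu d)) (w : Eu d → ℝ) : Prop where
  diff : ∀ᵐ x ∂volume.restrict Ω, DifferentiableAt ℝ w x
  memLp : MemLp w ⊤ (volume.restrict Ω)
  memLp_gradient : MemLp (gradient w) ⊤ (volume.restrict Ω)

variable {Ω : Set (Eu d)}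

lemma AdmissibleOn.add_smul {w₁ w₂ : Eu d → ℝ} (h₁ : AdmissibleOn Ω w₁) (h₂ : AdmissibleOn Ω w₂)
    (r : ℝ) : AdmissibleOn Ω (w₁ + r • w₂) where
  diff := by
    filter_upwards [h₁.diff, h₂.diff] with x hx₁ hx₂ using hx₁.add (hx₂.const_smul r)
  memLp := h₁.memLp.add (h₂.memLp.const_smul r)
  memLp_gradient := by
    refine (h₁.memLp_gradient.add (h₂.memLp_gradient.const_smul r)).ae_eq ?_
    filter_upwards [h₁.diff, h₂.diff] with x hx₁ hx₂
    exact (gradient_add_smul hx₁ hx₂ r).symm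

lemma norm_gradient (w : Eu d → ℝ) (x : Eu d) : ‖gradient w x‖ = ‖fderiv ℝ w x‖ := by
  simp [gradient]

lemma exists_norm_le_of_bounded {F : Type*} [NormedAddCommGroup F] (hb : Bornology.IsBounded Ω)
    {w : Eu d → F} (hw : ContinuousOn w (closure Ω)) : ∃ M, ∀ x ∈ closure Ω, ‖w x‖ ≤ M := by
  obtain ⟨M, hM⟩ := (hb.isCompact_closure.image_of_continuousOn hw.norm).bddAbove
  exact ⟨M, fun x hx => hM ⟨x, hx, rfl⟩⟩

lemma memLp_top_of_continuousOn {F : Type*} [NormedAddCommGroup F] (hΩ : IsOpen Ω)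
    (hb : Bornology.IsBounded Ω) {w : Eu d → F} (hw : ContinuousOn w (closure Ω)) :
    MemLp w ⊤ (volume.restrict Ω) := by
  obtain ⟨M, hM⟩ := exists_norm_le_of_bounded hb hw
  refine memLp_top_of_bound ((hw.mono subset_closure).aestronglyMeasurable_of_isSeparable
    hΩ.measurableSet (TopologicalSpace.IsSeparable.of_separableSpace _)) M ?_
  filter_upwards [ae_restrict_mem hΩ.measurableSet] with x hx using hM x (subset_closure hx)

lemma admissibleOn_of_lipschitzWith (hΩ : IsOpen Ω) (hb : Bornology.IsBounded Ω) {C : ℝ≥0}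
    {w : Eu d → ℝ} (hw : LipschitzWith C w) : AdmissibleOn Ω w where
  diff := ae_restrict_of_ae hw.ae_differentiableAt
  memLp := memLp_top_of_continuousOn hΩ hb hw.continuous.continuousOn
  memLp_gradient := by
    refine memLp_top_of_bound (measurable_gradient w).aestronglyMeasurable C
      (Eventually.of_forall fun x => ?_)
    rw [norm_gradient]
    exact norm_fderiv_le_of_lipschitz ℝ hw

lemma continuous_gradient {w : Eu d → ℝ} (hw : ContDiff ℝ 1 w) : Continuous (gradient w) :=
  (InnerProductSpace.toDual ℝ (Eu d)).symm.continuous.comp (hw.continuous_fderiv (by simp))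

lemma admissibleOn_of_contDiff (hΩ : IsOpen Ω) (hb : Bornology.IsBounded Ω) {w : Eu d → ℝ}
    (hw : ContDiff ℝ 1 w) : AdmissibleOn Ω w where
  diff := Eventually.of_forall fun _ => hw.differentiable (by simp) _
  memLp := memLp_top_of_continuousOn hΩ hb hw.continuous.continuousOn
  memLp_gradient := memLp_top_of_continuousOn hΩ hb (continuous_gradient hw).continuousOn

variable {K : Geometry.SimplicialComplex ℝ (Eu d)}

lemma IsP1.admissibleOn (hΩ : IsOpen Ω) (hb : Bornology.IsBounded Ω) (hK : K.faces.Finite)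
    (hsp : K.space = closure Ω) {u : Eu d → ℝ} (hu : IsP1 K u) : AdmissibleOn Ω u := by
  choose! L hL using hu
  have hder : ∀ s ∈ K.faces, ∀ x ∈ interior (convexHull ℝ (s : Set (Eu d))),
      HasFDerivAt u (L s).linear.toContinuousLinearMap x := by
    intro s hs x hx
    have h1 : HasFDerivAt (L s) (L s).linear.toContinuousLinearMap x := by
      have h2 : (L s : Eu d → ℝ) = fun y => (L s).linear.toContinuousLinearMap y + L s 0 :=
        funext fun y => congrFun (L s).decomp y
      have h3 := ((L s).linear.toContinuousLinearMap.hasFDerivAt (x := x)).add_const (L s 0)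
      rwa [← h2] at h3
    exact h1.congr_of_eventuallyEq
      ((hL s hs).eventuallyEq_of_mem (mem_interior_iff_mem_nhds.1 hx))
  have hae := ae_mem_interior_face hΩ hK hsp
  refine ⟨?_, memLp_top_of_continuousOn hΩ hb
    (hsp ▸ IsP1.continuousOn hK (fun s hs => ⟨L s, hL s hs⟩)), ?_⟩
  · filter_upwards [hae] with x ⟨s, hs, hx⟩ using (hder s hs x hx).differentiableAt
  · obtain ⟨M, hM⟩ := (hK.image fun s => ‖(L s).linear.toContinuousLinearMap‖).bddAbove
    refine memLp_top_of_bound (measurable_gradient u).aestronglyMeasurable M ?_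
    filter_upwards [hae] with x ⟨s, hs, hx⟩
    rw [norm_gradient, (hder s hs x hx).fderiv]
    exact hM ⟨s, hs, rfl⟩

/-! ### Integration by parts -/

lemma MemLp.inner_top {μ : Measure (Eu d)} {F G : Eu d → Eu d} (hF : MemLp F ⊤ μ)
    (hG : MemLp G ⊤ μ) : MemLp (fun x => (inner ℝ (F x) (G x) : ℝ)) ⊤ μ := by
  refine memLp_top_of_bound (hF.1.inner hG.1) ((eLpNorm F ⊤ μ).toReal * (eLpNorm G ⊤ μ).toReal) ?_
  have h : ∀ {H : Eu d → Eu d}, MemLp H ⊤ μ → ∀ᵐ x ∂μ, ‖H x‖ ≤ (eLpNorm H ⊤ μ).toReal := by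
    intro H hH
    have h1 := ae_le_eLpNormEssSup (f := H) (μ := μ)
    filter_upwards [h1] with x hx
    rw [← eLpNorm_exponent_top] at hx
    have := ENNReal.toReal_mono hH.2.ne hx
    rwa [toReal_enorm] at this
  filter_upwards [h hF, h hG] with x hx1 hx2
  exact (norm_inner_le_norm _ _).trans (by gcongr)

lemma MemLp.mul_top {μ : Measure (Eu d)} {F G : Eu d → ℝ} (hF : MemLp F ⊤ μ)
    (hG : MemLp G ⊤ μ) : MemLp (fun x => F x * G x) ⊤ μ :=
  MemLp.mul (p := ⊤) (q := ⊤) (r := ⊤) hG hF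

lemma isFiniteMeasure_restrict (hb : Bornology.IsBounded Ω) :
    IsFiniteMeasure (volume.restrict Ω : Measure (Eu d)) :=
  ⟨by rw [Measure.restrict_apply_univ]; exact hb.measure_lt_top⟩

/-- By Rademacher's theorem the line derivatives exist almost everywhere and are given by the
gradient; the formula is tested with each fixed direction `v`. -/
lemma hasWeakGradient_of_lipschitzWith (hΩ : IsOpen Ω) (hb : Bornology.IsBounded Ω) {C : ℝ≥0}
    {w : Eu d → ℝ} (hw : LipschitzWith C w) : HasWeakGradient Ω w (gradient w) := by
  rintro φ ⟨hφ, hφc, hφs⟩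
  have : IsFiniteMeasure (volume.restrict Ω : Measure (Eu d)) := isFiniteMeasure_restrict hb
  have hφ1 : ContDiff ℝ 1 φ := hφ.of_le (by exact_mod_cast le_top)
  obtain ⟨D, hD⟩ := ContDiff.lipschitzWith_of_hasCompactSupport hφc hφ1 (by simp)
  have hzero : ∀ x, x ∉ Ω → φ x = 0 := fun x hx => image_eq_zero_of_notMem_tsupport
    fun h => hx (hφs h)
  have hgzero : ∀ x, x ∉ Ω → gradient φ x = 0 := by
    intro x hx
    have : φ =ᶠ[𝓝 x] fun _ => 0 := notMem_tsupport_iff_eventuallyEq.1 fun h => hx (hφs h)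
    rw [this.gradient_eq, gradient_fun_const]
  have hwA := admissibleOn_of_lipschitzWith hΩ hb hw
  have hφA := admissibleOn_of_contDiff hΩ hb hφ1
  have hi1 : Integrable (fun x => w x • gradient φ x) (volume.restrict Ω) :=
    (MemLp.smul (p := ⊤) (q := ⊤) (r := ⊤) hφA.memLp_gradient hwA.memLp).integrable le_top
  have hi2 : Integrable (fun x => φ x • gradient w x) (volume.restrict Ω) :=
    (MemLp.smul (p := ⊤) (q := ⊤) (r := ⊤) hwA.memLp_gradient hφA.memLp).integrable le_top
  refine ext_inner_left ℝ fun v => ?_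
  rw [inner_neg_right, ← integral_inner hi1, ← integral_inner hi2]
  rw [setIntegral_eq_integral_of_forall_compl_eq_zero fun x hx => by
      rw [hgzero x hx, smul_zero, inner_zero_right],
    setIntegral_eq_integral_of_forall_compl_eq_zero fun x hx => by
      rw [hzero x hx, zero_smul, inner_zero_right]]
  have key := LipschitzWith.integral_lineDeriv_mul_eq (μ := volume) hw hD hφc v
  have e1 : ∫ x, (inner ℝ v (φ x • gradient w x) : ℝ) = ∫ x, lineDeriv ℝ w x v * φ x := by
    refine integral_congr_ae ?_
    filter_upwards [hw.ae_differentiableAt (μ := volume)] with x hx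
    rw [hx.lineDeriv_eq_fderiv, inner_smul_right, real_inner_comm, inner_gradient_left, mul_comm]
  have e2 : ∫ x, (inner ℝ v (w x • gradient φ x) : ℝ) = - ∫ x, lineDeriv ℝ φ x (-v) * w x := by
    rw [← integral_neg]
    congr 1
    funext x
    rw [(hφ1.differentiable (by simp) x).lineDeriv_eq_fderiv, inner_smul_right, real_inner_comm,
      inner_gradient_left, map_neg]
    ring
  rw [e1, e2, key]

lemma mem_contH1_of_lipschitzWith (hΩ : IsOpen Ω) (hb : Bornology.IsBounded Ω) {C : ℝ≥0}
    {w : Eu d → ℝ} (hw : LipschitzWith C w) : w ∈ contH1 Ω := by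
  have : IsFiniteMeasure (volume.restrict Ω : Measure (Eu d)) := isFiniteMeasure_restrict hb
  have hwA := admissibleOn_of_lipschitzWith hΩ hb hw
  exact ⟨hw.continuous.continuousOn, hwA.memLp.mono_exponent le_top, gradient w,
    hwA.memLp_gradient.mono_exponent le_top, hasWeakGradient_of_lipschitzWith hΩ hb hw⟩

lemma HasWeakGradient.congr (hΩ : IsOpen Ω) {w₁ w₂ : Eu d → ℝ} {G₁ G₂ : Eu d → Eu d}
    (h : EqOn w₁ w₂ Ω) (hG : EqOn G₁ G₂ Ω) (h₁ : HasWeakGradient Ω w₁ G₁) :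
    HasWeakGradient Ω w₂ G₂ := by
  intro φ hφ
  have e1 : ∫ x in Ω, w₂ x • gradient φ x = ∫ x in Ω, w₁ x • gradient φ x :=
    setIntegral_congr_fun hΩ.measurableSet fun x hx => by simp only [h hx]
  have e2 : ∫ x in Ω, φ x • G₂ x = ∫ x in Ω, φ x • G₁ x :=
    setIntegral_congr_fun hΩ.measurableSet fun x hx => by simp only [hG hx]
  rw [e1, e2]
  exact h₁ φ hφ

lemma mem_contH1_congr (hΩ : IsOpen Ω) {w₁ w₂ : Eu d → ℝ} (h : EqOn w₁ w₂ (closure Ω))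
    (h₁ : w₁ ∈ contH1 Ω) : w₂ ∈ contH1 Ω := by
  obtain ⟨hc, hm, G, hG, hw⟩ := h₁
  refine ⟨hc.congr h.symm, hm.ae_eq ?_, G, hG, hw.congr hΩ (h.mono subset_closure) fun _ _ => rfl⟩
  filter_upwards [ae_restrict_mem hΩ.measurableSet] with x hx using h (subset_closure hx)

/-- Needed for the barriers, which are Lipschitz on the closed cylinder only; a Lipschitz extension
reduces to the global case. -/
lemma mem_contH1_of_lipschitzOnWith (hΩ : IsOpen Ω) (hb : Bornology.IsBounded Ω) {C : ℝ≥0}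
    {w : Eu d → ℝ} (hw : LipschitzOnWith C w (closure Ω)) : w ∈ contH1 Ω := by
  obtain ⟨w', hw', h⟩ := hw.extend_real
  exact mem_contH1_congr hΩ h.symm (mem_contH1_of_lipschitzWith hΩ hb hw')

/-- A smooth function agrees near a bounded set with a compactly supported one. -/
lemma exists_hasCompactSupport_eqOn (hb : Bornology.IsBounded Ω) {n : ℕ∞} {w : Eu d → ℝ}
    (hw : ContDiff ℝ n w) :
    ∃ w' : Eu d → ℝ, ContDiff ℝ n w' ∧ HasCompactSupport w' ∧ ∃ U, IsOpen U ∧ closure Ω ⊆ U ∧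
      EqOn w' w U := by
  obtain ⟨R, hR⟩ := hb.closure.subset_ball (0 : Eu d)
  have hR1 : (0 : ℝ) < max R 1 := lt_max_of_lt_right one_pos
  let χ : ContDiffBump (0 : Eu d) := ⟨max R 1, max R 1 + 1, hR1, by linarith⟩
  refine ⟨fun x => χ x * w x, χ.contDiff.mul hw, χ.hasCompactSupport.mul_right,
    Metric.ball 0 (max R 1), Metric.isOpen_ball,
    hR.trans (Metric.ball_subset_ball (le_max_left _ _)), fun x hx => ?_⟩
  simp [χ.one_of_mem_closedBall (Metric.ball_subset_closedBall hx)]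

lemma mem_contH1_of_contDiff (hΩ : IsOpen Ω) (hb : Bornology.IsBounded Ω) {w : Eu d → ℝ}
    (hw : ContDiff ℝ (⊤ : ℕ∞) w) : w ∈ contH1 Ω ∧ HasWeakGradient Ω w (gradient w) := by
  obtain ⟨w', hw', hc, U, hU, hΩU, h⟩ := exists_hasCompactSupport_eqOn hb hw
  obtain ⟨C, hC⟩ := ContDiff.lipschitzWith_of_hasCompactSupport hc hw' (by simp)
  refine ⟨mem_contH1_congr hΩ (h.mono hΩU) (mem_contH1_of_lipschitzWith hΩ hb hC),
    (hasWeakGradient_of_lipschitzWith hΩ hb hC).congr hΩ (h.mono (subset_closure.trans hΩU))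
      fun x hx => ?_⟩
  exact (h.eventuallyEq_of_mem (hU.mem_nhds (hΩU (subset_closure hx)))).gradient_eq

lemma laplacian_eq_sum {w : Eu d → ℝ} (x : Eu d) : Laplacian.laplacian w x =
    ∑ i, fderiv ℝ (fderiv ℝ w) x (EuclideanSpace.basisFun (Fin d) ℝ i)
      (EuclideanSpace.basisFun (Fin d) ℝ i) := by
  rw [InnerProductSpace.laplacian_eq_iteratedFDeriv_orthonormalBasis w
    (EuclideanSpace.basisFun (Fin d) ℝ)]
  simp [iteratedFDeriv_two_apply]

lemma continuous_laplacian {w : Eu d → ℝ} (hw : ContDiff ℝ 2 w) :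
    Continuous (Laplacian.laplacian w) := by
  rw [funext fun x => laplacian_eq_sum (w := w) x]
  have h1 : ContDiff ℝ 1 (fderiv ℝ w) := hw.fderiv_right (by norm_num)
  have h2 := h1.continuous_fderiv (by simp)
  fun_prop

/-- Green's formula for a nonnegative Lipschitz function that vanishes outside of `Ω`. -/
lemma integral_inner_gradient_eq (hΩ : IsOpen Ω) (hb : Bornology.IsBounded Ω) {w φ : Eu d → ℝ}
    (hw : ContDiff ℝ (⊤ : ℕ∞) w) {D : ℝ≥0} (hφ : LipschitzWith D φ) (h0 : ∀ x, 0 ≤ φ x)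
    (hzero : ∀ x, x ∉ Ω → φ x = 0) :
    ∫ x in Ω, (inner ℝ (gradient w x) (gradient φ x) : ℝ) =
      - ∫ x in Ω, Laplacian.laplacian w x * φ x := by
  have : IsFiniteMeasure (volume.restrict Ω : Measure (Eu d)) := isFiniteMeasure_restrict hb
  have hφc : HasCompactSupport φ := HasCompactSupport.intro hb.isCompact_closure
    fun x hx => hzero x fun h => hx (subset_closure h)
  -- Every point outside `Ω` is a global minimum of `φ ≥ 0`, so the derivative vanishes there, by
  -- Fermat or by its default value. No information on the measure of the boundary is needed.
  have hgzero : ∀ x, x ∉ Ω → fderiv ℝ φ x = 0 := fun x hx =>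
    IsLocalMin.fderiv_eq_zero (Eventually.of_forall fun y => by rw [hzero x hx]; exact h0 y)
  set b := EuclideanSpace.basisFun (Fin d) ℝ with hbdef
  have hw1 : ContDiff ℝ (⊤ : ℕ∞) (fderiv ℝ w) := hw.fderiv_right (by simp)
  have hφA := admissibleOn_of_lipschitzWith hΩ hb hφ
  have hlip : ∀ i, ∫ x in Ω, fderiv ℝ w x (b i) * fderiv ℝ φ x (b i) =
      - ∫ x in Ω, fderiv ℝ (fderiv ℝ w) x (b i) (b i) * φ x := by
    intro i
    have hwi : ContDiff ℝ (⊤ : ℕ∞) fun x => fderiv ℝ w x (b i) := hw1.clm_apply contDiff_const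
    -- The formula for line derivatives requires Lipschitz functions, and a partial derivative of
    -- `w` is Lipschitz only after a cut-off away from `Ω`.
    obtain ⟨f, hf, hfc, U, hU, hΩU, h⟩ := exists_hasCompactSupport_eqOn hb hwi
    obtain ⟨C, hC⟩ := ContDiff.lipschitzWith_of_hasCompactSupport hfc hf (by simp)
    have key := LipschitzWith.integral_lineDeriv_mul_eq (μ := volume) hC hφ hφc (b i)
    rw [setIntegral_eq_integral_of_forall_compl_eq_zero fun x hx => by rw [hgzero x hx]; simp,
      setIntegral_eq_integral_of_forall_compl_eq_zero fun x hx => by rw [hzero x hx, mul_zero],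
      ← integral_neg]
    have e1 : ∫ x, fderiv ℝ w x (b i) * fderiv ℝ φ x (b i) =
        - ∫ x, lineDeriv ℝ φ x (-(b i)) * f x := by
      rw [← integral_neg]
      refine integral_congr_ae ?_
      filter_upwards [hφ.ae_differentiableAt (μ := volume)] with x hx
      rw [hx.lineDeriv_eq_fderiv, map_neg]
      by_cases hxΩ : x ∈ Ω
      · rw [h (hΩU (subset_closure hxΩ))]; ring
      · rw [hgzero x hxΩ]; simp
    rw [e1, ← key, ← integral_neg]
    congr 1
    funext x
    by_cases hxΩ : x ∈ Ω
    · have hx := h.eventuallyEq_of_mem (hU.mem_nhds (hΩU (subset_closure hxΩ)))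
      rw [(hf.differentiable (by simp) x).lineDeriv_eq_fderiv, hx.fderiv_eq]
      have : fderiv ℝ (fun x => fderiv ℝ w x (b i)) x (b i) =
          fderiv ℝ (fderiv ℝ w) x (b i) (b i) := by
        rw [fderiv_clm_apply (hw1.differentiable (by simp) x) (differentiableAt_const _)]
        simp
      rw [this]
    · rw [hzero x hxΩ, mul_zero, mul_zero, neg_zero]
  have hbd : ∀ i, MemLp (fun _ : Eu d => b i) ⊤ (volume.restrict Ω) := fun i => memLp_top_const _
  have hint1 : ∀ i, Integrable (fun x => fderiv ℝ w x (b i) * fderiv ℝ φ x (b i))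
      (volume.restrict Ω) := by
    intro i
    have hwA := admissibleOn_of_contDiff hΩ hb (hw.of_le (by exact_mod_cast le_top))
    have := (MemLp.mul_top (MemLp.inner_top hwA.memLp_gradient (hbd i))
      (MemLp.inner_top hφA.memLp_gradient (hbd i))).integrable le_top
    simpa only [inner_gradient_left] using this
  have hint2 : ∀ i, Integrable (fun x => fderiv ℝ (fderiv ℝ w) x (b i) (b i) * φ x)
      (volume.restrict Ω) := by
    intro i
    have hc : Continuous fun x => fderiv ℝ (fderiv ℝ w) x (b i) (b i) := by
      have := hw1.continuous_fderiv (by simp)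
      fun_prop
    exact (MemLp.mul_top (memLp_top_of_continuousOn hΩ hb hc.continuousOn)
      hφA.memLp).integrable le_top
  have e1 : ∀ x, (inner ℝ (gradient w x) (gradient φ x) : ℝ) =
      ∑ i, fderiv ℝ w x (b i) * fderiv ℝ φ x (b i) := by
    intro x
    rw [← b.sum_inner_mul_inner]
    refine Finset.sum_congr rfl fun i _ => ?_
    rw [inner_gradient_left, real_inner_comm, inner_gradient_left]
  simp only [e1, laplacian_eq_sum, Finset.sum_mul]
  rw [integral_finsetSum _ fun i _ => hint1 i, integral_finsetSum _ fun i _ => hint2 i,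
    ← Finset.sum_neg_distrib]
  exact Finset.sum_congr rfl fun i _ => hlip i

end Admissible

/-! ### The Galerkin form and averages against normalised hat functions -/

section Galerkin

variable {d : ℕ} {Ω : Set (Eu d)} {K : Geometry.SimplicialComplex ℝ (Eu d)}

lemma MemLp.ae_norm_le_toReal {F : Type*} [NormedAddCommGroup F] {μ : Measure (Eu d)}
    {H : Eu d → F} (hH : MemLp H ⊤ μ) : ∀ᵐ x ∂μ, ‖H x‖ ≤ (eLpNorm H ⊤ μ).toReal := by
  filter_upwards [ae_le_eLpNormEssSup (f := H) (μ := μ)] with x hx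
  rw [← eLpNorm_exponent_top] at hx
  have := ENNReal.toReal_mono hH.2.ne hx
  rwa [toReal_enorm] at this

/-- A finite triangulation of the closure of a bounded Lipschitz domain. -/
structure Triangulates (K : Geometry.SimplicialComplex ℝ (Eu d)) (Ω : Set (Eu d)) : Prop where
  domain : IsLipschitzDomain Ω
  finite : K.faces.Finite
  space : K.space = closure Ω

variable {y : Eu d}

lemma Triangulates.mem_closure_of_mem_vertices (hT : Triangulates K Ω)
    (hy : y ∈ K.vertices) : y ∈ closure Ω :=
  hT.space ▸ Geometry.SimplicialComplex.vertices_subset_space hy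

lemma Triangulates.continuousOn (hT : Triangulates K Ω)
    {u : Eu d → ℝ} (hu : IsP1 K u) : ContinuousOn u (closure Ω) :=
  hT.space ▸ hu.continuousOn hT.finite

lemma Triangulates.admissibleOn (hT : Triangulates K Ω)
    {u : Eu d → ℝ} (hu : IsP1 K u) : AdmissibleOn Ω u :=
  hu.admissibleOn hT.domain.isOpen hT.domain.isBounded hT.finite hT.space

lemma isP1_nhat : IsP1 K (nhat Ω K y) := by
  have h := (isP1_hat (K := K) y).smul (∫ z in Ω, |hat K y z|)⁻¹
  have e : nhat Ω K y = (∫ z in Ω, |hat K y z|)⁻¹ • hat K y := by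
    funext x
    simp only [nhat, Pi.smul_apply, smul_eq_mul]
    rw [div_eq_inv_mul]
  rwa [e]

/-- The hat function is continuous with value one at `y`. Positivity ensures that the quotient in
`nhat` is a true normalisation and not a division by zero. -/
lemma integral_hat_pos (hT : Triangulates K Ω)
    (hy : y ∈ K.vertices) (hyΩ : y ∈ Ω) : 0 < ∫ z in Ω, |hat K y z| := by
  have := isFiniteMeasure_restrict hT.domain.isBounded
  have hA := hT.admissibleOn (isP1_hat y)
  have hcont : ContinuousOn (fun z => |hat K y z|) Ω :=
    ((hT.continuousOn (isP1_hat y)).mono subset_closure).abs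
  rw [setIntegral_pos_iff_support_of_nonneg_ae (Eventually.of_forall fun _ => abs_nonneg _)
    (hA.memLp.integrable le_top).abs]
  have hnhds : {z | 1 / 2 < |hat K y z|} ∩ Ω ∈ 𝓝 y := by
    refine Filter.inter_mem ?_ (hT.domain.isOpen.mem_nhds hyΩ)
    have h1 : Tendsto (fun z => |hat K y z|) (𝓝 y) (𝓝 |hat K y y|) :=
      (hcont.continuousAt (hT.domain.isOpen.mem_nhds hyΩ))
    rw [hat_self hy, abs_one] at h1
    exact h1.eventually (lt_mem_nhds (by norm_num))
  refine (Measure.measure_pos_of_mem_nhds volume hnhds).trans_le (measure_mono fun z hz => And.intro ?_ hz.2)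
  have := hz.1
  simp only [mem_ofPred_eq] at this
  rw [Function.mem_support]
  linarith

lemma nhat_nonneg (x : Eu d) : 0 ≤ nhat Ω K y x :=
  div_nonneg (hat_nonneg y x) (integral_nonneg fun _ => abs_nonneg _)

lemma hat_ne_zero_of_nhat_ne_zero {x : Eu d} (h : nhat Ω K y x ≠ 0) : hat K y x ≠ 0 :=
  fun h' => h (by rw [nhat, h', zero_div])

lemma nhat_eq_zero_of_notMem (hT : Triangulates K Ω)
    (hyΩ : y ∈ Ω) {x : Eu d} (hx : x ∉ Ω) : nhat Ω K y x = 0 := by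
  rw [nhat, hat_eq_zero_of_notMem hT.domain hT.finite hT.space hyΩ hx, zero_div]

lemma integral_nhat (hT : Triangulates K Ω)
    (hy : y ∈ K.vertices) (hyΩ : y ∈ Ω) : ∫ x in Ω, nhat Ω K y x = 1 := by
  have h := integral_hat_pos hT hy hyΩ
  simp only [nhat]
  rw [integral_div, ← setIntegral_congr_fun hT.domain.isOpen.measurableSet
    (fun x _ => abs_of_nonneg (hat_nonneg (K := K) y x)), div_self h.ne']

lemma exists_lipschitzWith_nhat (hT : Triangulates K Ω)
    (hyΩ : y ∈ Ω) : ∃ D, LipschitzWith D (nhat Ω K y) :=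
  (isP1_nhat).exists_lipschitzWith hT.domain.isOpen hT.finite hT.space
    fun _ hx => nhat_eq_zero_of_notMem hT hyΩ hx

/-- The `L¹`-normalised hat function computes averages. -/
lemma abs_integral_mul_nhat_sub_le (hT : Triangulates K Ω)
    (hy : y ∈ K.vertices) (hyΩ : y ∈ Ω) {F : Eu d → ℝ}
    (hF : MemLp F ⊤ (volume.restrict Ω)) {m e : ℝ}
    (h : ∀ᵐ x ∂volume.restrict Ω, nhat Ω K y x ≠ 0 → |F x - m| ≤ e) :
    |(∫ x in Ω, F x * nhat Ω K y x) - m| ≤ e := by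
  have := isFiniteMeasure_restrict hT.domain.isBounded
  have hA := hT.admissibleOn (isP1_nhat (Ω := Ω) (y := y))
  have hi := hA.memLp.integrable le_top
  have h1 : (∫ x in Ω, F x * nhat Ω K y x) - m = ∫ x in Ω, (F x - m) * nhat Ω K y x := by
    simp only [sub_mul]
    rw [integral_sub ((MemLp.mul_top hF hA.memLp).integrable le_top) (hi.const_mul m),
      integral_const_mul, integral_nhat hT hy hyΩ, mul_one]
  have h2 : e = ∫ x in Ω, e * nhat Ω K y x := by
    rw [integral_const_mul, integral_nhat hT hy hyΩ, mul_one]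
  rw [h1, h2, ← Real.norm_eq_abs]
  refine norm_integral_le_of_norm_le (hi.const_mul e) ?_
  filter_upwards [h] with x hx
  rw [norm_mul, Real.norm_eq_abs, Real.norm_eq_abs, abs_of_nonneg (nhat_nonneg x)]
  by_cases h0 : nhat Ω K y x = 0
  · simp [h0]
  · exact mul_le_mul_of_nonneg_right (hx h0) (nhat_nonneg x)

/-! ### Algebra of the Galerkin form -/

/-- `gradient` is additive only where both functions are differentiable; for admissible functions
this is almost everywhere, which suffices under the integrals. -/
lemma galerkin_add_smul (hT : Triangulates K Ω) {a : Eu d → ℝ} {b : Eu d → Eu d} {c : Eu d → ℝ}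
    (hb : MemLp b ⊤ (volume.restrict Ω)) (hc : MemLp c ⊤ (volume.restrict Ω)) {w₁ w₂ : Eu d → ℝ}
    (h₁ : AdmissibleOn Ω w₁) (h₂ : AdmissibleOn Ω w₂) (r : ℝ) :
    galerkin Ω K a b c (w₁ + r • w₂) y =
      galerkin Ω K a b c w₁ y + r * galerkin Ω K a b c w₂ y := by
  have := isFiniteMeasure_restrict hT.domain.isBounded
  have hφ := hT.admissibleOn (isP1_nhat (Ω := Ω) (y := y))
  have hI1 : ∀ {w}, AdmissibleOn Ω w → Integrable (fun x => (inner ℝ (gradient w x)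
      (gradient (nhat Ω K y) x) : ℝ)) (volume.restrict Ω) := fun hw =>
    (MemLp.inner_top hw.memLp_gradient hφ.memLp_gradient).integrable le_top
  have hI2 : ∀ {w}, AdmissibleOn Ω w → Integrable (fun x => (- inner ℝ (b x) (gradient w x) +
      c x * w x) * nhat Ω K y x) (volume.restrict Ω) := fun hw =>
    (MemLp.mul_top ((MemLp.inner_top hb hw.memLp_gradient).neg.add (MemLp.mul_top hc hw.memLp))
      hφ.memLp).integrable le_top
  have e1 : ∫ x in Ω, (inner ℝ (gradient (w₁ + r • w₂) x) (gradient (nhat Ω K y) x) : ℝ) =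
      (∫ x in Ω, (inner ℝ (gradient w₁ x) (gradient (nhat Ω K y) x) : ℝ)) +
        r * ∫ x in Ω, (inner ℝ (gradient w₂ x) (gradient (nhat Ω K y) x) : ℝ) := by
    rw [← integral_const_mul, ← integral_add (hI1 h₁) ((hI1 h₂).const_mul r)]
    refine integral_congr_ae ?_
    filter_upwards [h₁.diff, h₂.diff] with x hx₁ hx₂
    rw [gradient_add_smul hx₁ hx₂, inner_add_left, real_inner_smul_left]
  have e2 : ∫ x in Ω, (- inner ℝ (b x) (gradient (w₁ + r • w₂) x) + c x * (w₁ + r • w₂) x) *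
        nhat Ω K y x =
      (∫ x in Ω, (- inner ℝ (b x) (gradient w₁ x) + c x * w₁ x) * nhat Ω K y x) +
        r * ∫ x in Ω, (- inner ℝ (b x) (gradient w₂ x) + c x * w₂ x) * nhat Ω K y x := by
    rw [← integral_const_mul, ← integral_add (hI2 h₁) ((hI2 h₂).const_mul r)]
    refine integral_congr_ae ?_
    filter_upwards [h₁.diff, h₂.diff] with x hx₁ hx₂
    rw [gradient_add_smul hx₁ hx₂, inner_add_right, real_inner_smul_right]
    simp only [Pi.add_apply, Pi.smul_apply, smul_eq_mul]
    ring
  rw [galerkin, galerkin, galerkin, e1, e2]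
  ring

lemma galerkin_congr (hΩ : IsOpen Ω) {a : Eu d → ℝ} {b : Eu d → Eu d} {c : Eu d → ℝ}
    {w₁ w₂ : Eu d → ℝ} (h : EqOn w₁ w₂ Ω) :
    galerkin Ω K a b c w₁ y = galerkin Ω K a b c w₂ y := by
  have hg : ∀ x ∈ Ω, gradient w₁ x = gradient w₂ x := fun x hx =>
    (h.eventuallyEq_of_mem (hΩ.mem_nhds hx)).gradient_eq
  rw [galerkin, galerkin, setIntegral_congr_fun hΩ.measurableSet fun x hx => by rw [hg x hx]]
  congr 1
  exact setIntegral_congr_fun hΩ.measurableSet fun x hx => by simp only [hg x hx, h hx]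

lemma galerkin_zero {a : Eu d → ℝ} {b : Eu d → Eu d} {c : Eu d → ℝ} :
    galerkin Ω K a b c 0 y = 0 := by
  have : ∀ x, gradient (0 : Eu d → ℝ) x = 0 := fun x => gradient_fun_const x 0
  simp [galerkin, this]

lemma galerkin_one {a : Eu d → ℝ} {b : Eu d → Eu d} {c : Eu d → ℝ} :
    galerkin Ω K a b c (fun _ => 1) y = ∫ x in Ω, c x * nhat Ω K y x := by
  simp [galerkin, gradient_fun_const]

lemma galerkin_sum (hT : Triangulates K Ω) {a : Eu d → ℝ} {b : Eu d → Eu d} {c : Eu d → ℝ}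
    (hb : MemLp b ⊤ (volume.restrict Ω)) (hc : MemLp c ⊤ (volume.restrict Ω)) {ι : Type*}
    (N : Finset ι) (r : ι → ℝ) {w : ι → Eu d → ℝ} (h : ∀ z, AdmissibleOn Ω (w z)) :
    galerkin Ω K a b c (fun x => ∑ z ∈ N, r z * w z x) y =
      ∑ z ∈ N, r z * galerkin Ω K a b c (w z) y := by
  classical
  -- Admissibility of the partial sums is carried through the induction, because additivity of the
  -- form depends on it.
  suffices H : AdmissibleOn Ω (fun x => ∑ z ∈ N, r z * w z x) ∧
    galerkin Ω K a b c (fun x => ∑ z ∈ N, r z * w z x) y =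
      ∑ z ∈ N, r z * galerkin Ω K a b c (w z) y from H.2
  induction N using Finset.induction_on with
  | empty => exact ⟨by simpa using hT.admissibleOn (isP1_const 0), by
      simp only [Finset.sum_empty]
      exact galerkin_zero⟩
  | insert z N hz ih =>
    have e : (fun x => ∑ z ∈ insert z N, r z * w z x) =
        (fun x => ∑ z ∈ N, r z * w z x) + r z • w z := by
      funext x
      simp [Finset.sum_insert hz, add_comm]
    rw [e, Finset.sum_insert hz, galerkin_add_smul hT hb hc ih.1 (h z), ih.2]
    exact ⟨ih.1.add_smul (h z) _, add_comm _ _⟩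

lemma galerkin_coeff_add (hT : Triangulates K Ω)
    {a₁ a₂ : Eu d → ℝ} {b₁ b₂ : Eu d → Eu d} {c₁ c₂ : Eu d → ℝ}
    (hb₁ : MemLp b₁ ⊤ (volume.restrict Ω)) (hc₁ : MemLp c₁ ⊤ (volume.restrict Ω))
    (hb₂ : MemLp b₂ ⊤ (volume.restrict Ω)) (hc₂ : MemLp c₂ ⊤ (volume.restrict Ω)) {w : Eu d → ℝ}
    (hw : AdmissibleOn Ω w) :
    galerkin Ω K a₁ b₁ c₁ w y + galerkin Ω K a₂ b₂ c₂ w y =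
      galerkin Ω K (a₁ + a₂) (b₁ + b₂) (c₁ + c₂) w y := by
  have := isFiniteMeasure_restrict hT.domain.isBounded
  have hφ := hT.admissibleOn (isP1_nhat (Ω := Ω) (y := y))
  have hI : ∀ {b c}, MemLp b ⊤ (volume.restrict Ω) → MemLp c ⊤ (volume.restrict Ω) →
      Integrable (fun x => (- inner ℝ (b x) (gradient w x) + c x * w x) * nhat Ω K y x)
        (volume.restrict Ω) := fun hb hc =>
    (MemLp.mul_top ((MemLp.inner_top hb hw.memLp_gradient).neg.add (MemLp.mul_top hc hw.memLp))
      hφ.memLp).integrable le_top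
  simp only [galerkin, Pi.add_apply]
  have e : ∫ x in Ω, (- inner ℝ (b₁ x + b₂ x) (gradient w x) + (c₁ x + c₂ x) * w x) *
      nhat Ω K y x = (∫ x in Ω, (- inner ℝ (b₁ x) (gradient w x) + c₁ x * w x) * nhat Ω K y x) +
      ∫ x in Ω, (- inner ℝ (b₂ x) (gradient w x) + c₂ x * w x) * nhat Ω K y x := by
    rw [← integral_add (hI hb₁ hc₁) (hI hb₂ hc₂)]
    congr 1
    funext x
    rw [inner_add_left]
    ring
  rw [e]
  ring

/-- The constants depend on `w` and `y` but not on the coefficients, so a single bound serves all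
controls. Without it the real infima and suprema over controls could be default values. -/
lemma abs_galerkin_le (hT : Triangulates K Ω) (hy : y ∈ K.vertices) (hyΩ : y ∈ Ω) {w : Eu d → ℝ}
    (hw : AdmissibleOn Ω w) : ∃ C₀ C₁ C₂ : ℝ, ∀ (a : Eu d → ℝ) (b : Eu d → Eu d) (c : Eu d → ℝ)
      (Ma Mb Mc : ℝ), MemLp b ⊤ (volume.restrict Ω) → MemLp c ⊤ (volume.restrict Ω) → |a y| ≤ Ma →
      (∀ᵐ x ∂volume.restrict Ω, ‖b x‖ ≤ Mb) → (∀ᵐ x ∂volume.restrict Ω, ‖c x‖ ≤ Mc) →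
      |galerkin Ω K a b c w y| ≤ Ma * C₀ + (Mb * C₁ + Mc * C₂) := by
  refine ⟨|∫ x in Ω, (inner ℝ (gradient w x) (gradient (nhat Ω K y) x) : ℝ)|,
    (eLpNorm (gradient w) ⊤ (volume.restrict Ω)).toReal,
    (eLpNorm w ⊤ (volume.restrict Ω)).toReal, fun a b c Ma Mb Mc hb hc ha hMb hMc => ?_⟩
  rw [galerkin]
  refine (abs_add_le _ _).trans (add_le_add ?_ ?_)
  · rw [abs_mul]
    exact mul_le_mul_of_nonneg_right ha (abs_nonneg _)
  · rw [← sub_zero (∫ x in Ω, _)]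
    refine abs_integral_mul_nhat_sub_le hT hy hyΩ
      ((MemLp.inner_top hb hw.memLp_gradient).neg.add (MemLp.mul_top hc hw.memLp)) ?_
    filter_upwards [hMb, hMc, MemLp.ae_norm_le_toReal hw.memLp,
      MemLp.ae_norm_le_toReal hw.memLp_gradient] with x h1 h2 h3 h4 _
    rw [sub_zero]
    refine (abs_add_le _ _).trans (add_le_add ?_ ?_)
    · rw [Pi.neg_apply, abs_neg]
      exact (abs_real_inner_le_norm _ _).trans (by gcongr; exact (norm_nonneg _).trans h1)
    · rw [abs_mul]
      exact mul_le_mul h2 h3 (abs_nonneg _) ((norm_nonneg _).trans h2)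

end Galerkin

/-! ## Essential bounds and equicontinuity -/

section EssentialBounds

variable {d : ℕ} {Ω : Set (Eu d)} {F : Type*} [NormedAddCommGroup F]

lemma ae_norm_le_of_eLpNorm_top_le {μ : Measure (Eu d)} {w : Eu d → F} {e : ℝ} (he : 0 ≤ e)
    (h : eLpNorm w ⊤ μ ≤ ENNReal.ofReal e) : ∀ᵐ x ∂μ, ‖w x‖ ≤ e := by
  filter_upwards [ae_le_eLpNormEssSup (f := w) (μ := μ)] with x hx
  rw [← eLpNorm_exponent_top] at hx
  rw [← toReal_enorm]
  exact ENNReal.toReal_le_of_le_ofReal he (hx.trans h)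

/-- Neighbourhoods have positive measure, so an almost everywhere property cannot fail throughout
one. This converts essential bounds on continuous functions into pointwise ones. -/
lemma frequently_nhds_of_ae {U : Set (Eu d)} {x : Eu d} (hU : U ∈ 𝓝 x) {p : Eu d → Prop}
    (hp : ∀ᵐ y ∂volume.restrict U, p y) : ∃ᶠ y in 𝓝 x, p y := by
  intro hn
  have h1 : interior U ∈ 𝓝 x := interior_mem_nhds.2 hU
  have h2 : ∀ᵐ y ∂volume.restrict (interior U), p y :=
    ae_mono (Measure.restrict_mono interior_subset le_rfl) hp
  rw [ae_restrict_iff' isOpen_interior.measurableSet, ae_iff] at h2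
  refine (Measure.measure_pos_of_mem_nhds volume (Filter.inter_mem h1 hn)).ne' ?_
  refine measure_mono_null (fun y hy => ?_) h2
  exact fun h => hy.2 (h hy.1)

lemma norm_le_of_supNorm_le (hΩ : IsOpen Ω) {w : Eu d → F} (hw : ContinuousOn w (closure Ω))
    {e : ℝ} (he : 0 ≤ e) (h : supNorm Ω w ≤ ENNReal.ofReal e) : ∀ x ∈ closure Ω, ‖w x‖ ≤ e := by
  have hae := ae_norm_le_of_eLpNorm_top_le he h
  have hΩe : ∀ x ∈ Ω, ‖w x‖ ≤ e := fun x hx =>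
    le_of_tendsto_of_frequently ((hw.continuousAt
      (mem_of_superset (hΩ.mem_nhds hx) subset_closure)).norm)
      (frequently_nhds_of_ae (hΩ.mem_nhds hx) hae)
  intro x hx
  exact ContinuousWithinAt.closure_le hx ((hw x hx).norm.mono subset_closure)
    continuousWithinAt_const hΩe

lemma eventually_norm_le_of_tendsto_supNorm {ι : Type*} {l : Filter ι} {w : ι → Eu d → F}
    (hΩ : IsOpen Ω) (hw : ∀ i, ContinuousOn (w i) (closure Ω))
    (h : Tendsto (fun i => supNorm Ω (w i)) l (𝓝 0)) {e : ℝ} (he : 0 < e) :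
    ∀ᶠ i in l, ∀ x ∈ closure Ω, ‖w i x‖ ≤ e := by
  filter_upwards [h.eventually_le_const (ENNReal.ofReal_pos.2 he)] with i hi
  exact norm_le_of_supNorm_le hΩ (hw i) he.le hi

variable {A B : Type*} [MetricSpace A] [CompactSpace A] [MetricSpace B] [CompactSpace B]

lemma exists_equicontinuity {G : A → B → Eu d → F} (hb : Bornology.IsBounded Ω)
    (hG : ContinuousOn (fun p : (A × B) × Eu d => G p.1.1 p.1.2 p.2) (univ ×ˢ closure Ω)) {e : ℝ}
    (he : 0 < e) : ∃ δ > 0, ∀ α β, ∀ x ∈ closure Ω, ∀ y ∈ closure Ω, dist x y < δ →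
      ‖G α β x - G α β y‖ < e := by
  have hc : IsCompact ((univ : Set (A × B)) ×ˢ closure Ω) := isCompact_univ.prod hb.isCompact_closure
  obtain ⟨δ, hδ, h⟩ := Metric.uniformContinuousOn_iff.1
    (hc.uniformContinuousOn_of_continuous hG) e he
  refine ⟨δ, hδ, fun α β x hx y hy hxy => ?_⟩
  rw [← dist_eq_norm]
  exact h ((α, β), x) ⟨mem_univ _, hx⟩ ((α, β), y) ⟨mem_univ _, hy⟩ (by
    rw [Prod.dist_eq, dist_self]
    exact max_lt hδ hxy)

lemma exists_uniform_bound {G : A → B → Eu d → F} (hb : Bornology.IsBounded Ω)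
    (hG : ContinuousOn (fun p : (A × B) × Eu d => G p.1.1 p.1.2 p.2) (univ ×ˢ closure Ω)) :
    ∃ M, 0 ≤ M ∧ ∀ α β, ∀ x ∈ closure Ω, ‖G α β x‖ ≤ M := by
  have hc : IsCompact ((univ : Set (A × B)) ×ˢ closure Ω) := isCompact_univ.prod hb.isCompact_closure
  obtain ⟨M, hM⟩ := (hc.image_of_continuousOn hG.norm).bddAbove
  refine ⟨max M 0, le_max_right _ _, fun α β x hx => le_max_of_le_left ?_⟩
  exact hM ⟨((α, β), x), ⟨mem_univ _, hx⟩, rfl⟩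

lemma exists_equicontinuity_of_continuous {w : Eu d → F} (hb : Bornology.IsBounded Ω)
    (hw : ContinuousOn w (closure Ω)) {e : ℝ} (he : 0 < e) : ∃ δ > 0, ∀ x ∈ closure Ω,
      ∀ y ∈ closure Ω, dist x y < δ → ‖w x - w y‖ < e := by
  obtain ⟨δ, hδ, h⟩ := Metric.uniformContinuousOn_iff.1
    (hb.isCompact_closure.uniformContinuousOn_of_continuous hw) e he
  exact ⟨δ, hδ, fun x hx y hy hxy => by rw [← dist_eq_norm]; exact h x hx y hy hxy⟩

/-- Near a given control the essential norm exceeds its value there by at most one; compactness of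
`A × B` makes the bound uniform. -/
lemma LinftyContinuous.exists_bound {u : A → B → Eu d → F} (hu : LinftyContinuous Ω u) :
    ∃ M : ℝ, 0 ≤ M ∧ ∀ α β, ∀ᵐ x ∂volume.restrict Ω, ‖u α β x‖ ≤ M := by
  let P : Set (A × B) → Prop := fun s => ∃ M : ℝ≥0, ∀ p ∈ s, supNorm Ω (u p.1 p.2) ≤ M
  have hmono : ∀ s t, s ⊆ t → P t → P s := fun s t hst ⟨M, hM⟩ => ⟨M, fun p hp => hM p (hst hp)⟩
  have hunion : ∀ s t, P s → P t → P (s ∪ t) := by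
    rintro s t ⟨M, hM⟩ ⟨N, hN⟩
    refine ⟨max M N, ?_⟩
    rintro p (hp | hp)
    · exact (hM p hp).trans (ENNReal.coe_le_coe.2 (le_max_left _ _))
    · exact (hN p hp).trans (ENNReal.coe_le_coe.2 (le_max_right _ _))
  have hlocal : ∀ p ∈ (univ : Set (A × B)), ∃ t ∈ 𝓝[univ] p, P t := by
    intro p _
    obtain ⟨N, hN⟩ : ∃ N : ℝ≥0, (N : ℝ≥0∞) = supNorm Ω (u p.1 p.2) :=
      ⟨_, ENNReal.coe_toNNReal (hu.1 p.1 p.2).2.ne⟩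
    refine ⟨_, mem_nhdsWithin_of_mem_nhds ((hu.2 p).eventually_le_const one_pos), N + 1,
      fun q hq => ?_⟩
    have e : u q.1 q.2 = u p.1 p.2 + (u q.1 q.2 - u p.1 p.2) := (add_sub_cancel _ _).symm
    have h1 : supNorm Ω (u p.1 p.2 + (u q.1 q.2 - u p.1 p.2)) ≤
        supNorm Ω (u p.1 p.2) + supNorm Ω (u q.1 q.2 - u p.1 p.2) :=
      eLpNorm_add_le (hu.1 _ _).1 ((hu.1 _ _).1.sub (hu.1 _ _).1) le_top
    rw [← e] at h1
    refine h1.trans ?_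
    rw [ENNReal.coe_add, hN, ENNReal.coe_one]
    exact add_le_add le_rfl hq
  have h : P univ :=
    isCompact_univ.induction_on ⟨0, fun p hp => hp.elim⟩ hmono hunion hlocal
  obtain ⟨M, hM⟩ := h
  refine ⟨M, M.2, fun α β => ae_norm_le_of_eLpNorm_top_le M.2 ?_⟩
  rw [ENNReal.ofReal_coe_nnreal]
  exact hM (α, β) (mem_univ _)

end EssentialBounds

/-! ## Consistency of the discrete operators -/

section Consistency

variable {d : ℕ} {A B : Type*} [MetricSpace A] [MetricSpace B]

/-- The standing assumptions on the numerical scheme. -/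
structure IsStableScheme (𝓜 : IsaacsProblem d A B) (𝓓 : Discretisation d A B) : Prop where
  mesh : IsMeshSequence 𝓜 𝓓
  proj : IsEllipticProjection 𝓜 𝓓
  cons : IsConsistent 𝓜 𝓓
  mono : IsMonotone 𝓜 𝓓

variable {𝓜 : IsaacsProblem d A B} {𝓓 : Discretisation d A B}

lemma IsStableScheme.triangulates (h : IsStableScheme 𝓜 𝓓) (i : ℕ) :
    Triangulates (𝓓.mesh i) 𝓜.Ω :=
  ⟨𝓜.domain, h.mesh.finite i, h.mesh.space i⟩

lemma IsStableScheme.eventually_diam_le (h : IsStableScheme 𝓜 𝓓) {δ : ℝ} (hδ : 0 < δ) :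
    ∀ᶠ i in atTop, ∀ s ∈ (𝓓.mesh i).faces,
      Metric.diam (convexHull ℝ (s : Set (Eu d))) ≤ δ := by
  filter_upwards [h.mesh.meshSize.eventually_le_const (ENNReal.ofReal_pos.2 hδ)] with i hi s hs
  refine ENNReal.toReal_le_of_le_ofReal hδ.le (le_trans ?_ hi)
  exact le_iSup₂_of_le (f := fun (s : Finset (Eu d)) (_ : s ∈ (𝓓.mesh i).faces) =>
    Metric.ediam (convexHull ℝ (s : Set (Eu d)))) s hs le_rfl

lemma IsStableScheme.eventually_exists_node (h : IsStableScheme 𝓜 𝓓) {δ : ℝ} (hδ : 0 < δ) :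
    ∀ᶠ i in atTop, ∀ x ∈ closure 𝓜.Ω, ∃ y ∈ nodes 𝓓 i, dist y x ≤ δ := by
  filter_upwards [h.eventually_diam_le hδ] with i hi x hx
  rw [← h.mesh.space i] at hx
  obtain ⟨s, hs, hxs⟩ := Geometry.SimplicialComplex.mem_space_iff.1 hx
  obtain ⟨y, hy⟩ := Geometry.SimplicialComplex.nonempty_of_mem_faces hs
  exact ⟨y, mem_vertices_of_mem_face hs hy, (Metric.dist_le_diam_of_mem (isCompact_face s).isBounded
    (subset_convexHull ℝ _ hy) hxs).trans (hi s hs)⟩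

/-- For the diffusion coefficient the essential bound on the support of the hat function holds at
the node itself: `a` is continuous there, and the support is a neighbourhood of the node. -/
lemma IsStableScheme.eventually_consistent (h : IsStableScheme 𝓜 𝓓) {e : ℝ} (he : 0 < e) :
    ∀ᶠ i in atTop, ∀ α β,
      (∀ y ∈ innerNodes 𝓜 𝓓 i, |𝓜.a α β y - (𝓓.aE i α β y + 𝓓.aI i α β y)| ≤ e) ∧
      (∀ᵐ x ∂volume.restrict 𝓜.Ω, ‖𝓜.b α β x - (𝓓.bE i α β x + 𝓓.bI i α β x)‖ ≤ e) ∧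
      (∀ᵐ x ∂volume.restrict 𝓜.Ω, |𝓜.c α β x - (𝓓.cE i α β x + 𝓓.cI i α β x)| ≤ e) ∧
      (∀ᵐ x ∂volume.restrict 𝓜.Ω, |𝓜.f α β x - 𝓓.f i α β x| ≤ e) := by
  filter_upwards [h.cons.consistent.eventually_le_const (ENNReal.ofReal_pos.2 he)] with i hi α β
  have h1 := (le_iSup₂ (f := fun (α : A) (β : B) =>
    ((⨆ y ∈ innerNodes 𝓜 𝓓 i, supNorm (tsupport (hat (𝓓.mesh i) y))
        (fun x => 𝓜.a α β x - (𝓓.aE i α β y + 𝓓.aI i α β y))) +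
      supNorm 𝓜.Ω (𝓜.b α β - (𝓓.bE i α β + 𝓓.bI i α β)) +
      supNorm 𝓜.Ω (𝓜.c α β - (𝓓.cE i α β + 𝓓.cI i α β)) +
      supNorm 𝓜.Ω (𝓜.f α β - 𝓓.f i α β))) α β).trans hi
  have h2 := le_self_add.trans h1
  have h3 := le_self_add.trans h2
  refine ⟨fun y hy => ?_, ae_norm_le_of_eLpNorm_top_le he.le (le_add_self.trans h3),
    ae_norm_le_of_eLpNorm_top_le he.le (le_add_self.trans h2),
    ae_norm_le_of_eLpNorm_top_le he.le (le_add_self.trans h1)⟩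
  have h4 : supNorm (tsupport (hat (𝓓.mesh i) y))
      (fun x => 𝓜.a α β x - (𝓓.aE i α β y + 𝓓.aI i α β y)) ≤ ENNReal.ofReal e :=
    (le_iSup₂ (f := fun y (_ : y ∈ innerNodes 𝓜 𝓓 i) => supNorm (tsupport (hat (𝓓.mesh i) y))
        (fun x => 𝓜.a α β x - (𝓓.aE i α β y + 𝓓.aI i α β y))) y hy).trans
      (le_self_add.trans h3)
  have hT := h.triangulates i
  have hnhds := mem_of_superset (𝓜.domain.isOpen.mem_nhds hy.2) subset_closure
  have hsupp : tsupport (hat (𝓓.mesh i) y) ∈ 𝓝 y := by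
    refine mem_of_superset ?_ (subset_tsupport _)
    have h5 := (hT.continuousOn (isP1_hat y)).continuousAt hnhds
    exact h5.eventually_ne (by rw [hat_self hy.1]; exact one_ne_zero)
  have hcont : ContinuousAt (fun x => |𝓜.a α β x - (𝓓.aE i α β y + 𝓓.aI i α β y)|) y := by
    have h6 : ContinuousOn (fun x => 𝓜.a α β x) (closure 𝓜.Ω) :=
      𝓜.continuous_a.comp (f := fun x => ((α, β), x)) (by fun_prop) fun x hx => ⟨mem_univ _, hx⟩
    exact ((h6.continuousAt hnhds).sub continuousAt_const).abs
  exact le_of_tendsto_of_frequently hcont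
    (frequently_nhds_of_ae hsupp (ae_norm_le_of_eLpNorm_top_le he.le h4))

/-- The linear operators of the Isaacs equation, with source term `σ f`. The sign `σ` allows one to
treat subsolutions and supersolutions at the same time. -/
def linearOp (𝓜 : IsaacsProblem d A B) (σ : ℝ) (x : Eu d) (q : ℝ) (p : Eu d) (s : ℝ) (α : A)
    (β : B) : ℝ :=
  - 𝓜.a α β x * q - inner ℝ (𝓜.b α β x) p + 𝓜.c α β x * s - σ * 𝓜.f α β x

/-- All terms except diffusion are collected in one average, so that a single oscillation estimate
treats them. -/
lemma galerkin_add_reaction_sub_source {Ω : Set (Eu d)} {K : Geometry.SimplicialComplex ℝ (Eu d)}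
    (hT : Triangulates K Ω) {y : Eu d} {a : Eu d → ℝ} {b : Eu d → Eu d} {c f w : Eu d → ℝ}
    (hb : MemLp b ⊤ (volume.restrict Ω)) (hc : MemLp c ⊤ (volume.restrict Ω))
    (hf : MemLp f ⊤ (volume.restrict Ω)) (hw : AdmissibleOn Ω w) (r : ℝ) :
    galerkin Ω K a b c w y + r * (∫ x in Ω, c x * nhat Ω K y x) - ∫ x in Ω, f x * nhat Ω K y x =
      a y * (∫ x in Ω, (inner ℝ (gradient w x) (gradient (nhat Ω K y) x) : ℝ)) +
      ∫ x in Ω, (- inner ℝ (b x) (gradient w x) + c x * w x + r * c x - f x) * nhat Ω K y x := by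
  have := isFiniteMeasure_restrict hT.domain.isBounded
  have hφA := hT.admissibleOn (isP1_nhat (Ω := Ω) (y := y))
  have i1 : Integrable (fun x => (- inner ℝ (b x) (gradient w x) + c x * w x) * nhat Ω K y x)
      (volume.restrict Ω) := (MemLp.mul_top ((MemLp.inner_top hb hw.memLp_gradient).neg.add
        (MemLp.mul_top hc hw.memLp)) hφA.memLp).integrable le_top
  have i2 : Integrable (fun x => c x * nhat Ω K y x) (volume.restrict Ω) :=
    (MemLp.mul_top hc hφA.memLp).integrable le_top
  have i3 : Integrable (fun x => f x * nhat Ω K y x) (volume.restrict Ω) :=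
    (MemLp.mul_top hf hφA.memLp).integrable le_top
  have e : ∀ x, (- inner ℝ (b x) (gradient w x) + c x * w x + r * c x - f x) * nhat Ω K y x =
      (- inner ℝ (b x) (gradient w x) + c x * w x) * nhat Ω K y x + r * (c x * nhat Ω K y x) -
        f x * nhat Ω K y x := fun x => by ring
  simp only [e]
  have e2 := integral_sub (i1.add (i2.const_mul r)) i3
  have e3 := integral_add i1 (i2.const_mul r)
  simp only [Pi.add_apply] at e2
  rw [e2, e3, integral_const_mul, galerkin]
  ring

/-- Primed quantities are values at the node, `s` is the prescribed value there. Each `2 * κ` is one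
approximation error plus one oscillation; the `3 * κ` has two projection errors, at the point and at
the node. -/
lemma abs_lowerOrder_sub_le {b b' g g' : Eu d} {c c' w w' s f f' κ Mg Mb Mc S : ℝ} (hκ0 : 0 ≤ κ)
    (hκ1 : κ ≤ 1) (hb : ‖b - b'‖ ≤ 2 * κ) (hg : ‖g - g'‖ ≤ 2 * κ) (hc : |c - c'| ≤ 2 * κ)
    (hf : |f - f'| ≤ 2 * κ) (hw : |w - w'| ≤ 3 * κ) (hMb : ‖b'‖ ≤ Mb) (hMg : ‖g'‖ ≤ Mg)
    (hMc : |c'| ≤ Mc) (hs : |s| ≤ S) :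
    |(- inner ℝ b g + c * w + (s - w') * c - f) - (- inner ℝ b' g' + c' * s - f')| ≤
      2 * κ * (Mg + 2) + Mb * (2 * κ) + 2 * κ * S + (Mc + 2) * (3 * κ) + 2 * κ := by
  have e1 : (- inner ℝ b g + c * w + (s - w') * c - f) - (- inner ℝ b' g' + c' * s - f') =
      - inner ℝ (b - b') g - inner ℝ b' (g - g') + (c - c') * s + c * (w - w') - (f - f') := by
    rw [inner_sub_left, inner_sub_right]
    ring
  have hg' : ‖g‖ ≤ Mg + 2 := by
    have := norm_le_norm_add_norm_sub g' g
    rw [norm_sub_rev] at this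
    linarith
  have hc' : |c| ≤ Mc + 2 := by
    have := abs_sub_abs_le_abs_sub c c'
    linarith
  have hMb0 : 0 ≤ Mb := (norm_nonneg _).trans hMb
  have t1 : |(inner ℝ (b - b') g : ℝ)| ≤ 2 * κ * (Mg + 2) :=
    (abs_real_inner_le_norm _ _).trans (by gcongr)
  have t2 : |(inner ℝ b' (g - g') : ℝ)| ≤ Mb * (2 * κ) :=
    (abs_real_inner_le_norm _ _).trans (by gcongr)
  have t3 : |(c - c') * s| ≤ 2 * κ * S := by
    rw [abs_mul]
    gcongr
  have t4 : |c * (w - w')| ≤ (Mc + 2) * (3 * κ) := by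
    rw [abs_mul]
    exact mul_le_mul hc' hw (abs_nonneg _) ((abs_nonneg _).trans hc')
  rw [e1]
  rw [abs_le] at t1 t2 t3 t4 hf ⊢
  constructor <;> linarith [t1.1, t1.2, t2.1, t2.2, t3.1, t3.2, t4.1, t4.2, hf.1, hf.2]

lemma abs_diffusion_add_sub_le {a aT J Δ R m κ M Ma E : ℝ} (hκ0 : 0 ≤ κ) (hκ1 : κ ≤ 1)
    (ha : |a - aT| ≤ κ) (hJ : |J - Δ| ≤ κ) (hM : |Δ| ≤ M) (hMa : |a| ≤ Ma) (hR : |R - m| ≤ E) :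
    |aT * -J + R - (-a * Δ + m)| ≤ κ * (M + 1) + Ma * κ + E := by
  have hJ' : |J| ≤ M + 1 := by
    have := abs_sub_abs_le_abs_sub J Δ
    linarith
  have u1 : |(a - aT) * J| ≤ κ * (M + 1) := by
    rw [abs_mul]
    gcongr
  have u2 : |a * (J - Δ)| ≤ Ma * κ := by
    rw [abs_mul]
    exact mul_le_mul hMa hJ (abs_nonneg _) ((abs_nonneg _).trans hMa)
  rw [abs_le] at u1 u2 hR ⊢
  constructor <;> linarith [u1.1, u1.2, u2.1, u2.2, hR.1, hR.2]

/-- The total discrete operator applied to the projection of `η` shifted to have value `s` at the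
node `y`. -/
lemma IsStableScheme.consistency [CompactSpace A] [CompactSpace B] (h : IsStableScheme 𝓜 𝓓) {η : Eu d → ℝ}
    (hη : ContDiff ℝ (⊤ : ℕ∞) η) {σ : ℝ} (hσ : |σ| = 1) (S : ℝ) {e : ℝ}
    (he : 0 < e) :
    ∀ᶠ i in atTop, ∀ α β, ∀ y ∈ innerNodes 𝓜 𝓓 i, ∀ s : ℝ, |s| ≤ S →
      |opE 𝓜 𝓓 i α β (𝓓.P i η) y + opI 𝓜 𝓓 i α β (𝓓.P i η) y +
        (s - 𝓓.P i η y) * (∫ x in 𝓜.Ω, (𝓓.cE i α β x + 𝓓.cI i α β x) *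
          nhat 𝓜.Ω (𝓓.mesh i) y x) - σ * srcF 𝓜 𝓓 i α β y -
        linearOp 𝓜 σ y (Laplacian.laplacian η y) (gradient η y) s α β| ≤ e := by
  have hΩ := 𝓜.domain.isOpen
  have hb := 𝓜.domain.isBounded
  have hη2 : ContDiff ℝ 2 η := hη.of_le (WithTop.coe_le_coe.2 le_top)
  have hη1 : ContDiff ℝ 1 η := hη.of_le (by exact_mod_cast le_top)
  have hηA := admissibleOn_of_contDiff hΩ hb hη1
  obtain ⟨hηH, hηG⟩ := mem_contH1_of_contDiff hΩ hb hη
  have hΔc := (continuous_laplacian hη2).continuousOn (s := closure 𝓜.Ω)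
  have hgc := (continuous_gradient hη1).continuousOn (s := closure 𝓜.Ω)
  obtain ⟨Ma, hMa0, hMa⟩ := exists_uniform_bound hb 𝓜.continuous_a
  obtain ⟨Mb, hMb0, hMb⟩ := exists_uniform_bound hb 𝓜.continuous_b
  obtain ⟨Mc, hMc0, hMc⟩ := exists_uniform_bound hb 𝓜.continuous_c
  obtain ⟨MΔ, hMΔ⟩ := exists_norm_le_of_bounded hb hΔc
  obtain ⟨Mg, hMg⟩ := exists_norm_le_of_bounded hb hgc
  -- `Q` sums the factors in the final estimate, whose total error is exactly `κ * Q`.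
  set Q : ℝ := 1 + |MΔ| + Ma + 2 * (|Mg| + 2) + 2 * Mb + 2 * |S| + 3 * (Mc + 2) + 2 with hQ
  have hQpos : 0 < Q := by positivity
  set κ : ℝ := min 1 (e / Q) with hκ
  have hκ0 : 0 < κ := lt_min one_pos (div_pos he hQpos)
  have hκ1 : κ ≤ 1 := min_le_left _ _
  have hκQ : κ * Q ≤ e := by
    have := min_le_right 1 (e / Q)
    rwa [← hκ, le_div_iff₀ hQpos] at this
  obtain ⟨δb, hδb, hob⟩ := exists_equicontinuity hb 𝓜.continuous_b hκ0
  obtain ⟨δc, hδc, hoc⟩ := exists_equicontinuity hb 𝓜.continuous_c hκ0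
  obtain ⟨δf, hδf, hof⟩ := exists_equicontinuity hb 𝓜.continuous_f hκ0
  obtain ⟨δΔ, hδΔ, hoΔ⟩ := exists_equicontinuity_of_continuous hb hΔc hκ0
  obtain ⟨δg, hδg, hog⟩ := exists_equicontinuity_of_continuous hb hgc hκ0
  obtain ⟨δη, hδη, hoη⟩ := exists_equicontinuity_of_continuous hb
    (hη.continuous.continuousOn (s := closure 𝓜.Ω)) hκ0
  -- Half of the minimum of the moduli, since the mesh bound is `≤ δ` while the moduli require a
  -- strict inequality.
  set δ : ℝ := min (min (min δb δc) (min δf δΔ)) (min δg δη) / 2 with hδ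
  have hδ0 : 0 < δ := by positivity
  have hconv := h.proj.convergent η hη
  filter_upwards [h.eventually_diam_le hδ0, h.eventually_consistent hκ0,
    hconv.eventually_le_const (ENNReal.ofReal_pos.2 hκ0)] with i hdiam hcons hconv α β y hy s hs
  obtain ⟨hca, hcb, hcc, hcf⟩ := hcons α β
  have hT := h.triangulates i
  have hyc : y ∈ closure 𝓜.Ω := subset_closure hy.2
  have hPη : IsP1 (𝓓.mesh i) (𝓓.P i η) := h.proj.isP1 i η hηH
  have hPA := hT.admissibleOn hPη
  have hbE := (h.cons.continuous_bE i).1 α β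
  have hbI := (h.cons.continuous_bI i).1 α β
  have hcE := (h.cons.continuous_cE i).1 α β
  have hcI := (h.cons.continuous_cI i).1 α β
  have hf := (h.cons.continuous_f i).1 α β
  have hφA := hT.admissibleOn (isP1_nhat (Ω := 𝓜.Ω) (y := y))
  have := isFiniteMeasure_restrict hb
  -- closeness of `P η` and `η`
  have hcl0 : ∀ x ∈ closure 𝓜.Ω, |𝓓.P i η x - η x| ≤ κ :=
    norm_le_of_supNorm_le hΩ ((hT.continuousOn hPη).sub hη.continuous.continuousOn) hκ0.le
      (le_self_add.trans hconv)
  have hcl1 : ∀ᵐ x ∂volume.restrict 𝓜.Ω, ‖gradient (𝓓.P i η) x - gradient η x‖ ≤ κ := by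
    filter_upwards [ae_norm_le_of_eLpNorm_top_le hκ0.le (le_add_self.trans hconv), hPA.diff,
      hηA.diff] with x hx h1 h2
    have h3 := gradient_add_smul h1 h2 (-1)
    rw [neg_one_smul, ← sub_eq_add_neg, neg_one_smul, ← sub_eq_add_neg] at h3
    rwa [h3] at hx
  have hdist : ∀ x, nhat 𝓜.Ω (𝓓.mesh i) y x ≠ 0 → dist x y ≤ δ := fun x hx =>
    dist_le_of_hat_ne_zero hdiam (hat_ne_zero_of_nhat_ne_zero hx)
  have hδlt : δ < δb ∧ δ < δc ∧ δ < δf ∧ δ < δΔ ∧ δ < δg ∧ δ < δη := by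
    have hm : 2 * δ = min (min (min δb δc) (min δf δΔ)) (min δg δη) := by rw [hδ]; ring
    have h1 : min (min (min δb δc) (min δf δΔ)) (min δg δη) ≤ min (min δb δc) (min δf δΔ) :=
      min_le_left _ _
    have h2 : min (min (min δb δc) (min δf δΔ)) (min δg δη) ≤ min δg δη := min_le_right _ _
    have h3 := h1.trans (min_le_left _ _)
    have h4 := h1.trans (min_le_right _ _)
    refine ⟨?_, ?_, ?_, ?_, ?_, ?_⟩
    · linarith [h3.trans (min_le_left _ _)]
    · linarith [h3.trans (min_le_right _ _)]
    · linarith [h4.trans (min_le_left _ _)]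
    · linarith [h4.trans (min_le_right _ _)]
    · linarith [h2.trans (min_le_left _ _)]
    · linarith [h2.trans (min_le_right _ _)]
  -- the diffusion term
  have hgreen : ∫ x in 𝓜.Ω, (inner ℝ (gradient (𝓓.P i η) x)
      (gradient (nhat 𝓜.Ω (𝓓.mesh i) y) x) : ℝ) =
      - ∫ x in 𝓜.Ω, Laplacian.laplacian η x * nhat 𝓜.Ω (𝓓.mesh i) y x := by
    obtain ⟨D, hD⟩ := exists_lipschitzWith_nhat hT hy.2
    -- The normalised hat function of an internal node belongs to `Vᵢ⁰`, so `P η` may be replaced by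
    -- `η`, for which Green's formula is available.
    rw [h.proj.orthogonal i η hηH (gradient η) (hηA.memLp_gradient.mono_exponent le_top) hηG
      _ isP1_nhat fun x hx => nhat_eq_zero_of_notMem hT hy.2 fun hx' =>
        (hΩ.frontier_eq ▸ hx).2 hx']
    exact integral_inner_gradient_eq hΩ hb hη hD nhat_nonneg
      fun x hx => nhat_eq_zero_of_notMem hT hy.2 hx
  have hΔ : |(∫ x in 𝓜.Ω, Laplacian.laplacian η x * nhat 𝓜.Ω (𝓓.mesh i) y x) -
      Laplacian.laplacian η y| ≤ κ := by
    refine abs_integral_mul_nhat_sub_le hT hy.1 hy.2 (memLp_top_of_continuousOn hΩ hb hΔc) ?_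
    filter_upwards [ae_restrict_mem hΩ.measurableSet] with x hx h0
    exact (hoΔ x (subset_closure hx) y hyc ((hdist x h0).trans_lt hδlt.2.2.2.1)).le
  -- the terms of lower order
  have hlow : |(∫ x in 𝓜.Ω, (- inner ℝ ((𝓓.bE i α β + 𝓓.bI i α β) x) (gradient (𝓓.P i η) x) +
      (𝓓.cE i α β + 𝓓.cI i α β) x * 𝓓.P i η x + (s - 𝓓.P i η y) *
        (𝓓.cE i α β + 𝓓.cI i α β) x - σ * 𝓓.f i α β x) * nhat 𝓜.Ω (𝓓.mesh i) y x) -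
      (- inner ℝ (𝓜.b α β y) (gradient η y) + 𝓜.c α β y * s - σ * 𝓜.f α β y)| ≤
      2 * κ * (|Mg| + 2) + Mb * (2 * κ) + 2 * κ * |S| + (Mc + 2) * (3 * κ) + 2 * κ := by
    refine abs_integral_mul_nhat_sub_le hT hy.1 hy.2
      ((((MemLp.inner_top (hbE.add hbI) hPA.memLp_gradient).neg.add
        (MemLp.mul_top (hcE.add hcI) hPA.memLp)).add ((hcE.add hcI).const_mul _)).sub (hf.const_mul σ)) ?_
    filter_upwards [hcb, hcc, hcf, hcl1, ae_restrict_mem hΩ.measurableSet]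
      with x hxb hxc hxf hxg hxΩ h0
    have hxc' := subset_closure hxΩ
    have hd := hdist x h0
    have kb := (hob α β x hxc' y hyc (hd.trans_lt hδlt.1)).le
    have kc := (hoc α β x hxc' y hyc (hd.trans_lt hδlt.2.1)).le
    have kf := (hof α β x hxc' y hyc (hd.trans_lt hδlt.2.2.1)).le
    have kg := (hog x hxc' y hyc (hd.trans_lt hδlt.2.2.2.2.1)).le
    have kη := (hoη x hxc' y hyc (hd.trans_lt hδlt.2.2.2.2.2)).le
    refine abs_lowerOrder_sub_le hκ0.le hκ1 ?_ ?_ ?_ ?_ ?_ (hMb α β y hyc)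
      ((hMg y hyc).trans (le_abs_self _)) (hMc α β y hyc) (hs.trans (le_abs_self _))
    · rw [two_mul]
      exact (norm_sub_le_norm_sub_add_norm_sub _ (𝓜.b α β x) _).trans
        (add_le_add ((norm_sub_rev _ _).trans_le hxb) kb)
    · rw [two_mul]
      exact (norm_sub_le_norm_sub_add_norm_sub _ (gradient η x) _).trans (add_le_add hxg kg)
    · rw [two_mul]
      exact (abs_sub_le _ (𝓜.c α β x) _).trans (add_le_add ((abs_sub_comm _ _).trans_le hxc) kc)
    · rw [← mul_sub, abs_mul, hσ, one_mul, two_mul]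
      exact (abs_sub_le _ (𝓜.f α β x) _).trans (add_le_add ((abs_sub_comm _ _).trans_le hxf) kf)
    · have h1 := (abs_sub_le _ (η x) _).trans (add_le_add (hcl0 x hxc') kη)
      have h2 := (abs_sub_le _ (η y) _).trans
        (add_le_add h1 ((abs_sub_comm _ _).trans_le (hcl0 y hyc)))
      linarith
  -- assembling
  have hsplit := galerkin_add_reaction_sub_source hT (y := y) (a := 𝓓.aE i α β + 𝓓.aI i α β)
    (hbE.add hbI) (hcE.add hcI) (hf.const_mul σ) hPA (s - 𝓓.P i η y)
  rw [← galerkin_coeff_add hT hbE hcE hbI hcI hPA, hgreen] at hsplit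
  simp only [mul_assoc σ] at hsplit
  rw [integral_const_mul] at hsplit
  rw [opE, opI, srcF]
  refine le_trans (le_of_eq (congrArg _ (congrArg₂ _ hsplit rfl))) ?_
  rw [linearOp]
  simp only [Pi.add_apply] at hlow ⊢
  have hfin := abs_diffusion_add_sub_le hκ0.le hκ1 (hca y hy) hΔ
    ((hMΔ y hyc).trans (le_abs_self _)) (hMa α β y hyc) hlow
  refine (le_of_eq ?_).trans (hfin.trans (le_trans (le_of_eq ?_) hκQ))
  · congr 1
    ring
  · rw [hQ]
    ring

end Consistency

/-! ## The discrete comparison principle -/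

section InfSup

variable {A B : Type*} [Nonempty A] [Nonempty B]

/-- The bound `M` guarantees that the real infima and suprema are attained as order-theoretic bounds
and not as default values. -/
lemma infSup_le_infSup_add {X Y : A → B → ℝ} {M c : ℝ} (hX : ∀ α β, |X α β| ≤ M)
    (hY : ∀ α β, |Y α β| ≤ M) (h : ∀ α β, X α β ≤ Y α β + c) :
    (⨅ β, ⨆ α, X α β) ≤ (⨅ β, ⨆ α, Y α β) + c := by
  have hXα : ∀ β, BddAbove (range fun α => X α β) := fun β =>
    ⟨M, by rintro _ ⟨α, rfl⟩; exact (abs_le.1 (hX α β)).2⟩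
  have hYα : ∀ β, BddAbove (range fun α => Y α β) := fun β =>
    ⟨M, by rintro _ ⟨α, rfl⟩; exact (abs_le.1 (hY α β)).2⟩
  have hXβ : BddBelow (range fun β => ⨆ α, X α β) := by
    refine ⟨-M, ?_⟩
    rintro _ ⟨β, rfl⟩
    obtain ⟨α⟩ := ‹Nonempty A›
    exact (abs_le.1 (hX α β)).1.trans (le_ciSup (hXα β) α)
  rw [← sub_le_iff_le_add]
  refine le_ciInf fun β => ?_
  rw [sub_le_iff_le_add]
  refine (ciInf_le hXβ β).trans (ciSup_le fun α => (h α β).trans ?_)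
  exact add_le_add (le_ciSup (hYα β) α) le_rfl

/-- The functional `inf sup` if `σ = 1` and `sup inf` if `σ = -1`. -/
def signedInfSup (σ : ℝ) (X : A → B → ℝ) : ℝ := σ * ⨅ β, ⨆ α, σ * X α β

lemma signedInfSup_le_add {σ : ℝ} (hσ : σ = 1 ∨ σ = -1) {X Y : A → B → ℝ} {M c : ℝ}
    (hX : ∀ α β, |X α β| ≤ M) (hY : ∀ α β, |Y α β| ≤ M) (h : ∀ α β, X α β ≤ Y α β + c) :
    signedInfSup σ X ≤ signedInfSup σ Y + c := by
  rcases hσ with rfl | rfl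
  · simpa [signedInfSup] using infSup_le_infSup_add hX hY h
  -- For `σ = -1` the outer and the inner sign reverse the order twice, so `X` and `Y` exchange
  -- roles.
  · have := infSup_le_infSup_add (X := fun α β => -Y α β) (Y := fun α β => -X α β) (M := M) (c := c)
      (by simpa using hY) (by simpa using hX) fun α β => by linarith [h α β]
    simp only [signedInfSup, neg_one_mul]
    linarith

lemma le_signedInfSup {σ : ℝ} (hσ : σ = 1 ∨ σ = -1) {X : A → B → ℝ} {M c : ℝ}
    (hX : ∀ α β, |X α β| ≤ M) (h : ∀ α β, c ≤ X α β) : c ≤ signedInfSup σ X := by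
  have h1 := signedInfSup_le_add hσ (X := fun _ _ => (0 : ℝ)) (Y := X) (M := M) (c := -c)
    (fun α β => by simpa using (abs_nonneg _).trans (hX α β)) hX fun α β => by linarith [h α β]
  have h2 : signedInfSup σ (fun (_ : A) (_ : B) => (0 : ℝ)) = 0 := by simp [signedInfSup]
  linarith

end InfSup

section Comparison

variable {d : ℕ} {A B : Type*} [MetricSpace A] [MetricSpace B] {𝓜 : IsaacsProblem d A B}
  {𝓓 : Discretisation d A B}

/-- `w` is `σ` times a numerical solution. -/
structure IsSignedSolution (𝓜 : IsaacsProblem d A B) (𝓓 : Discretisation d A B) (σ : ℝ)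
    (w : ℕ → ℕ → Eu d → ℝ) : Prop where
  isP1 : ∀ i, ∀ k ≤ 𝓓.steps i, IsP1 (𝓓.mesh i) (w i k)
  final : ∀ i, ∀ y ∈ closure 𝓜.Ω, w i (𝓓.steps i) y = σ * 𝓓.P i 𝓜.vT y
  boundary : ∀ i, ∀ k < 𝓓.steps i, ∀ y ∈ frontier 𝓜.Ω, w i k y = σ * 𝓓.P i 𝓜.g y
  equation : ∀ i, ∀ k < 𝓓.steps i, ∀ y ∈ innerNodes 𝓜 𝓓 i,
    signedInfSup σ (fun α β => opE 𝓜 𝓓 i α β (w i (k + 1)) y + opI 𝓜 𝓓 i α β (w i k) y -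
      σ * srcF 𝓜 𝓓 i α β y) = (w i (k + 1) y - w i k y) / 𝓓.h i

lemma IsStableScheme.opE_add_smul (h : IsStableScheme 𝓜 𝓓) (i : ℕ) (α : A) (β : B) {y : Eu d}
    {w₁ w₂ : Eu d → ℝ} (h₁ : IsP1 (𝓓.mesh i) w₁) (h₂ : IsP1 (𝓓.mesh i) w₂) (r : ℝ) :
    opE 𝓜 𝓓 i α β (w₁ + r • w₂) y = opE 𝓜 𝓓 i α β w₁ y + r * opE 𝓜 𝓓 i α β w₂ y :=
  galerkin_add_smul (h.triangulates i) ((h.cons.continuous_bE i).1 α β)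
    ((h.cons.continuous_cE i).1 α β) ((h.triangulates i).admissibleOn h₁)
    ((h.triangulates i).admissibleOn h₂) r

lemma IsStableScheme.opI_add_smul (h : IsStableScheme 𝓜 𝓓) (i : ℕ) (α : A) (β : B) {y : Eu d}
    {w₁ w₂ : Eu d → ℝ} (h₁ : IsP1 (𝓓.mesh i) w₁) (h₂ : IsP1 (𝓓.mesh i) w₂) (r : ℝ) :
    opI 𝓜 𝓓 i α β (w₁ + r • w₂) y = opI 𝓜 𝓓 i α β w₁ y + r * opI 𝓜 𝓓 i α β w₂ y :=
  galerkin_add_smul (h.triangulates i) ((h.cons.continuous_bI i).1 α β)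
    ((h.cons.continuous_cI i).1 α β) ((h.triangulates i).admissibleOn h₁)
    ((h.triangulates i).admissibleOn h₂) r

/-- `E` and `I` are linear and `σ² = 1`, so the two signs inside the functional cancel and only the
outer one remains. This makes the supersolution half an instance of the subsolution half. -/
lemma IsStableScheme.isSignedSolution (h : IsStableScheme 𝓜 𝓓) {v : ℕ → ℕ → Eu d → ℝ}
    (hv : IsNumericalSolution 𝓜 𝓓 v) {σ : ℝ} (hσ : σ = 1 ∨ σ = -1) :
    IsSignedSolution 𝓜 𝓓 σ fun i k => σ • v i k where
  isP1 i k hk := (hv.isP1 i k hk).smul σ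
  final i y hy := by simp [hv.final i hy]
  boundary i k hk y hy := by simp [hv.boundary i k hk hy]
  equation i k hk y hy := by
    have h0 : IsP1 (𝓓.mesh i) (0 : Eu d → ℝ) := isP1_const 0
    have hE : ∀ α β, opE 𝓜 𝓓 i α β (σ • v i (k + 1)) y = σ * opE 𝓜 𝓓 i α β (v i (k + 1)) y := by
      intro α β
      have := h.opE_add_smul i α β (y := y) h0 (hv.isP1 i (k + 1) hk) σ
      rwa [zero_add, show opE 𝓜 𝓓 i α β 0 y = 0 from galerkin_zero, zero_add] at this
    have hI : ∀ α β, opI 𝓜 𝓓 i α β (σ • v i k) y = σ * opI 𝓜 𝓓 i α β (v i k) y := by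
      intro α β
      have := h.opI_add_smul i α β (y := y) h0 (hv.isP1 i k hk.le) σ
      rwa [zero_add, show opI 𝓜 𝓓 i α β 0 y = 0 from galerkin_zero, zero_add] at this
    have hσ2 : σ * σ = 1 := by rcases hσ with rfl | rfl <;> norm_num
    have heq := hv.equation i k hk y hy
    simp only [signedInfSup, hE, hI, Pi.smul_apply, smul_eq_mul, ← mul_add, ← mul_sub, ← mul_assoc,
      hσ2, one_mul]
    rw [mul_div_assoc]
    congr 1
    linarith

variable [CompactSpace A] [CompactSpace B]

lemma IsStableScheme.exists_abs_op_le (h : IsStableScheme 𝓜 𝓓) (i : ℕ) {y : Eu d}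
    (hy : y ∈ innerNodes 𝓜 𝓓 i) {σ : ℝ} (hσ : |σ| = 1) {u w : Eu d → ℝ}
    (hu : IsP1 (𝓓.mesh i) u) (hw : IsP1 (𝓓.mesh i) w) :
    ∃ M, ∀ α β, |opE 𝓜 𝓓 i α β u y + opI 𝓜 𝓓 i α β w y - σ * srcF 𝓜 𝓓 i α β y| ≤ M := by
  have hT := h.triangulates i
  have ha : ∀ {a : A → B → Eu d → ℝ}, (Continuous fun p : A × B => a p.1 p.2 y) →
      ∃ M, ∀ α β, |a α β y| ≤ M := by
    intro a ha
    obtain ⟨M, hM⟩ := (isCompact_univ.image ha.abs).bddAbove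
    exact ⟨M, fun α β => hM ⟨(α, β), mem_univ _, rfl⟩⟩
  obtain ⟨aE, haE⟩ := ha (h.cons.continuous_aE i y hy)
  obtain ⟨aI, haI⟩ := ha (h.cons.continuous_aI i y hy)
  obtain ⟨bE, -, hbE⟩ := (h.cons.continuous_bE i).exists_bound
  obtain ⟨bI, -, hbI⟩ := (h.cons.continuous_bI i).exists_bound
  obtain ⟨cE, -, hcE⟩ := (h.cons.continuous_cE i).exists_bound
  obtain ⟨cI, -, hcI⟩ := (h.cons.continuous_cI i).exists_bound
  obtain ⟨F, -, hF⟩ := (h.cons.continuous_f i).exists_bound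
  obtain ⟨C₀, C₁, C₂, hC⟩ := abs_galerkin_le hT hy.1 hy.2 (hT.admissibleOn hu)
  obtain ⟨D₀, D₁, D₂, hD⟩ := abs_galerkin_le hT hy.1 hy.2 (hT.admissibleOn hw)
  refine ⟨(aE * C₀ + (bE * C₁ + cE * C₂)) + (aI * D₀ + (bI * D₁ + cI * D₂)) + F, fun α β => ?_⟩
  have h1 := hC _ _ _ _ _ _ ((h.cons.continuous_bE i).1 α β) ((h.cons.continuous_cE i).1 α β)
    (haE α β) (hbE α β) (hcE α β)
  have h2 := hD _ _ _ _ _ _ ((h.cons.continuous_bI i).1 α β) ((h.cons.continuous_cI i).1 α β)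
    (haI α β) (hbI α β) (hcI α β)
  have h3 : |srcF 𝓜 𝓓 i α β y| ≤ F := by
    rw [← sub_zero (srcF 𝓜 𝓓 i α β y)]
    refine abs_integral_mul_nhat_sub_le hT hy.1 hy.2 ((h.cons.continuous_f i).1 α β) ?_
    filter_upwards [hF α β] with x hx _
    rwa [sub_zero, ← Real.norm_eq_abs]
  refine (abs_sub _ _).trans (add_le_add ((abs_add_le _ _).trans (add_le_add h1 h2)) ?_)
  rwa [abs_mul, hσ, one_mul]

lemma abs_of_sign {σ : ℝ} (hσ : σ = 1 ∨ σ = -1) : |σ| = 1 := by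
  rcases hσ with rfl | rfl <;> simp

variable [Nonempty A] [Nonempty B] {σ : ℝ} {w : ℕ → ℕ → Eu d → ℝ}

/-- The discrete equation is inherited by functions that touch the solution from above. -/
lemma IsSignedSolution.touching (h : IsStableScheme 𝓜 𝓓) (hσ : σ = 1 ∨ σ = -1)
    (hw : IsSignedSolution 𝓜 𝓓 σ w) {i k : ℕ} (hk : k < 𝓓.steps i) {y : Eu d}
    (hy : y ∈ innerNodes 𝓜 𝓓 i) {W₀ W₁ : Eu d → ℝ} (hW₀ : IsP1 (𝓓.mesh i) W₀)
    (hW₁ : IsP1 (𝓓.mesh i) W₁) (h₁ : ∀ z ∈ nodes 𝓓 i, w i (k + 1) z ≤ W₁ z)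
    (h₀ : ∀ z ∈ nodes 𝓓 i, w i k z - W₀ z ≤ w i k y - W₀ y) (hpos : 0 ≤ w i k y - W₀ y) :
    - ((W₁ y - W₀ y) / 𝓓.h i) + signedInfSup σ (fun α β => opE 𝓜 𝓓 i α β W₁ y +
      opI 𝓜 𝓓 i α β W₀ y - σ * srcF 𝓜 𝓓 i α β y) ≤ - ((w i k y - W₀ y) / 𝓓.h i) := by
  have hT := h.triangulates i
  have hh := h.mesh.h_pos i
  have hw0 := hw.isP1 i k hk.le
  have hw1 := hw.isP1 i (k + 1) hk
  have hyc := subset_closure (s := 𝓜.Ω) hy.2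
  -- `W₀ - w` has a minimum over the nodes at `y`, which is a local minimum by piecewise affinity,
  -- and its value there is non-positive. Local monotonicity of `I` applies.
  have hI : ∀ α β, opI 𝓜 𝓓 i α β W₀ y ≤ opI 𝓜 𝓓 i α β (w i k) y := by
    intro α β
    have hmin : IsLocalMin (W₀ + (-1 : ℝ) • w i k) y := by
      filter_upwards [𝓜.domain.isOpen.mem_nhds hy.2] with x hx
      refine IsP1.le_of_vertices (isP1_const _) (hW₀.add (hw0.smul (-1))) (fun z hz => ?_)
        (show x ∈ (𝓓.mesh i).space from hT.space ▸ subset_closure hx)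
      have := h₀ z hz
      simp only [Pi.add_apply, Pi.smul_apply, smul_eq_mul]
      linarith
    have := h.mono.localMonotonicity i α β _ (hW₀.add (hw0.smul (-1))) y hy
      (by simp only [Pi.add_apply, Pi.smul_apply, smul_eq_mul]; linarith) hmin
    rw [h.opI_add_smul i α β hW₀ hw0] at this
    linarith
  -- `W₁ - w` is a combination of hat functions with nonnegative coefficients, and `h E φ_z ≤ φ_z`
  -- at `y` for each of them by the time step condition.
  have hE : ∀ α β, 𝓓.h i * (opE 𝓜 𝓓 i α β W₁ y - opE 𝓜 𝓓 i α β (w i (k + 1)) y) ≤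
      W₁ y - w i (k + 1) y := by
    intro α β
    have hN := (finite_vertices hT.finite)
    set N := hN.toFinset
    have hmem : ∀ z, z ∈ N ↔ z ∈ (𝓓.mesh i).vertices := fun z => hN.mem_toFinset
    set D := W₁ + (-1 : ℝ) • w i (k + 1) with hD
    have hDP : IsP1 (𝓓.mesh i) D := hW₁.add (hw1.smul (-1))
    have hrep : ∀ x ∈ closure 𝓜.Ω, D x = ∑ z ∈ N, D z * hat (𝓓.mesh i) z x := fun x hx =>
      sum_hat_eq N hmem hDP (hT.space ▸ hx)
    have h2 : opE 𝓜 𝓓 i α β D y = ∑ z ∈ N, D z * opE 𝓜 𝓓 i α β (hat (𝓓.mesh i) z) y :=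
      (galerkin_congr 𝓜.domain.isOpen fun x hx => hrep x (subset_closure hx)).trans
        (galerkin_sum hT ((h.cons.continuous_bE i).1 α β) ((h.cons.continuous_cE i).1 α β) N _
          fun z => hT.admissibleOn (isP1_hat z))
    have h3 : 𝓓.h i * opE 𝓜 𝓓 i α β D y ≤ D y := by
      rw [h2, hrep y hyc, Finset.mul_sum]
      refine Finset.sum_le_sum fun z hz => ?_
      have hz' := (hmem z).1 hz
      have hDz : 0 ≤ D z := by
        have := h₁ z hz'
        simp only [hD, Pi.add_apply, Pi.smul_apply, smul_eq_mul]
        linarith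
      have := mul_le_mul_of_nonneg_left (h.mono.timeStep i α β y hy z hz') hDz
      rw [mul_zero] at this
      linarith
    rw [hD, h.opE_add_smul i α β hW₁ hw1] at h3
    simp only [Pi.add_apply, Pi.smul_apply, smul_eq_mul] at h3
    linarith
  obtain ⟨M, hM⟩ := h.exists_abs_op_le i hy (abs_of_sign hσ) hW₁ hW₀
  obtain ⟨M', hM'⟩ := h.exists_abs_op_le i hy (abs_of_sign hσ) hw1 hw0
  have key := signedInfSup_le_add hσ (M := max M M') (c := (W₁ y - w i (k + 1) y) / 𝓓.h i)
    (fun α β => (hM α β).trans (le_max_left _ _)) (fun α β => (hM' α β).trans (le_max_right _ _))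
    fun α β => by
      have h1 := hI α β
      have h2 := hE α β
      rw [mul_comm, ← le_div_iff₀ hh] at h2
      linarith
  rw [hw.equation i k hk y hy] at key
  -- The excess of the explicit part is absorbed by the difference quotient: the contributions of
  -- time level `k + 1` cancel, and only the gap at level `k` survives.
  have e : -((W₁ y - W₀ y) / 𝓓.h i) + ((w i (k + 1) y - w i k y) / 𝓓.h i +
      (W₁ y - w i (k + 1) y) / 𝓓.h i) = -((w i k y - W₀ y) / 𝓓.h i) := by
    field_simp
    ring
  linarith

/-- The discrete comparison principle. -/
lemma IsSignedSolution.comparison (h : IsStableScheme 𝓜 𝓓) (hσ : σ = 1 ∨ σ = -1)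
    (hw : IsSignedSolution 𝓜 𝓓 σ w) {i : ℕ} {W : ℕ → Eu d → ℝ}
    (hW : ∀ k, IsP1 (𝓓.mesh i) (W k))
    (hfinal : ∀ z ∈ nodes 𝓓 i, w i (𝓓.steps i) z ≤ W (𝓓.steps i) z)
    (hbdry : ∀ k < 𝓓.steps i, ∀ z ∈ nodes 𝓓 i, z ∉ 𝓜.Ω → w i k z ≤ W k z)
    (hsuper : ∀ k < 𝓓.steps i, ∀ y ∈ innerNodes 𝓜 𝓓 i,
      0 ≤ - ((W (k + 1) y - W k y) / 𝓓.h i) + signedInfSup σ (fun α β =>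
        opE 𝓜 𝓓 i α β (W (k + 1)) y + opI 𝓜 𝓓 i α β (W k) y - σ * srcF 𝓜 𝓓 i α β y)) :
    ∀ k ≤ 𝓓.steps i, ∀ z ∈ nodes 𝓓 i, w i k z ≤ W k z := by
  intro k hk
  induction hk using Nat.decreasingInduction with
  | self => exact hfinal
  | of_succ k hk ih =>
    intro z hz
    -- Backwards in time, a positive maximum of `w - W` over the nodes must sit at an internal node
    -- by the boundary bound. There `touching` produces a strictly negative value, against the
    -- supersolution property.
    obtain ⟨y, hy, hmax⟩ := (finite_vertices (h.mesh.finite i)).exists_maximalFor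
      (fun x => w i k x - W k x) _ ⟨z, hz⟩
    have hmax' : ∀ x ∈ nodes 𝓓 i, w i k x - W k x ≤ w i k y - W k y := by
      intro x hx
      by_contra hlt
      exact hlt (hmax hx (not_le.1 hlt).le)
    by_contra hlt
    have hpos : 0 < w i k y - W k y := by linarith [hmax' z hz, not_le.1 hlt]
    have hyΩ : y ∈ 𝓜.Ω := by
      by_contra hyΩ
      linarith [hbdry k hk y hy hyΩ]
    have h1 := hw.touching h hσ hk ⟨hy, hyΩ⟩ (hW k) (hW (k + 1)) ih hmax' hpos.le
    have h2 := hsuper k hk y ⟨hy, hyΩ⟩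
    have h3 := div_pos hpos (h.mesh.h_pos i)
    linarith

end Comparison

/-! ## Bounds from above near the final time -/

section UpperBound

variable {d : ℕ} {A B : Type*} [MetricSpace A] [MetricSpace B] {𝓜 : IsaacsProblem d A B}
  {𝓓 : Discretisation d A B}

/-- These are the values of `E` and `I` on the constant one: the signs show that adding positive
constants raises the operators, and `γ` controls the effect of a time increment on `E`. -/
lemma IsStableScheme.integral_cE_mem (h : IsStableScheme 𝓜 𝓓) : ∃ γ : ℝ, ∀ i α β,
    ∀ y ∈ innerNodes 𝓜 𝓓 i,
      (0 ≤ ∫ x in 𝓜.Ω, 𝓓.cE i α β x * nhat 𝓜.Ω (𝓓.mesh i) y x) ∧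
      (∫ x in 𝓜.Ω, 𝓓.cE i α β x * nhat 𝓜.Ω (𝓓.mesh i) y x) ≤ γ ∧
      (0 ≤ ∫ x in 𝓜.Ω, 𝓓.cI i α β x * nhat 𝓜.Ω (𝓓.mesh i) y x) := by
  obtain ⟨γ, hγ⟩ := h.cons.c_bounded
  refine ⟨γ, fun i α β y hy => ⟨?_, ?_, ?_⟩⟩
  · refine integral_nonneg_of_ae ?_
    filter_upwards [h.cons.cE_nonneg i α β] with x hx using mul_nonneg hx (nhat_nonneg x)
  · have hle : ∀ᵐ x ∂volume.restrict 𝓜.Ω, ‖𝓓.cE i α β x‖ ≤ γ :=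
      ae_norm_le_of_eLpNorm_top_le γ.2 (by
        rw [ENNReal.ofReal_coe_nnreal]
        exact le_self_add.trans (hγ i α β))
    have := abs_integral_mul_nhat_sub_le (h.triangulates i) hy.1 hy.2
      ((h.cons.continuous_cE i).1 α β) (m := 0) (e := γ) (by
        filter_upwards [hle] with x hx _
        rwa [sub_zero, ← Real.norm_eq_abs])
    rw [sub_zero] at this
    exact (le_abs_self _).trans this
  · refine integral_nonneg_of_ae ?_
    filter_upwards [h.cons.cI_nonneg i α β] with x hx using mul_nonneg hx (nhat_nonneg x)

lemma IsStableScheme.opE_add_const (h : IsStableScheme 𝓜 𝓓) (i : ℕ) (α : A) (β : B) {y : Eu d}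
    {u : Eu d → ℝ} (hu : IsP1 (𝓓.mesh i) u) (r : ℝ) :
    opE 𝓜 𝓓 i α β (u + r • fun _ => 1) y = opE 𝓜 𝓓 i α β u y +
      r * ∫ x in 𝓜.Ω, 𝓓.cE i α β x * nhat 𝓜.Ω (𝓓.mesh i) y x := by
  rw [h.opE_add_smul i α β hu (isP1_const 1), ← galerkin_one]
  rfl

lemma IsStableScheme.opI_add_const (h : IsStableScheme 𝓜 𝓓) (i : ℕ) (α : A) (β : B) {y : Eu d}
    {u : Eu d → ℝ} (hu : IsP1 (𝓓.mesh i) u) (r : ℝ) :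
    opI 𝓜 𝓓 i α β (u + r • fun _ => 1) y = opI 𝓜 𝓓 i α β u y +
      r * ∫ x in 𝓜.Ω, 𝓓.cI i α β x * nhat 𝓜.Ω (𝓓.mesh i) y x := by
  rw [h.opI_add_smul i α β hu (isP1_const 1), ← galerkin_one]
  rfl

lemma IsaacsProblem.g_mem (𝓜 : IsaacsProblem d A B) : 𝓜.g ∈ contH1 𝓜.Ω := by
  obtain ⟨L, hL⟩ := 𝓜.g_lipschitz
  exact mem_contH1_of_lipschitzWith 𝓜.domain.isOpen 𝓜.domain.isBounded hL

lemma IsStableScheme.mem_frontier (h : IsStableScheme 𝓜 𝓓) {i : ℕ} {z : Eu d}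
    (hz : z ∈ nodes 𝓓 i) (hzΩ : z ∉ 𝓜.Ω) : z ∈ frontier 𝓜.Ω := by
  rw [𝓜.domain.isOpen.frontier_eq]
  exact ⟨(h.triangulates i).mem_closure_of_mem_vertices hz, hzΩ⟩

lemma IsStableScheme.eventually_abs_P_sub_le (h : IsStableScheme 𝓜 𝓓) {u : Eu d → ℝ}
    (hu : u ∈ contH1 𝓜.Ω) (hlim : Tendsto (fun i => supNorm 𝓜.Ω (𝓓.P i u - u)) atTop (𝓝 0))
    {e : ℝ} (he : 0 < e) : ∀ᶠ i in atTop, ∀ x ∈ closure 𝓜.Ω, |𝓓.P i u x - u x| ≤ e :=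
  eventually_norm_le_of_tendsto_supNorm 𝓜.domain.isOpen
    (fun i => ((h.triangulates i).continuousOn (h.proj.isP1 i _ hu)).sub hu.1) hlim he

lemma IsStableScheme.eventually_abs_P_sub_le_of_contDiff (h : IsStableScheme 𝓜 𝓓)
    {u : Eu d → ℝ} (hu : ContDiff ℝ (⊤ : ℕ∞) u) {e : ℝ} (he : 0 < e) :
    ∀ᶠ i in atTop, ∀ x ∈ closure 𝓜.Ω, |𝓓.P i u x - u x| ≤ e :=
  h.eventually_abs_P_sub_le
    (mem_contH1_of_contDiff 𝓜.domain.isOpen 𝓜.domain.isBounded hu).1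
    (tendsto_of_tendsto_of_tendsto_of_le_of_le tendsto_const_nhds (h.proj.convergent u hu)
      (fun _ => zero_le) fun _ => le_self_add) he

variable [CompactSpace A] [CompactSpace B]

lemma exists_abs_linearOp_le (𝓜 : IsaacsProblem d A B) {σ : ℝ} (hσ : |σ| = 1) (Q R S : ℝ) :
    ∃ M, 0 ≤ M ∧ ∀ x ∈ closure 𝓜.Ω, ∀ q (p : Eu d) s, |q| ≤ Q → ‖p‖ ≤ R → |s| ≤ S →
      ∀ α β, |linearOp 𝓜 σ x q p s α β| ≤ M := by
  have hb := 𝓜.domain.isBounded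
  obtain ⟨Ma, hMa0, hMa⟩ := exists_uniform_bound hb 𝓜.continuous_a
  obtain ⟨Mb, hMb0, hMb⟩ := exists_uniform_bound hb 𝓜.continuous_b
  obtain ⟨Mc, hMc0, hMc⟩ := exists_uniform_bound hb 𝓜.continuous_c
  obtain ⟨Mf, hMf0, hMf⟩ := exists_uniform_bound hb 𝓜.continuous_f
  refine ⟨Ma * |Q| + Mb * |R| + Mc * |S| + Mf, by positivity, fun x hx q p s hq hp hs α β => ?_⟩
  have hq := hq.trans (le_abs_self Q)
  have hp := hp.trans (le_abs_self R)
  have hs := hs.trans (le_abs_self S)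
  rw [linearOp]
  refine (abs_sub _ _).trans (add_le_add ((abs_add_le _ _).trans (add_le_add
    ((abs_sub _ _).trans (add_le_add ?_ ?_)) ?_)) ?_)
  · rw [abs_mul, abs_neg]
    exact mul_le_mul (hMa α β x hx) hq (abs_nonneg _) hMa0
  · exact (abs_real_inner_le_norm _ _).trans (mul_le_mul (hMb α β x hx) hp (norm_nonneg _) hMb0)
  · rw [abs_mul]
    exact mul_le_mul (hMc α β x hx) hs (abs_nonneg _) hMc0
  · rw [abs_mul, hσ, one_mul]
    exact hMf α β x hx

variable [Nonempty A] [Nonempty B] {σ : ℝ} {w : ℕ → ℕ → Eu d → ℝ}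

/-- A smooth strict upper bound of the final data yields an upper bound of the numerical
solutions. -/
lemma IsSignedSolution.le_of_final_lt (h : IsStableScheme 𝓜 𝓓) (hσ : σ = 1 ∨ σ = -1)
    (hw : IsSignedSolution 𝓜 𝓓 σ w) {η : Eu d → ℝ} (hη : ContDiff ℝ (⊤ : ℕ∞) η) {δ : ℝ}
    (hδ : 0 < δ) (hle : ∀ x ∈ closure 𝓜.Ω, σ * 𝓜.vT x + δ ≤ η x) :
    ∃ C, 0 ≤ C ∧ ∀ᶠ i in atTop, ∀ k ≤ 𝓓.steps i, ∀ z ∈ nodes 𝓓 i,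
      w i k z ≤ η z + δ + C * (𝓜.T - k * 𝓓.h i) := by
  have hΩ := 𝓜.domain.isOpen
  have hb := 𝓜.domain.isBounded
  have hσ1 := abs_of_sign hσ
  have hη2 : ContDiff ℝ 2 η := hη.of_le (WithTop.coe_le_coe.2 le_top)
  have hη1 : ContDiff ℝ 1 η := hη.of_le (by exact_mod_cast le_top)
  obtain ⟨Mη, hMη⟩ := exists_norm_le_of_bounded hb (hη.continuous.continuousOn (s := closure 𝓜.Ω))
  obtain ⟨MΔ, hMΔ⟩ := exists_norm_le_of_bounded hb
    ((continuous_laplacian hη2).continuousOn (s := closure 𝓜.Ω))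
  obtain ⟨Mg, hMg⟩ := exists_norm_le_of_bounded hb
    ((continuous_gradient hη1).continuousOn (s := closure 𝓜.Ω))
  obtain ⟨L, hL0, hL⟩ := exists_abs_linearOp_le 𝓜 hσ1 MΔ Mg (Mη + δ)
  obtain ⟨γ, hγ⟩ := h.integral_cE_mem
  have hηH := (mem_contH1_of_contDiff hΩ hb hη).1
  -- `L` bounds the linear operators on the jet of `η`, and the extra one pays for the consistency
  -- error.
  refine ⟨L + 1, by linarith, ?_⟩
  have hδ3 : 0 < δ / 3 := by linarith
  filter_upwards [h.consistency hη hσ1 (Mη + δ) one_pos,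
    h.eventually_abs_P_sub_le_of_contDiff hη hδ3,
    h.eventually_abs_P_sub_le 𝓜.g_mem h.proj.convergent_g hδ3,
    h.eventually_abs_P_sub_le 𝓜.vT_mem h.proj.convergent_vT hδ3] with i hcons hPη hPg hPv
  have hT := h.triangulates i
  have hh := h.mesh.h_pos i
  have hKh := h.mesh.steps_mul_h i
  have hP : IsP1 (𝓓.mesh i) (𝓓.P i η) := h.proj.isP1 i η hηH
  set W : ℕ → Eu d → ℝ := fun k => 𝓓.P i η + ((L + 1) * (𝓜.T - k * 𝓓.h i)) • fun _ => 1 with hW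
  have hWP : ∀ k, IsP1 (𝓓.mesh i) (W k) := fun k => hP.add ((isP1_const 1).smul _)
  have hWv : ∀ k z, W k z = 𝓓.P i η z + (L + 1) * (𝓜.T - k * 𝓓.h i) := fun k z => by simp [hW]
  have htime : ∀ k ≤ 𝓓.steps i, 0 ≤ (L + 1) * (𝓜.T - k * 𝓓.h i) := by
    intro k hk
    refine mul_nonneg (by linarith) ?_
    rw [← hKh, sub_nonneg]
    exact mul_le_mul_of_nonneg_right (by exact_mod_cast hk) hh.le
  have hσle : ∀ a b : ℝ, |a - b| ≤ δ / 3 → σ * a ≤ σ * b + δ / 3 := by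
    intro a b hab
    have : |σ * (a - b)| ≤ δ / 3 := by rwa [abs_mul, hσ1, one_mul]
    linarith [(abs_le.1 this).2]
  have hcomp := hw.comparison h hσ hWP ?_ ?_ ?_
  · intro k hk z hz
    have hzc := hT.mem_closure_of_mem_vertices hz
    have h1 := hcomp k hk z hz
    rw [hWv] at h1
    linarith [(abs_le.1 (hPη z hzc)).2]
  · intro z hz
    have hzc := hT.mem_closure_of_mem_vertices hz
    rw [hw.final i z hzc, hWv]
    linarith [hσle _ _ (hPv z hzc), hle z hzc, (abs_le.1 (hPη z hzc)).1, htime _ le_rfl]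
  · intro k hk z hz hzΩ
    have hzc := hT.mem_closure_of_mem_vertices hz
    have hzf := h.mem_frontier hz hzΩ
    rw [hw.boundary i k hk z hzf, hWv]
    -- Since `vT = g` on the boundary, the bound on the final data is also a bound on the lateral
    -- data.
    have h1 := hle z hzc
    rw [𝓜.vT_eq_g z hzf] at h1
    linarith [hσle _ _ (hPg z hzc), (abs_le.1 (hPη z hzc)).1, htime k hk.le]
  · intro k hk y hy
    have hyc := subset_closure (s := 𝓜.Ω) hy.2
    obtain ⟨M, hM⟩ := h.exists_abs_op_le i hy hσ1 (hWP (k + 1)) (hWP k)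
    have e1 : -((W (k + 1) y - W k y) / 𝓓.h i) = L + 1 := by
      rw [hWv, hWv]
      push_cast
      field_simp
      ring
    have h2 : -(L + 1) ≤ signedInfSup σ (fun α β => opE 𝓜 𝓓 i α β (W (k + 1)) y +
        opI 𝓜 𝓓 i α β (W k) y - σ * srcF 𝓜 𝓓 i α β y) := by
      refine le_signedInfSup hσ hM fun α β => ?_
      rw [hW, h.opE_add_const i α β hP, h.opI_add_const i α β hP]
      have hs : |𝓓.P i η y| ≤ Mη + δ := by
        have h3 := abs_sub_abs_le_abs_sub (𝓓.P i η y) (η y)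
        have h4 := hMη y hyc
        rw [Real.norm_eq_abs] at h4
        linarith [hPη y hyc]
      -- Consistency is used with prescribed value `P η y`, for which the shift term is zero.
      have h5 := hcons α β y hy _ hs
      rw [sub_self, zero_mul, add_zero] at h5
      have h6 := hL y hyc _ _ _ (hMΔ y hyc) (hMg y hyc) hs α β
      obtain ⟨m1, -, m2⟩ := hγ i α β y hy
      have h7 := mul_nonneg (htime (k + 1) hk) m1
      have h8 := mul_nonneg (htime k hk.le) m2
      linarith [(abs_le.1 h5).1, (abs_le.1 h6).1]
    linarith

/-- The numerical solutions are uniformly bounded from above. -/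
lemma IsSignedSolution.exists_eventually_le (h : IsStableScheme 𝓜 𝓓) (hσ : σ = 1 ∨ σ = -1)
    (hw : IsSignedSolution 𝓜 𝓓 σ w) : ∃ M, ∀ᶠ i in atTop, ∀ k ≤ 𝓓.steps i, ∀ z ∈ nodes 𝓓 i,
      w i k z ≤ M := by
  obtain ⟨M, hM⟩ := exists_norm_le_of_bounded 𝓜.domain.isBounded 𝓜.vT_mem.1
  obtain ⟨C, hC0, hC⟩ := hw.le_of_final_lt h hσ (contDiff_const (c := M + 1)) one_pos fun x hx => by
    have h1 : |σ * 𝓜.vT x| ≤ M := by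
      rw [abs_mul, abs_of_sign hσ, one_mul]
      exact hM x hx
    linarith [(abs_le.1 h1).2]
  refine ⟨M + 1 + 1 + C * 𝓜.T, hC.mono fun i hi k hk z hz => (hi k hk z hz).trans ?_⟩
  have : 0 ≤ (k : ℝ) * 𝓓.h i := mul_nonneg (Nat.cast_nonneg k) (h.mesh.h_pos i).le
  have := mul_le_mul_of_nonneg_left (show 𝓜.T - k * 𝓓.h i ≤ 𝓜.T by linarith) hC0
  linarith

end UpperBound

/-! ## Envelopes -/

section Envelopes

/-- A limit superior in `ℝ` is meaningful only for bounded functions; the eventual lower bound `b`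
excludes the default value. -/
lemma upperEnv_le {X : Type*} [TopologicalSpace X] {D : Set X} {f : X → ℝ} {x : X} (hx : x ∈ D)
    {a b : ℝ} (hb : ∀ᶠ y in 𝓝[D] x, b ≤ f y) (h : ∀ᶠ y in 𝓝[D] x, f y ≤ a) :
    upperEnv D f x ≤ a := by
  have : (𝓝[D] x).NeBot := mem_closure_iff_nhdsWithin_neBot.1 (subset_closure hx)
  exact limsup_le_of_le (IsCoboundedUnder.of_frequently_ge hb.frequently) h

lemma le_upperEnv {X : Type*} [TopologicalSpace X] {D : Set X} {f : X → ℝ} {x : X}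
    {a b : ℝ} (hb : ∀ᶠ y in 𝓝[D] x, f y ≤ b) (h : ∃ᶠ y in 𝓝[D] x, a ≤ f y) :
    a ≤ upperEnv D f x :=
  le_limsup_of_frequently_le h ⟨b, hb⟩

/-- Valid without any boundedness, because in `ℝ` the infimum is defined by reflecting the supremum,
so default values correspond too. -/
lemma lowerEnv_neg {X : Type*} [TopologicalSpace X] (D : Set X) (f : X → ℝ) (x : X) :
    lowerEnv D (fun y => - f y) x = - upperEnv D f x := by
  rw [lowerEnv, upperEnv, liminf, limsup, limsInf, limsSup, Real.sInf_def, neg_neg]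
  congr 1
  ext a
  simp only [Set.mem_neg, mem_ofPred_eq, eventually_map]
  refine eventually_congr (Eventually.of_forall fun y => ?_)
  exact le_neg

lemma upperEnv_neg {X : Type*} [TopologicalSpace X] (D : Set X) (f : X → ℝ) (x : X) :
    upperEnv D (fun y => - f y) x = - lowerEnv D f x := by
  have := lowerEnv_neg D (fun y => - f y) x
  simp only [neg_neg] at this
  rw [this, neg_neg]

variable {d : ℕ} {A B : Type*} [MetricSpace A] [MetricSpace B] {𝓜 : IsaacsProblem d A B}
  {𝓓 : Discretisation d A B}

lemma hasBasis_nodeFilter {A B : Type*} (𝓓 : Discretisation d A B) (z : ℝ × Eu d) :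
    (nodeFilter 𝓓 z).HasBasis (fun p : ℕ × ℝ => True ∧ 0 < p.2) fun p =>
      (((fun q : ℕ × ℕ × Eu d => q.1) ⁻¹' Ici p.1) ∩
        ((fun q : ℕ × ℕ × Eu d => ((q.2.1 * 𝓓.h q.1, q.2.2) : ℝ × Eu d)) ⁻¹' Metric.ball z p.2)) ∩
        {q | q.2.1 ≤ 𝓓.steps q.1 ∧ q.2.2 ∈ nodes 𝓓 q.1} :=
  ((atTop_basis.comap _).inf (Metric.nhds_basis_ball.comap _)).inf_principal _

lemma eventually_nodeFilter {A B : Type*} {𝓓 : Discretisation d A B} {z : ℝ × Eu d}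
    {p : ℕ → ℕ → Eu d → Prop} :
    (∀ᶠ q in nodeFilter 𝓓 z, p q.1 q.2.1 q.2.2) ↔ ∃ ρ > 0, ∀ᶠ i in atTop, ∀ k ≤ 𝓓.steps i,
      ∀ y ∈ nodes 𝓓 i, dist ((k * 𝓓.h i, y) : ℝ × Eu d) z < ρ → p i k y := by
  rw [(hasBasis_nodeFilter 𝓓 z).eventually_iff]
  constructor
  · rintro ⟨⟨i₀, ρ⟩, ⟨-, hρ⟩, h⟩
    exact ⟨ρ, hρ, eventually_atTop.2 ⟨i₀, fun i hi k hk y hy hd =>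
      @h (i, k, y) ⟨⟨hi, hd⟩, hk, hy⟩⟩⟩
  · rintro ⟨ρ, hρ, h⟩
    obtain ⟨i₀, hi₀⟩ := eventually_atTop.1 h
    exact ⟨(i₀, ρ), ⟨trivial, hρ⟩, fun q hq => hi₀ q.1 hq.1.1 q.2.1 hq.2.1 q.2.2 hq.2.2 hq.1.2⟩

/-- This replaces the extraction of subsequences: any property `P` that holds on all fine levels may
be imposed on the level found. -/
lemma frequently_nodeFilter {A B : Type*} {𝓓 : Discretisation d A B} {z : ℝ × Eu d}
    {p : ℕ → ℕ → Eu d → Prop}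
    (h : ∃ᶠ q in nodeFilter 𝓓 z, p q.1 q.2.1 q.2.2) {ρ : ℝ} (hρ : 0 < ρ) {P : ℕ → Prop}
    (hP : ∀ᶠ i in atTop, P i) : ∃ i, P i ∧ ∃ k ≤ 𝓓.steps i, ∃ y ∈ nodes 𝓓 i,
      dist ((k * 𝓓.h i, y) : ℝ × Eu d) z < ρ ∧ p i k y := by
  by_contra hcon
  push Not at hcon
  refine h ((eventually_nodeFilter (p := fun i k y => ¬ p i k y)).2 ⟨ρ, hρ, hP.mono fun i hi k hk y hy hd => ?_⟩)
  exact hcon i hi k hk y hy hd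

lemma IsStableScheme.time_mem (h : IsStableScheme 𝓜 𝓓) {i k : ℕ} (hk : k ≤ 𝓓.steps i) :
    (k * 𝓓.h i : ℝ) ∈ Icc 0 𝓜.T := by
  have hh := (h.mesh.h_pos i).le
  refine ⟨mul_nonneg (Nat.cast_nonneg k) hh, ?_⟩
  rw [← h.mesh.steps_mul_h i]
  exact mul_le_mul_of_nonneg_right (by exact_mod_cast hk) hh

lemma IsStableScheme.mem_cyl (h : IsStableScheme 𝓜 𝓓) {i k : ℕ} (hk : k ≤ 𝓓.steps i) {y : Eu d}
    (hy : y ∈ nodes 𝓓 i) : ((k * 𝓓.h i, y) : ℝ × Eu d) ∈ cyl 𝓜 :=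
  ⟨h.time_mem hk, (h.triangulates i).mem_closure_of_mem_vertices hy⟩

lemma IsStableScheme.nodeFilter_neBot (h : IsStableScheme 𝓜 𝓓) {z : ℝ × Eu d}
    (hz : z ∈ cyl 𝓜) : (nodeFilter 𝓓 z).NeBot := by
  refine ⟨fun hbot => ?_⟩
  have hF : ∀ᶠ _ in nodeFilter 𝓓 z, False := by
    rw [hbot]
    exact eventually_bot
  obtain ⟨ρ, hρ, hev⟩ := (eventually_nodeFilter (p := fun _ _ _ => False)).1 hF
  obtain ⟨i, hi, hnode, hh⟩ := (hev.and ((h.eventually_exists_node (half_pos hρ)).and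
    (h.mesh.h_tendsto.eventually_lt_const hρ))).exists
  obtain ⟨y, hy, hyd⟩ := hnode z.2 hz.2
  have hh0 := h.mesh.h_pos i
  -- The time step `⌊t / h⌋` lies within `h` below `t` and does not exceed the number of steps, as
  -- `t ≤ T`.
  have hfl := Nat.floor_le (div_nonneg hz.1.1 hh0.le)
  have hfl2 := Nat.lt_floor_add_one (z.1 / 𝓓.h i)
  rw [le_div_iff₀ hh0] at hfl
  rw [div_lt_iff₀ hh0] at hfl2
  refine hi ⌊z.1 / 𝓓.h i⌋₊ ?_ y hy ?_
  · refine Nat.floor_le_of_le ?_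
    rw [div_le_iff₀ hh0, h.mesh.steps_mul_h i]
    exact hz.1.2
  · rw [Prod.dist_eq]
    refine max_lt ?_ (hyd.trans_lt (half_lt_self hρ))
    rw [Real.dist_eq, abs_lt]
    constructor <;> linarith

/-- `u` is the upper envelope of the family `w`. -/
structure IsUpperLimit (𝓜 : IsaacsProblem d A B) (𝓓 : Discretisation d A B)
    (w : ℕ → ℕ → Eu d → ℝ) (u : ℝ × Eu d → ℝ) : Prop where
  eventually_le : ∀ z ∈ cyl 𝓜, ∀ δ > 0, ∃ ρ > 0, ∀ᶠ i in atTop, ∀ k ≤ 𝓓.steps i,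
      ∀ y ∈ nodes 𝓓 i, dist ((k * 𝓓.h i, y) : ℝ × Eu d) z < ρ → w i k y ≤ u z + δ
  frequently_ge : ∀ z ∈ cyl 𝓜, ∀ δ > 0, ∀ ρ > 0, ∀ {P : ℕ → Prop}, (∀ᶠ i in atTop, P i) →
      ∃ i, P i ∧ ∃ k ≤ 𝓓.steps i, ∃ y ∈ nodes 𝓓 i,
      dist ((k * 𝓓.h i, y) : ℝ × Eu d) z < ρ ∧ u z - δ ≤ w i k y

lemma exists_isUpperLimit (h : IsStableScheme 𝓜 𝓓) {w : ℕ → ℕ → Eu d → ℝ} {M : ℝ}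
    (hM : ∀ᶠ i in atTop, ∀ k ≤ 𝓓.steps i, ∀ z ∈ nodes 𝓓 i, |w i k z| ≤ M) :
    ∃ u : ℝ × Eu d → ℝ, (∀ z ∈ cyl 𝓜, upperEnvelope 𝓓 w z = (u z : EReal)) ∧
      IsUpperLimit 𝓜 𝓓 w u ∧ ∀ z ∈ cyl 𝓜, |u z| ≤ M := by
  have hev : ∀ z, ∀ᶠ q in nodeFilter 𝓓 z, |w q.1 q.2.1 q.2.2| ≤ M := fun z =>
    (eventually_nodeFilter (p := fun i k y => |w i k y| ≤ M)).2
      ⟨1, one_pos, hM.mono fun i hi k hk y hy _ => hi k hk y hy⟩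
  have hle : ∀ z, upperEnvelope 𝓓 w z ≤ (M : EReal) := fun z =>
    limsup_le_of_le (h := (hev z).mono fun q hq => EReal.coe_le_coe_iff.2 (abs_le.1 hq).2)
  have hge : ∀ z ∈ cyl 𝓜, ((-M : ℝ) : EReal) ≤ upperEnvelope 𝓓 w z := fun z hz => by
    have := h.nodeFilter_neBot hz
    exact le_limsup_of_frequently_le
      ((hev z).mono fun q hq => EReal.coe_le_coe_iff.2 (abs_le.1 hq).1).frequently
  have hcoe : ∀ z ∈ cyl 𝓜, upperEnvelope 𝓓 w z = ((upperEnvelope 𝓓 w z).toReal : EReal) :=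
    fun z hz => (EReal.coe_toReal ((hle z).trans_lt (EReal.coe_lt_top M)).ne
      ((EReal.bot_lt_coe _).trans_le (hge z hz)).ne').symm
  refine ⟨fun z => (upperEnvelope 𝓓 w z).toReal, hcoe, ⟨fun z hz δ hδ => ?_,
    fun z hz δ hδ ρ hρ P hP => ?_⟩, fun z hz => ?_⟩
  · refine (eventually_nodeFilter (p := fun i k y => w i k y ≤ _)).1 ?_
    have hlt : upperEnvelope 𝓓 w z < (((upperEnvelope 𝓓 w z).toReal + δ : ℝ) : EReal) := by
      conv_lhs => rw [hcoe z hz]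
      exact EReal.coe_lt_coe_iff.2 (by linarith)
    filter_upwards [eventually_lt_of_limsup_lt hlt] with q hq
    exact (EReal.coe_lt_coe_iff.1 hq).le
  · refine frequently_nodeFilter (p := fun i k y => _ ≤ w i k y) ?_ hρ hP
    have hlt : (((upperEnvelope 𝓓 w z).toReal - δ : ℝ) : EReal) < upperEnvelope 𝓓 w z := by
      conv_rhs => rw [hcoe z hz]
      exact EReal.coe_lt_coe_iff.2 (by linarith)
    exact (frequently_lt_of_lt_limsup (h := hlt)).mono fun q hq => (EReal.coe_lt_coe_iff.1 hq).le
  · have h1 := hle z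
    have h2 := hge z hz
    rw [hcoe z hz, EReal.coe_le_coe_iff] at h1 h2
    exact abs_le.2 ⟨h2, h1⟩

/-- Upper semicontinuity: a discrete value close to `z` nearly attains `u z`, and it is still
governed by the upper bound around `z₀`. -/
lemma IsUpperLimit.le_add {w : ℕ → ℕ → Eu d → ℝ} {u : ℝ × Eu d → ℝ} (hu : IsUpperLimit 𝓜 𝓓 w u)
    {z₀ : ℝ × Eu d} (hz₀ : z₀ ∈ cyl 𝓜) {δ : ℝ} (hδ : 0 < δ) :
    ∃ ρ > 0, ∀ z ∈ cyl 𝓜, dist z z₀ < ρ → u z ≤ u z₀ + δ := by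
  obtain ⟨ρ, hρ, hev⟩ := hu.eventually_le z₀ hz₀ (δ / 2) (half_pos hδ)
  refine ⟨ρ, hρ, fun z hz hd => ?_⟩
  obtain ⟨i, hi, k, hk, y, hy, hyd, hyw⟩ := hu.frequently_ge z hz (δ / 2) (half_pos hδ)
    (ρ - dist z z₀) (by linarith) hev
  have := hi k hk y hy ((dist_triangle _ z _).trans_lt (by linarith))
  linarith

lemma IsUpperLimit.upperEnv_eq {w : ℕ → ℕ → Eu d → ℝ} {u : ℝ × Eu d → ℝ}
    (hu : IsUpperLimit 𝓜 𝓓 w u) {M : ℝ} (hM : ∀ z ∈ cyl 𝓜, |u z| ≤ M) {z : ℝ × Eu d}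
    (hz : z ∈ cyl 𝓜) : upperEnv (cyl 𝓜) u z = u z := by
  refine le_antisymm (le_of_forall_pos_le_add fun δ hδ => ?_) ?_
  · obtain ⟨ρ, hρ, h⟩ := hu.le_add hz hδ
    refine upperEnv_le hz (b := -M) ?_ ?_
    · filter_upwards [self_mem_nhdsWithin] with y hy using (abs_le.1 (hM y hy)).1
    · filter_upwards [self_mem_nhdsWithin, mem_nhdsWithin_of_mem_nhds (Metric.ball_mem_nhds z hρ)]
        with y hy hyd using h y hy hyd
  · refine le_upperEnv (b := M) ?_ ?_
    · filter_upwards [self_mem_nhdsWithin] with y hy using (abs_le.1 (hM y hy)).2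
    · exact fun hn => (hn.self_of_nhdsWithin hz) le_rfl

end Envelopes

/-! ## The equation is inherited by the upper envelope -/

section Touching

variable {d : ℕ} {A B : Type*} [MetricSpace A] [MetricSpace B] {𝓜 : IsaacsProblem d A B}
  {𝓓 : Discretisation d A B} {w : ℕ → ℕ → Eu d → ℝ} {u : ℝ × Eu d → ℝ}

lemma isCompact_cyl (𝓜 : IsaacsProblem d A B) : IsCompact (cyl 𝓜) :=
  isCompact_Icc.prod 𝓜.domain.isBounded.isCompact_closure

/-- Discrete functions stay below the maximum of `u - Q` away from the maximiser. -/
lemma IsUpperLimit.exists_gap (hu : IsUpperLimit 𝓜 𝓓 w u) (h : IsStableScheme 𝓜 𝓓)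
    {Q : ℝ × Eu d → ℝ} (hQ : Continuous Q) {z₀ : ℝ × Eu d}
    (hstrict : ∀ z ∈ cyl 𝓜, z ≠ z₀ → u z - Q z < u z₀ - Q z₀) {ρ : ℝ} (hρ : 0 < ρ) :
    ∃ m > 0, ∀ᶠ i in atTop, ∀ k ≤ 𝓓.steps i, ∀ y ∈ nodes 𝓓 i,
      ρ ≤ dist ((k * 𝓓.h i, y) : ℝ × Eu d) z₀ →
        w i k y - Q (k * 𝓓.h i, y) ≤ u z₀ - Q z₀ - m := by
  let P : Set (ℝ × Eu d) → Prop := fun S => ∃ m > 0, ∀ᶠ i in atTop, ∀ k ≤ 𝓓.steps i,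
    ∀ y ∈ nodes 𝓓 i, ((k * 𝓓.h i, y) : ℝ × Eu d) ∈ S →
      w i k y - Q (k * 𝓓.h i, y) ≤ u z₀ - Q z₀ - m
  have hcompact : IsCompact (cyl 𝓜 \ Metric.ball z₀ ρ) :=
    (isCompact_cyl 𝓜).diff Metric.isOpen_ball
  have key : P (cyl 𝓜 \ Metric.ball z₀ ρ) := by
    refine hcompact.induction_on (p := P) ⟨1, one_pos, Eventually.of_forall
      fun i k _ y _ hS => hS.elim⟩ ?_ ?_ ?_
    · rintro s t hst ⟨m, hm, hev⟩
      exact ⟨m, hm, hev.mono fun i hi k hk y hy hS => hi k hk y hy (hst hS)⟩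
    · rintro s t ⟨m, hm, hev⟩ ⟨m', hm', hev'⟩
      refine ⟨min m m', lt_min hm hm', ?_⟩
      filter_upwards [hev, hev'] with i hi hi' k hk y hy hS
      rcases hS with hS | hS
      · linarith [hi k hk y hy hS, min_le_left m m']
      · linarith [hi' k hk y hy hS, min_le_right m m']
    · rintro z ⟨hz, hzball⟩
      have hne : z ≠ z₀ := fun h => hzball (h ▸ Metric.mem_ball_self hρ)
      set g := (u z₀ - Q z₀) - (u z - Q z) with hg
      have hg0 : 0 < g / 3 := by linarith [hstrict z hz hne]
      obtain ⟨r, hr, hev⟩ := hu.eventually_le z hz (g / 3) hg0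
      obtain ⟨r', hr', hQr⟩ := Metric.continuousAt_iff.1 (hQ.continuousAt (x := z)) (g / 3) hg0
      refine ⟨Metric.ball z (min r r'), mem_nhdsWithin_of_mem_nhds
        (Metric.ball_mem_nhds z (lt_min hr hr')), g / 3, hg0, ?_⟩
      filter_upwards [hev] with i hi k hk y hy hS
      have h1 := hi k hk y hy (hS.trans_le (min_le_left _ _))
      have h2 := hQr (hS.trans_le (min_le_right _ _))
      rw [Real.dist_eq] at h2
      linarith [(abs_lt.1 h2).1]
  obtain ⟨m, hm, hev⟩ := key
  exact ⟨m, hm, hev.mono fun i hi k hk y hy hd =>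
    hi k hk y hy ⟨h.mem_cyl hk hy, fun hball => absurd hd (not_le.2 hball)⟩⟩

/-- Maximisers of discrete functions minus a test function converge to a strict maximiser of their
upper envelope minus the test function. -/
lemma IsUpperLimit.exists_maximiser_near (hu : IsUpperLimit 𝓜 𝓓 w u) (h : IsStableScheme 𝓜 𝓓)
    {θ : ℝ → ℝ} (hθ : Continuous θ) {η : Eu d → ℝ} (hη : ContDiff ℝ (⊤ : ℕ∞) η)
    {z₀ : ℝ × Eu d} (hz₀ : z₀ ∈ cyl 𝓜)
    (hstrict : ∀ z ∈ cyl 𝓜, z ≠ z₀ → u z - (θ z.1 + η z.2) < u z₀ - (θ z₀.1 + η z₀.2))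
    {ρ : ℝ} (hρ : 0 < ρ) {P : ℕ → Prop} (hP : ∀ᶠ i in atTop, P i) :
    ∃ i, P i ∧ ∃ k ≤ 𝓓.steps i, ∃ y ∈ nodes 𝓓 i, dist ((k * 𝓓.h i, y) : ℝ × Eu d) z₀ < ρ ∧
      |w i k y - u z₀| ≤ ρ ∧ ∀ k' ≤ 𝓓.steps i, ∀ y' ∈ nodes 𝓓 i,
        w i k' y' - (θ (k' * 𝓓.h i) + 𝓓.P i η y') ≤ w i k y - (θ (k * 𝓓.h i) + 𝓓.P i η y) := by
  set Q : ℝ × Eu d → ℝ := fun z => θ z.1 + η z.2 with hQdef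
  have hQ : Continuous Q := (hθ.comp continuous_fst).add (hη.continuous.comp continuous_snd)
  obtain ⟨r₁, hr₁, hev₁⟩ := hu.eventually_le z₀ hz₀ (ρ / 2) (half_pos hρ)
  obtain ⟨r₂, hr₂, hQ₂⟩ := Metric.continuousAt_iff.1 (hQ.continuousAt (x := z₀)) (ρ / 8)
    (by linarith)
  set r := min ρ (min r₁ r₂) with hr
  have hr0 : 0 < r := lt_min hρ (lt_min hr₁ hr₂)
  obtain ⟨m, hm, hgap⟩ := hu.exists_gap h hQ hstrict hr0
  -- Four errors of size `m' / 8` arise below: near-attainment of `u z₀`, continuity of `Q`, and the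
  -- projection at two nodes. Their sum `m' / 2` stays below the gap `m`, so the maximiser lies in
  -- the small ball.
  set m' := min m ρ with hm'
  have hm0 : 0 < m' := lt_min hm hρ
  have hm8 : 0 < m' / 8 := by linarith
  obtain ⟨r₃, hr₃, hQ₃⟩ := Metric.continuousAt_iff.1 (hQ.continuousAt (x := z₀)) (m' / 8) hm8
  obtain ⟨i, ⟨hPi, h1, hg, hPη⟩, k', hk', y', hy', hd', hw'⟩ := hu.frequently_ge z₀ hz₀ (m' / 8)
    hm8 r₃ hr₃ (hP.and (hev₁.and (hgap.and (h.eventually_abs_P_sub_le_of_contDiff hη hm8))))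
  have hfin : (Iic (𝓓.steps i) ×ˢ nodes 𝓓 i).Finite :=
    (finite_Iic _).prod (finite_vertices (h.mesh.finite i))
  obtain ⟨⟨k, y⟩, ⟨hk, hy⟩, hmax⟩ := exists_max_image _
    (fun q : ℕ × Eu d => w i q.1 q.2 - (θ (q.1 * 𝓓.h i) + 𝓓.P i η q.2)) hfin ⟨(k', y'), hk', hy'⟩
  have hcl : ∀ z ∈ nodes 𝓓 i, |𝓓.P i η z - η z| ≤ m' / 8 := fun z hz =>
    hPη z ((h.triangulates i).mem_closure_of_mem_vertices hz)
  have hmm : m' ≤ m := min_le_left _ _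
  have hmρ : m' ≤ ρ := min_le_right _ _
  have hq' := hQ₃ hd'
  rw [Real.dist_eq] at hq'
  have hval : u z₀ - Q z₀ - m' / 2 ≤ w i k y - Q (k * 𝓓.h i, y) := by
    have h2 := hmax (k', y') ⟨hk', hy'⟩
    have h3 := (abs_le.1 (hcl y' hy')).2
    have h4 := (abs_le.1 (hcl y hy)).1
    have h5 := (abs_lt.1 hq').2
    simp only [hQdef] at h2 h5 ⊢
    linarith
  have hdist : dist ((k * 𝓓.h i, y) : ℝ × Eu d) z₀ < r := by
    by_contra hd
    linarith [hg k hk y hy (not_lt.1 hd)]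
  refine ⟨i, hPi, k, hk, y, hy, hdist.trans_le (min_le_left _ _), ?_,
    fun k' hk' y' hy' => hmax (k', y') ⟨hk', hy'⟩⟩
  have h6 := h1 k hk y hy (hdist.trans_le ((min_le_right _ _).trans (min_le_left _ _)))
  have h7 := hQ₂ (hdist.trans_le ((min_le_right _ _).trans (min_le_right _ _)))
  rw [Real.dist_eq] at h7
  rw [abs_le]
  constructor <;> linarith [(abs_lt.1 h7).1]

/-- Nodes near `x` with values near `u z₀` are internal, unless the boundary condition holds. -/
lemma IsSignedSolution.exists_mem_of_near {σ : ℝ} (hσ : σ = 1 ∨ σ = -1)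
    (h : IsStableScheme 𝓜 𝓓) (hw : IsSignedSolution 𝓜 𝓓 σ w) {x : Eu d} {U : ℝ}
    (hx : x ∈ 𝓜.Ω ∨ σ * 𝓜.g x < U) : ∃ ρ > 0, ∀ᶠ i in atTop, ∀ k < 𝓓.steps i,
      ∀ y ∈ nodes 𝓓 i, dist y x < ρ → |w i k y - U| ≤ ρ → y ∈ 𝓜.Ω := by
  rcases hx with hx | hx
  · obtain ⟨ρ, hρ, hball⟩ := Metric.isOpen_iff.1 𝓜.domain.isOpen x hx
    exact ⟨ρ, hρ, Eventually.of_forall fun i k _ y _ hd _ => hball hd⟩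
  · obtain ⟨L, hL⟩ := 𝓜.g_lipschitz
    set G := U - σ * 𝓜.g x with hG
    have hG4 : 0 < G / 4 := by linarith
    obtain ⟨r, hr, hgr⟩ := Metric.continuousAt_iff.1 (hL.continuous.continuousAt (x := x)) _ hG4
    refine ⟨min r (G / 4), lt_min hr hG4, ?_⟩
    filter_upwards [h.eventually_abs_P_sub_le 𝓜.g_mem h.proj.convergent_g hG4]
      with i hi k hk y hy hd hU
    by_contra hyΩ
    rw [hw.boundary i k hk y (h.mem_frontier hy hyΩ)] at hU
    have h1 := hi y ((h.triangulates i).mem_closure_of_mem_vertices hy)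
    have h2 := hgr (hd.trans_le (min_le_left _ _))
    rw [Real.dist_eq] at h2
    have h3 := (abs_le.1 (hU.trans (min_le_right _ _))).1
    have h4 : |σ * (𝓓.P i 𝓜.g y - 𝓜.g x)| ≤ G / 4 + G / 4 := by
      rw [abs_mul, abs_of_sign hσ, one_mul]
      exact (abs_sub_le _ (𝓜.g y) _).trans (add_le_add h1 h2.le)
    linarith [(abs_le.1 h4).2]

variable [CompactSpace A] [CompactSpace B] [Nonempty A] [Nonempty B]

/-- At a discrete maximiser `y` near the strict maximum, the test function lifted to touch `w` from
above inherits the discrete equation. Consistency replaces the discrete operators by `linearOp`,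
with `r'` the difference quotient in time. -/
lemma IsUpperLimit.exists_discrete_test {σ : ℝ} (hσ : σ = 1 ∨ σ = -1) (h : IsStableScheme 𝓜 𝓓)
    (hw : IsSignedSolution 𝓜 𝓓 σ w) (hu : IsUpperLimit 𝓜 𝓓 w u) (r C : ℝ) {η : Eu d → ℝ}
    (hη : ContDiff ℝ (⊤ : ℕ∞) η) {t : ℝ} {x : Eu d} (hz₀ : (t, x) ∈ cyl' 𝓜)
    (hstrict : ∀ z ∈ cyl 𝓜, z ≠ (t, x) → u z - (r * (z.1 - t) + C * (z.1 - t) ^ 2 + η z.2) <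
      u (t, x) - η x) (hx : x ∈ 𝓜.Ω ∨ σ * 𝓜.g x < u (t, x)) {ρ : ℝ} (hρ : 0 < ρ) :
    ∃ s ∈ Ico 0 𝓜.T, ∃ y ∈ 𝓜.Ω, ∃ p r', |s - t| < ρ ∧ dist y x < ρ ∧ |p - u (t, x)| ≤ ρ ∧
      |r' - r| ≤ ρ ∧ - r' + signedInfSup σ
        (linearOp 𝓜 σ y (Laplacian.laplacian η y) (gradient η y) p) ≤ ρ := by
  have hσ1 := abs_of_sign hσ
  have hz₀' : (t, x) ∈ cyl 𝓜 := ⟨Ico_subset_Icc_self hz₀.1, hz₀.2⟩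
  set θ : ℝ → ℝ := fun s => r * (s - t) + C * (s - t) ^ 2 with hθdef
  have hθ : Continuous θ := by fun_prop
  obtain ⟨γ, hγ⟩ := h.integral_cE_mem
  obtain ⟨ρ₁, hρ₁, hmem⟩ := hw.exists_mem_of_near hσ h hx
  -- `ρ₁` makes the node internal, `T - t` keeps its time before `T`, and the last entry bounds the
  -- slope error `|C| * 3 * ρ₂` by `ρ`.
  set ρ₂ := min (min ρ ρ₁) (min (𝓜.T - t) (ρ / (3 * (|C| + 1)))) with hρ₂
  have hTt : 0 < 𝓜.T - t := sub_pos.2 hz₀.1.2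
  have hC0 : 0 < 3 * (|C| + 1) := by positivity
  have hρ₂0 : 0 < ρ₂ := lt_min (lt_min hρ hρ₁) (lt_min hTt (div_pos hρ hC0))
  have hD0 : 0 < 2 * (|γ| + 1) * (|r| + ρ) := by positivity
  have hstr : ∀ z ∈ cyl 𝓜, z ≠ (t, x) →
      u z - (θ z.1 + η z.2) < u (t, x) - (θ (t, x).1 + η (t, x).2) := by
    intro z hz hne
    have := hstrict z hz hne
    simp only [hθdef, sub_self] at this ⊢
    linarith
  obtain ⟨i, ⟨hin, hcons, hh1, hh2⟩, k, hk, y, hy, hd, hwu, hmax⟩ := hu.exists_maximiser_near h hθ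
    hη hz₀' hstr hρ₂0 (hmem.and ((h.consistency hη hσ1 (|u (t, x)| + ρ) (half_pos hρ)).and
      ((h.mesh.h_tendsto.eventually_lt_const hρ₂0).and
        (h.mesh.h_tendsto.eventually_lt_const (div_pos hρ hD0)))))
  have hT := h.triangulates i
  have hh := h.mesh.h_pos i
  set s : ℝ := k * 𝓓.h i with hs
  rw [Prod.dist_eq, max_lt_iff] at hd
  obtain ⟨hd1, hd2⟩ := hd
  rw [Real.dist_eq] at hd1
  simp only at hd1 hd2
  have hle1 : ρ₂ ≤ ρ := (min_le_left _ _).trans (min_le_left _ _)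
  have hle2 : ρ₂ ≤ ρ₁ := (min_le_left _ _).trans (min_le_right _ _)
  have hle3 : ρ₂ ≤ 𝓜.T - t := (min_le_right _ _).trans (min_le_left _ _)
  have hle4 : ρ₂ * (3 * (|C| + 1)) ≤ ρ := by
    rw [← le_div_iff₀ hC0]
    exact (min_le_right _ _).trans (min_le_right _ _)
  have hsT : s < 𝓜.T := by linarith [(abs_lt.1 hd1).2]
  have hkK : k < 𝓓.steps i := by
    refine lt_of_le_of_ne hk ?_
    rintro rfl
    rw [hs, h.mesh.steps_mul_h i] at hsT
    exact lt_irrefl _ hsT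
  have hyΩ : y ∈ 𝓜.Ω := hin k hkK y hy (hd2.trans_le hle2) (hwu.trans hle2)
  have hyI : y ∈ innerNodes 𝓜 𝓓 i := ⟨hy, hyΩ⟩
  set p := w i k y with hp
  have hP : IsP1 (𝓓.mesh i) (𝓓.P i η) := h.proj.isP1 i η
    (mem_contH1_of_contDiff 𝓜.domain.isOpen 𝓜.domain.isBounded hη).1
  set Δθ := θ ((k + 1 : ℕ) * 𝓓.h i) - θ s with hΔθ
  set r' := Δθ / 𝓓.h i with hr'
  -- For the quadratic `θ` the forward quotient is computed exactly, without a remainder.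
  have hr'eq : r' - r = C * (2 * (s - t) + 𝓓.h i) := by
    rw [hr', hΔθ, hθdef]
    push_cast
    rw [show ((k : ℝ) + 1) * 𝓓.h i = s + 𝓓.h i by rw [hs]; ring]
    field_simp
    ring
  have hr'le : |r' - r| ≤ ρ := by
    rw [hr'eq, abs_mul]
    have h1 : |2 * (s - t) + 𝓓.h i| ≤ 3 * ρ₂ := by
      rw [abs_le]
      constructor <;> linarith [(abs_lt.1 hd1).1, (abs_lt.1 hd1).2]
    have h2 := mul_le_mul_of_nonneg_left h1 (abs_nonneg C)
    linarith
  have hΔθle : |Δθ| * (|γ| + 1) ≤ ρ / 2 := by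
    have h1 : Δθ = r' * 𝓓.h i := by rw [hr']; field_simp
    have h2 : |r'| ≤ |r| + ρ := by linarith [abs_sub_abs_le_abs_sub r' r]
    rw [h1, abs_mul, abs_of_pos hh]
    rw [lt_div_iff₀ hD0] at hh2
    have h3 : |r'| * 𝓓.h i ≤ (|r| + ρ) * 𝓓.h i := mul_le_mul_of_nonneg_right h2 hh.le
    have h4 := mul_le_mul_of_nonneg_right h3 (by positivity : 0 ≤ |γ| + 1)
    linarith
  refine ⟨s, ⟨(h.time_mem hk).1, hsT⟩, y, hyΩ, p, r', hd1.trans_le hle1, hd2.trans_le hle1,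
    hwu.trans hle1, hr'le, ?_⟩
  -- `W₀` is `P η` lifted to the value of `w` at `y`, so the gap in `touching` is zero. `W₁` adds
  -- the increment of `θ`; its effect on the explicit reaction term is at most `ρ / 2` by the choice
  -- of `h`.
  set W₀ : Eu d → ℝ := 𝓓.P i η + (p - 𝓓.P i η y) • fun _ => 1 with hW₀
  set W₁ : Eu d → ℝ := 𝓓.P i η + (p - 𝓓.P i η y + Δθ) • fun _ => 1 with hW₁
  have hW₀P : IsP1 (𝓓.mesh i) W₀ := hP.add ((isP1_const 1).smul _)
  have hW₁P : IsP1 (𝓓.mesh i) W₁ := hP.add ((isP1_const 1).smul _)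
  have hW₀v : ∀ z, W₀ z = 𝓓.P i η z + (p - 𝓓.P i η y) := fun z => by simp [hW₀]
  have hW₁v : ∀ z, W₁ z = 𝓓.P i η z + (p - 𝓓.P i η y + Δθ) := fun z => by simp [hW₁]
  have htouch := hw.touching h hσ hkK hyI hW₀P hW₁P
    (fun z hz => by
      have := hmax (k + 1) hkK z hz
      rw [hW₁v]
      linarith)
    (fun z hz => by
      have := hmax k hk z hz
      rw [hW₀v, hW₀v]
      linarith) (by rw [hW₀v]; linarith)
  have e0 : w i k y - W₀ y = 0 := by rw [hW₀v]; linarith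
  have e1 : W₁ y - W₀ y = Δθ := by rw [hW₁v, hW₀v]; ring
  rw [e0, e1, zero_div, neg_zero] at htouch
  obtain ⟨M, hM⟩ := h.exists_abs_op_le i hyI hσ1 hW₁P hW₀P
  obtain ⟨M', -, hM'⟩ := exists_abs_linearOp_le 𝓜 hσ1 |Laplacian.laplacian η y| ‖gradient η y‖ |p|
  have key := signedInfSup_le_add hσ (M := max M M') (c := ρ)
    (fun α β => (hM' y (subset_closure hyΩ) _ _ _ le_rfl le_rfl le_rfl α β).trans
      (le_max_right _ _)) (fun α β => (hM α β).trans (le_max_left _ _))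
    fun α β => by
      have hpS : |p| ≤ |u (t, x)| + ρ := by
        linarith [abs_sub_abs_le_abs_sub p (u (t, x)), hwu.trans hle1]
      have h1 := (abs_le.1 (hcons α β y hyI p hpS)).1
      obtain ⟨m1, m2, -⟩ := hγ i α β y hyI
      have hφA := hT.admissibleOn (isP1_nhat (Ω := 𝓜.Ω) (y := y))
      have := isFiniteMeasure_restrict 𝓜.domain.isBounded
      have h2 : ∫ z in 𝓜.Ω, (𝓓.cE i α β z + 𝓓.cI i α β z) * nhat 𝓜.Ω (𝓓.mesh i) y z =
          (∫ z in 𝓜.Ω, 𝓓.cE i α β z * nhat 𝓜.Ω (𝓓.mesh i) y z) +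
            ∫ z in 𝓜.Ω, 𝓓.cI i α β z * nhat 𝓜.Ω (𝓓.mesh i) y z := by
        simp only [add_mul]
        exact integral_add
          ((MemLp.mul_top ((h.cons.continuous_cE i).1 α β) hφA.memLp).integrable le_top)
          ((MemLp.mul_top ((h.cons.continuous_cI i).1 α β) hφA.memLp).integrable le_top)
      rw [hW₁, hW₀, h.opE_add_const i α β hP, h.opI_add_const i α β hP]
      have h3 : |Δθ * ∫ z in 𝓜.Ω, 𝓓.cE i α β z * nhat 𝓜.Ω (𝓓.mesh i) y z| ≤ ρ / 2 := by
        rw [abs_mul, abs_of_nonneg m1]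
        refine (mul_le_mul_of_nonneg_left ?_ (abs_nonneg _)).trans hΔθle
        linarith [le_abs_self γ]
      rw [h2] at h1
      linarith [(abs_le.1 h3).1]
  linarith

end Touching

/-! ## Smooth test functions -/

section TestFunctions

/-- The remainder has derivative `f'(y) - f'(z₀) - f''(z₀)(y - z₀)`, by symmetry of the second
derivative. This is small relative to the distance, and the mean value inequality on a ball
integrates the estimate. -/
lemma exists_abs_taylor_le {E : Type*} [NormedAddCommGroup E] [NormedSpace ℝ E] {f : E → ℝ}
    (hf : ContDiff ℝ 2 f) (z₀ : E) {ε : ℝ} (hε : 0 < ε) : ∃ r > 0, ∀ z, ‖z - z₀‖ < r →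
      |f z - f z₀ - fderiv ℝ f z₀ (z - z₀) -
        1 / 2 * fderiv ℝ (fderiv ℝ f) z₀ (z - z₀) (z - z₀)| ≤ ε * ‖z - z₀‖ ^ 2 := by
  have hdiff : Differentiable ℝ f := hf.differentiable (by norm_num)
  have hdiff2 : Differentiable ℝ (fderiv ℝ f) :=
    (hf.fderiv_right (m := 1) (by norm_num)).differentiable (by norm_num)
  have hsymm : IsSymmSndFDerivAt ℝ f z₀ := hf.contDiffAt.isSymmSndFDerivAt (by simp)
  set D₂ := fderiv ℝ (fderiv ℝ f) z₀ with hD₂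
  have hlo := (hdiff2 z₀).hasFDerivAt.isLittleO.def hε
  obtain ⟨r, hr, hball⟩ := Metric.eventually_nhds_iff.1 hlo
  refine ⟨r, hr, fun z hz => ?_⟩
  set R : E → ℝ := fun y => f y - fderiv ℝ f z₀ (y - z₀) - 1 / 2 * D₂ (y - z₀) (y - z₀) with hR
  have hRd : ∀ y, HasFDerivAt R (fderiv ℝ f y - fderiv ℝ f z₀ - D₂ (y - z₀)) y := by
    intro y
    have h0 : HasFDerivAt (fun y : E => y - z₀) (ContinuousLinearMap.id ℝ E) y :=
      (hasFDerivAt_id y).sub_const z₀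
    have h1 := ((fderiv ℝ f z₀).hasFDerivAt (x := y - z₀)).comp y h0
    have h2 := ((D₂.hasFDerivAt (x := y - z₀)).comp y h0).clm_apply h0
    refine (((hdiff y).hasFDerivAt.sub h1).sub (h2.const_mul (1 / 2))).congr_fderiv ?_
    refine ContinuousLinearMap.ext fun e => ?_
    have h3 : D₂ e (y - z₀) = D₂ (y - z₀) e := hsymm e (y - z₀)
    simp only [map_sub, sub_apply] at h3
    simp
    linarith
  have hmean := (convex_closedBall z₀ ‖z - z₀‖).norm_image_sub_le_of_norm_hasFDerivWithin_le
    (f := R) (C := ε * ‖z - z₀‖) (fun y _ => (hRd y).hasFDerivWithinAt) (fun y hy => ?_)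
    (Metric.mem_closedBall_self (norm_nonneg _)) (y := z) (by simp [dist_eq_norm])
  · rw [Real.norm_eq_abs] at hmean
    have e1 : R z - R z₀ = f z - f z₀ - fderiv ℝ f z₀ (z - z₀) - 1 / 2 * D₂ (z - z₀) (z - z₀) := by
      simp only [hR, sub_self, map_zero, mul_zero]
      ring
    rw [e1] at hmean
    linarith
  · rw [Metric.mem_closedBall, dist_eq_norm] at hy
    exact (hball (by rw [dist_eq_norm]; exact hy.trans_lt hz)).trans
      (mul_le_mul_of_nonneg_left hy hε.le)

lemma hasDerivAt_line {E : Type*} [NormedAddCommGroup E] [NormedSpace ℝ E] {F : Type*}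
    [NormedAddCommGroup F] [NormedSpace ℝ F] {f : E → F}
    (hf : Differentiable ℝ f) (x e : E) (t : ℝ) :
    HasDerivAt (fun t : ℝ => f (x + t • e)) (fderiv ℝ f (x + t • e) e) t := by
  have h : HasDerivAt (fun t : ℝ => x + t • e) e t := by
    simpa using ((hasDerivAt_id t).smul_const e).const_add x
  exact (hf (x + t • e)).hasFDerivAt.comp_hasDerivAt t h

lemma fderiv_fderiv_apply_self {E : Type*} [NormedAddCommGroup E] [NormedSpace ℝ E] {f : E → ℝ}
    (hf : ContDiff ℝ 2 f) (x e : E) :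
    fderiv ℝ (fderiv ℝ f) x e e = deriv (deriv fun t : ℝ => f (x + t • e)) 0 := by
  have hdiff : Differentiable ℝ f := hf.differentiable (by norm_num)
  have hdiff2 : Differentiable ℝ (fderiv ℝ f) :=
    (hf.fderiv_right (m := 1) (by norm_num)).differentiable (by norm_num)
  rw [funext fun t => (hasDerivAt_line hdiff x e t).deriv]
  have := ((hasDerivAt_line hdiff2 x e 0).clm_apply (hasDerivAt_const (0 : ℝ) e)).deriv
  simp only [zero_smul, add_zero, map_zero] at this
  exact this.symm

variable {d : ℕ}

/-- The quadratic polynomial with the derivatives `L` and `H` at `x`, with penalties. -/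
def testFun (L : Eu d →L[ℝ] ℝ) (H : Eu d →L[ℝ] Eu d →L[ℝ] ℝ) (ε C : ℝ) (x y : Eu d) : ℝ :=
  L (y - x) + 1 / 2 * H (y - x) (y - x) + ε * ‖y - x‖ ^ 2 + C * (‖y - x‖ ^ 2) ^ 2

variable {L : Eu d →L[ℝ] ℝ} {H : Eu d →L[ℝ] Eu d →L[ℝ] ℝ} {ε C : ℝ} {x : Eu d}

lemma contDiff_testFun {n : WithTop ℕ∞} : ContDiff ℝ n (testFun L H ε C x) := by
  have h : ContDiff ℝ n fun y : Eu d => y - x := contDiff_id.sub contDiff_const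
  have h2 := h.norm_sq ℝ
  exact (((L.contDiff.comp h).add (contDiff_const.mul ((H.contDiff.comp h).clm_apply h))).add
    (contDiff_const.mul h2)).add (contDiff_const.mul (h2.pow 2))

/-- Along a line the test function is a polynomial in `t`, from which its derivatives at `x` are
read off. The quartic penalty affects neither the first nor the second. -/
lemma testFun_line (e : Eu d) : (fun t : ℝ => testFun L H ε C x (x + t • e)) = fun t =>
    t * L e + t ^ 2 * (1 / 2 * H e e + ε * ‖e‖ ^ 2) + t ^ 4 * (C * ‖e‖ ^ 4) := by
  funext t
  simp only [testFun, add_sub_cancel_left, map_smul, smul_apply, smul_eq_mul,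
    norm_smul, mul_pow, Real.norm_eq_abs, sq_abs]
  ring

lemma fderiv_testFun : fderiv ℝ (testFun L H ε C x) x = L := by
  ext e
  have h1 := hasDerivAt_line
    ((contDiff_testFun (n := 1) (L := L) (H := H) (ε := ε) (C := C) (x := x)).differentiable
      (by norm_num)) x e 0
  rw [testFun_line] at h1
  have h2 : HasDerivAt (fun t : ℝ => t * L e + t ^ 2 * (1 / 2 * H e e + ε * ‖e‖ ^ 2) +
      t ^ 4 * (C * ‖e‖ ^ 4)) (L e) 0 := by
    have := (((hasDerivAt_id (0 : ℝ)).mul_const (L e)).add ((hasDerivAt_pow 2 (0 : ℝ)).mul_const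
      (1 / 2 * H e e + ε * ‖e‖ ^ 2))).add ((hasDerivAt_pow 4 (0 : ℝ)).mul_const (C * ‖e‖ ^ 4))
    exact this.congr_deriv (by simp)
  have := h1.unique h2
  simpa using this

lemma fderiv_fderiv_testFun (e : Eu d) :
    fderiv ℝ (fderiv ℝ (testFun L H ε C x)) x e e = H e e + 2 * ε * ‖e‖ ^ 2 := by
  rw [fderiv_fderiv_apply_self contDiff_testFun, testFun_line]
  have h1 : deriv (fun t : ℝ => t * L e + t ^ 2 * (1 / 2 * H e e + ε * ‖e‖ ^ 2) +
      t ^ 4 * (C * ‖e‖ ^ 4)) = fun t => L e + t * (H e e + 2 * ε * ‖e‖ ^ 2) +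
        t ^ 3 * (4 * (C * ‖e‖ ^ 4)) := by
    funext t
    have := ((((hasDerivAt_id t).mul_const (L e)).add ((hasDerivAt_pow 2 t).mul_const
      (1 / 2 * H e e + ε * ‖e‖ ^ 2))).add ((hasDerivAt_pow 4 t).mul_const (C * ‖e‖ ^ 4))).deriv
    refine Eq.trans this ?_
    simp
    ring
  rw [h1]
  have := ((((hasDerivAt_id (0 : ℝ)).mul_const (H e e + 2 * ε * ‖e‖ ^ 2)).const_add (L e)).add
    ((hasDerivAt_pow 3 (0 : ℝ)).mul_const (4 * (C * ‖e‖ ^ 4)))).deriv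
  refine Eq.trans this ?_
  simp

lemma laplacian_testFun : Laplacian.laplacian (testFun L H ε C x) x =
    ∑ i, H (EuclideanSpace.basisFun (Fin d) ℝ i) (EuclideanSpace.basisFun (Fin d) ℝ i) +
      2 * d * ε := by
  rw [laplacian_eq_sum]
  simp only [fderiv_fderiv_testFun, OrthonormalBasis.norm_eq_one, Finset.sum_add_distrib]
  simp
  ring

lemma laplacian_slice {ψ : ℝ × Eu d → ℝ} (hψ : ContDiff ℝ 2 ψ) (t : ℝ) (x : Eu d) :
    Laplacian.laplacian (fun y => ψ (t, y)) x = ∑ i, fderiv ℝ (fderiv ℝ ψ) (t, x)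
      (0, EuclideanSpace.basisFun (Fin d) ℝ i) (0, EuclideanSpace.basisFun (Fin d) ℝ i) := by
  rw [laplacian_eq_sum]
  refine Finset.sum_congr rfl fun i _ => ?_
  rw [fderiv_fderiv_apply_self hψ, fderiv_fderiv_apply_self (by fun_prop)]
  simp

lemma fderiv_slice {ψ : ℝ × Eu d → ℝ} (hψ : ContDiff ℝ 2 ψ) (t : ℝ) (x : Eu d) :
    fderiv ℝ (fun y => ψ (t, y)) x =
      (fderiv ℝ ψ (t, x)).comp (ContinuousLinearMap.inr ℝ ℝ (Eu d)) :=
  ((hψ.differentiable (by norm_num) (t, x)).hasFDerivAt.comp x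
    (hasFDerivAt_prodMk_right t x)).fderiv

lemma deriv_slice {ψ : ℝ × Eu d → ℝ} (hψ : ContDiff ℝ 2 ψ) (t : ℝ) (x : Eu d) :
    deriv (fun s => ψ (s, x)) t = fderiv ℝ ψ (t, x) (1, 0) := by
  have h : HasDerivAt (fun s : ℝ => (s, x)) ((1 : ℝ), (0 : Eu d)) t :=
    (hasDerivAt_id t).prodMk (hasDerivAt_const t x)
  exact ((hψ.differentiable (by norm_num) (t, x)).hasFDerivAt.comp_hasDerivAt t h).deriv

/-- Young's inequality separates the variables in the Taylor polynomial at a local maximum. -/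
lemma exists_le_quadratic_of_isLocalMaxOn {A B : Type*} [MetricSpace A] [MetricSpace B]
    (𝓜 : IsaacsProblem d A B) {u ψ : ℝ × Eu d → ℝ} (hψ : ContDiff ℝ 2 ψ) {t : ℝ} {x : Eu d}
    (hz₀ : (t, x) ∈ cyl' 𝓜) (hmax : IsLocalMaxOn (fun z => u z - ψ z) (cyl' 𝓜) (t, x)) {e : ℝ}
    (he0 : 0 < e) {r : ℝ} (hr : r = fderiv ℝ ψ (t, x) (1, 0)) {L : Eu d →L[ℝ] ℝ}
    (hL : ∀ v, L v = fderiv ℝ ψ (t, x) (0, v)) {H : Eu d →L[ℝ] Eu d →L[ℝ] ℝ}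
    (hH : ∀ v, H v v = fderiv ℝ (fderiv ℝ ψ) (t, x) (0, v) (0, v)) :
    ∃ K, 0 ≤ K ∧ ∃ ρ > 0, ∀ z ∈ cyl 𝓜, dist z (t, x) < ρ → u z - u (t, x) ≤
      r * (z.1 - t) + (L (z.2 - x) + 1 / 2 * H (z.2 - x) (z.2 - x) + 2 * e * ‖z.2 - x‖ ^ 2) +
        K * (z.1 - t) ^ 2 := by
  set D₁ := fderiv ℝ ψ (t, x) with hD₁
  set D₂ := fderiv ℝ (fderiv ℝ ψ) (t, x) with hD₂
  set K := ‖D₂‖ with hK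
  have hK0 : 0 ≤ K := norm_nonneg D₂
  have hsymm : IsSymmSndFDerivAt ℝ ψ (t, x) := hψ.contDiffAt.isSymmSndFDerivAt (by simp)
  obtain ⟨r₁, hr₁, hT⟩ := exists_abs_taylor_le hψ (t, x) he0
  obtain ⟨r₂, hr₂, hloc⟩ := Metric.mem_nhdsWithin_iff.1 hmax
  -- The bound `T - t` keeps times below `T`, since the maximum is relative to `[0,T)` whereas the
  -- conclusion is about the closed cylinder.
  set ρ := min (min r₁ r₂) (𝓜.T - t) with hρ
  have hρ0 : 0 < ρ := lt_min (lt_min hr₁ hr₂) (sub_pos.2 hz₀.1.2)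
  -- The three terms come from the second time derivative, the Taylor remainder, and Young's
  -- inequality for the mixed derivative.
  refine ⟨K / 2 + e + K ^ 2 / (4 * e), by positivity, ρ, hρ0, ?_⟩
  rintro ⟨s, y⟩ hz hd
  have h1 := hT (s, y) (by
    rw [← dist_eq_norm]
    exact hd.trans_le ((min_le_left _ _).trans (min_le_left _ _)))
  have h2 : u (s, y) - ψ (s, y) ≤ u (t, x) - ψ (t, x) := by
    refine hloc ⟨hd.trans_le ((min_le_left _ _).trans (min_le_right _ _)), ⟨hz.1.1, ?_⟩, hz.2⟩
    have := (le_max_left _ _).trans_lt (hd.trans_le (min_le_right _ _))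
    rw [Real.dist_eq] at this
    linarith [(abs_lt.1 this).2]
  simp only [← hD₁, ← hD₂] at h1
  set τ := s - t with hτ
  set v := y - x with hv
  have hsplit : ((s, y) - (t, x) : ℝ × Eu d) = τ • (1, 0) + (0, v) := by
    ext1 <;> simp [hτ, hv]
  have e1 : D₁ ((s, y) - (t, x)) = r * τ + L v := by
    rw [hsplit, map_add, map_smul, smul_eq_mul, mul_comm, ← hr, ← hL]
  have e2 : D₂ ((s, y) - (t, x)) ((s, y) - (t, x)) =
      τ ^ 2 * D₂ (1, 0) (1, 0) + 2 * τ * D₂ (1, 0) (0, v) + H v v := by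
    have h3 := hsymm (0, v) (1, 0)
    simp only [← hD₂] at h3
    rw [hsplit]
    simp only [map_add, map_smul, add_apply, smul_apply, smul_eq_mul, h3]
    rw [hH]
    ring
  have n1 : ‖((1, 0) : ℝ × Eu d)‖ = 1 := by simp [Prod.norm_def]
  have n2 : ‖((0, v) : ℝ × Eu d)‖ = ‖v‖ := by simp [Prod.norm_def]
  have e3 : D₂ (1, 0) (1, 0) ≤ K := by
    have := D₂.le_opNorm₂ (1, 0) (1, 0)
    rw [n1, mul_one, mul_one] at this
    exact (le_abs_self _).trans this
  have e4 : |D₂ (1, 0) (0, v)| ≤ K * ‖v‖ := by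
    have := D₂.le_opNorm₂ (1, 0) (0, v)
    rwa [n1, n2, mul_one] at this
  have e5 : ‖((s, y) - (t, x) : ℝ × Eu d)‖ ^ 2 ≤ τ ^ 2 + ‖v‖ ^ 2 := by
    rw [show ((s, y) - (t, x) : ℝ × Eu d) = (τ, v) from rfl, Prod.norm_def, Real.norm_eq_abs]
    rcases max_cases |τ| ‖v‖ with h | h <;> simp only [h.1, sq_abs] <;> nlinarith
  have e6 : τ * D₂ (1, 0) (0, v) ≤ e * ‖v‖ ^ 2 + K ^ 2 / (4 * e) * τ ^ 2 := by
    have h3 : τ * D₂ (1, 0) (0, v) ≤ |τ| * (K * ‖v‖) := (le_abs_self _).trans (by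
      rw [abs_mul]
      exact mul_le_mul_of_nonneg_left e4 (abs_nonneg _))
    have h4 : |τ| * (K * ‖v‖) ≤ e * ‖v‖ ^ 2 + K ^ 2 / (4 * e) * |τ| ^ 2 := by
      have h5 : e * ‖v‖ ^ 2 + K ^ 2 / (4 * e) * |τ| ^ 2 - |τ| * (K * ‖v‖) =
          e * (‖v‖ - K / (2 * e) * |τ|) ^ 2 := by
        field_simp
        ring
      have := mul_nonneg he0.le (sq_nonneg (‖v‖ - K / (2 * e) * |τ|))
      linarith
    rw [sq_abs] at h4
    exact h3.trans h4
  rw [e1, e2] at h1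
  have h6 := (abs_le.1 h1).2
  have h7 := mul_le_mul_of_nonneg_left e5 he0.le
  have h8 := mul_le_mul_of_nonneg_left e3 (sq_nonneg τ)
  change u (s, y) - u (t, x) ≤ r * τ + (L v + 1 / 2 * H v v + 2 * e * ‖v‖ ^ 2) +
    (K / 2 + e + K ^ 2 / (4 * e)) * τ ^ 2
  linarith

/-- A local maximum can be made strict and global by perturbing the test function. -/
lemma exists_strict_test {A B : Type*} [MetricSpace A] [MetricSpace B] (𝓜 : IsaacsProblem d A B)
    {u : ℝ × Eu d → ℝ} {M : ℝ} (hM : ∀ z ∈ cyl 𝓜, |u z| ≤ M) {ψ : ℝ × Eu d → ℝ}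
    (hψ : ContDiff ℝ 2 ψ) {t : ℝ} {x : Eu d} (hz₀ : (t, x) ∈ cyl' 𝓜)
    (hmax : IsLocalMaxOn (fun z => u z - ψ z) (cyl' 𝓜) (t, x)) {ε : ℝ} (hε : 0 < ε) :
    ∃ (C : ℝ) (η : Eu d → ℝ), ContDiff ℝ (⊤ : ℕ∞) η ∧
      gradient η x = gradient (fun y => ψ (t, y)) x ∧
      |Laplacian.laplacian η x - Laplacian.laplacian (fun y => ψ (t, y)) x| ≤ ε ∧
      ∀ z ∈ cyl 𝓜, z ≠ (t, x) → u z -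
        (deriv (fun s => ψ (s, x)) t * (z.1 - t) + C * (z.1 - t) ^ 2 + η z.2) <
          u (t, x) - η x := by
  -- The penalty `3 * e * ‖v‖ ^ 2` changes the Laplacian by `6 * d * e ≤ ε`; the local estimate uses
  -- only `2 * e`, and the remaining `e` gives strictness in space.
  set e := ε / (6 * (d + 1)) with he
  have hd0 : (0 : ℝ) < 6 * (d + 1) := by positivity
  have he0 : 0 < e := div_pos hε hd0
  have hed : 6 * d * e ≤ ε := by
    have : e * (6 * (d + 1)) = ε := by rw [he]; field_simp
    linarith
  set D₁ := fderiv ℝ ψ (t, x) with hD₁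
  set D₂ := fderiv ℝ (fderiv ℝ ψ) (t, x) with hD₂
  set r := D₁ (1, 0) with hr
  set L : Eu d →L[ℝ] ℝ := D₁.comp (ContinuousLinearMap.inr ℝ ℝ (Eu d)) with hL
  set ι := ContinuousLinearMap.inr ℝ ℝ (Eu d) with hι
  set H : Eu d →L[ℝ] Eu d →L[ℝ] ℝ := D₂.bilinearComp ι ι with hH
  obtain ⟨K, hK0, ρ, hρ0, hnear⟩ := exists_le_quadratic_of_isLocalMaxOn 𝓜 hψ hz₀ hmax he0 hr
    (L := L) (fun v => rfl) (H := H) (fun v => rfl)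
  obtain ⟨N, hN⟩ : ∃ N, ∀ z ∈ cyl 𝓜,
      |r * (z.1 - t) + (L (z.2 - x) + 1 / 2 * H (z.2 - x) (z.2 - x))| ≤ N := by
    have hc : Continuous fun z : ℝ × Eu d =>
        r * (z.1 - t) + (L (z.2 - x) + 1 / 2 * H (z.2 - x) (z.2 - x)) := by fun_prop
    exact (isCompact_cyl 𝓜).exists_bound_of_continuousOn hc.continuousOn
  have hz₀' : (t, x) ∈ cyl 𝓜 := ⟨Ico_subset_Icc_self hz₀.1, hz₀.2⟩
  have hMn : 0 ≤ M := (abs_nonneg _).trans (hM _ hz₀')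
  have hNn : 0 ≤ N := (abs_nonneg _).trans (hN _ hz₀')
  -- The `1` gives strictness in time near the maximum. The quotients dominate `2 * M + N` at
  -- distance at least `ρ`, in time by the quadratic term and in space by the quartic one, which
  -- leaves the Laplacian at `x` unchanged.
  set C₁ := K + 1 + (2 * M + N + 1) / ρ ^ 2 with hC₁
  set C₂ := (2 * M + N + 1) / (ρ ^ 2) ^ 2 with hC₂
  have hC₁0 : K + 1 ≤ C₁ := le_add_of_nonneg_right (by positivity)
  have hC₁1 : (2 * M + N + 1) / ρ ^ 2 ≤ C₁ := by linarith
  have hC₂0 : 0 ≤ C₂ := by positivity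
  refine ⟨C₁, testFun L H (3 * e) C₂ x, contDiff_testFun, ?_, ?_, ?_⟩
  · rw [gradient, gradient, fderiv_testFun, fderiv_slice hψ]
  · rw [laplacian_testFun, laplacian_slice hψ]
    have : ∑ i, H (EuclideanSpace.basisFun (Fin d) ℝ i) (EuclideanSpace.basisFun (Fin d) ℝ i) =
        ∑ i, D₂ (0, EuclideanSpace.basisFun (Fin d) ℝ i)
          (0, EuclideanSpace.basisFun (Fin d) ℝ i) := rfl
    rw [this, add_sub_cancel_left, abs_of_nonneg (by positivity)]
    linarith
  · intro z hz hne
    rw [deriv_slice hψ, ← hD₁, ← hr]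
    have e0 : testFun L H (3 * e) C₂ x x = 0 := by simp [testFun]
    rw [e0]
    simp only [testFun]
    set τ := z.1 - t with hτ
    set v := z.2 - x with hv
    have hq1 : 0 ≤ τ ^ 2 := sq_nonneg _
    have hq2 : 0 ≤ ‖v‖ ^ 2 := sq_nonneg _
    have hq3 : 0 ≤ C₂ * (‖v‖ ^ 2) ^ 2 := by positivity
    have hq4 : 0 ≤ e * ‖v‖ ^ 2 := by positivity
    by_cases hd : dist z (t, x) < ρ
    · have h1 := hnear z hz hd
      have h2 := mul_le_mul_of_nonneg_right hC₁0 hq1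
      have h3 : 0 < τ ^ 2 + e * ‖v‖ ^ 2 := by
        by_contra hcon
        refine hne (Prod.ext ?_ ?_)
        · have : τ ^ 2 = 0 := by linarith
          exact sub_eq_zero.1 (pow_eq_zero_iff two_ne_zero |>.1 this)
        · have h4 : e * ‖v‖ ^ 2 = 0 := by linarith
          have h5 := (mul_eq_zero.1 h4).resolve_left he0.ne'
          exact sub_eq_zero.1 (norm_eq_zero.1 (pow_eq_zero_iff two_ne_zero |>.1 h5))
      simp only [← hτ, ← hv] at h1
      linarith
    · have h1 := (abs_le.1 (hN z hz)).1
      have h2 := (abs_le.1 (hM z hz)).2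
      have h3 := (abs_le.1 (hM _ hz₀')).1
      have h4 : 2 * M + N + 1 ≤ C₁ * τ ^ 2 + C₂ * (‖v‖ ^ 2) ^ 2 := by
        have hpos : 0 < 2 * M + N + 1 := by positivity
        have hρ2 : 0 < ρ ^ 2 := by positivity
        rcases le_max_iff.1 (not_lt.1 hd) with h | h
        · rw [Real.dist_eq] at h
          have h5 : ρ ^ 2 ≤ τ ^ 2 := by
            rw [← sq_abs τ]
            exact pow_le_pow_left₀ hρ0.le h 2
          have h6 := mul_le_mul hC₁1 h5 hρ2.le (by linarith)
          rw [div_mul_cancel₀ _ hρ2.ne'] at h6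
          linarith
        · rw [dist_eq_norm] at h
          have h5 : ρ ^ 2 ≤ ‖v‖ ^ 2 := pow_le_pow_left₀ hρ0.le h 2
          have h6 := mul_le_mul_of_nonneg_left (pow_le_pow_left₀ hρ2.le h5 2) hC₂0
          rw [hC₂, div_mul_cancel₀ _ (pow_pos hρ2 2).ne'] at h6
          have h7 : 0 ≤ C₁ * τ ^ 2 := mul_nonneg (by linarith) hq1
          linarith
      simp only [← hτ, ← hv] at h1
      linarith

end TestFunctions

/-! ## The viscosity inequality -/

section Viscosity

variable {d : ℕ} {A B : Type*} [MetricSpace A] [MetricSpace B] {𝓜 : IsaacsProblem d A B}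
  {𝓓 : Discretisation d A B} {w : ℕ → ℕ → Eu d → ℝ} {u : ℝ × Eu d → ℝ} {σ : ℝ}

lemma jet_const_mul {ψ : ℝ × Eu d → ℝ} (hψ : ContDiff ℝ 2 ψ) (t : ℝ) (x : Eu d) :
    Laplacian.laplacian (fun y => σ * ψ (t, y)) x =
        σ * Laplacian.laplacian (fun y => ψ (t, y)) x ∧
      gradient (fun y => σ * ψ (t, y)) x = σ • gradient (fun y => ψ (t, y)) x ∧
      deriv (fun s => σ * ψ (s, x)) t = σ * deriv (fun s => ψ (s, x)) t := by
  have h1 : ContDiff ℝ 2 fun y => ψ (t, y) := by fun_prop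
  refine ⟨InnerProductSpace.laplacian_smul σ h1.contDiffAt, ?_, deriv_const_mul_field σ⟩
  rw [gradient, gradient, fderiv_const_mul (h1.differentiable (by norm_num) x), map_smul]

lemma opF_sign (hσ : σ = 1 ∨ σ = -1) {s : ℝ} (hs : s < 𝓜.T) {y : Eu d} (hy : y ∈ 𝓜.Ω)
    (q : ℝ) (p : Eu d) (r v : ℝ) : σ * opF 𝓜 (s, y, σ * q, σ • p, σ * r, σ * v) =
      - r + signedInfSup σ (linearOp 𝓜 σ y q p v) := by
  simp only [opF, if_pos hs, if_pos hy, hamiltonian, signedInfSup, linearOp, inner_smul_right]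
  rcases hσ with rfl | rfl
  · simp
  · simp only [neg_one_mul, neg_add, neg_neg]
    congr 4
    funext β
    congr 1
    funext α
    ring

variable [CompactSpace A] [CompactSpace B] [Nonempty A] [Nonempty B]

/-- The upper envelope `u` of `w`, where `w` is `σ` times a numerical solution, satisfies the
viscosity inequality for `σ • F`. -/
lemma IsUpperLimit.frequently_opF_le (hσ : σ = 1 ∨ σ = -1) (h : IsStableScheme 𝓜 𝓓)
    (hw : IsSignedSolution 𝓜 𝓓 σ w) (hu : IsUpperLimit 𝓜 𝓓 w u) {M : ℝ}
    (hM : ∀ z ∈ cyl 𝓜, |u z| ≤ M) {ψ : ℝ × Eu d → ℝ} (hψ : ContDiff ℝ 2 ψ) {z : ℝ × Eu d}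
    (hz : z ∈ cyl' 𝓜) (hmax : IsLocalMaxOn (fun y => u y - σ * ψ y) (cyl' 𝓜) z) {e : ℝ}
    (he : 0 < e) : ∃ᶠ ζ in 𝓝[domF 𝓜] (jet ψ z (σ * u z)), σ * opF 𝓜 ζ ≤ e := by
  obtain ⟨t, x⟩ := z
  have hσσ : σ * σ = 1 := by rcases hσ with rfl | rfl <;> norm_num
  have hσ1 := abs_of_sign hσ
  intro hcon
  obtain ⟨δ, hδ, hball⟩ := Metric.mem_nhdsWithin_iff.1 hcon
  by_cases hx : x ∈ 𝓜.Ω ∨ σ * 𝓜.g x < u (t, x)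
  · obtain ⟨C, η, hη, hgrad, hlap, hstrict⟩ := exists_strict_test 𝓜 hM
      (contDiff_const.mul hψ : ContDiff ℝ 2 fun y => σ * ψ y) hz hmax (ε := δ / 4) (by linarith)
    obtain ⟨j1, j2, j3⟩ := jet_const_mul (σ := σ) hψ t x
    rw [j1] at hlap
    rw [j2] at hgrad
    rw [j3] at hstrict
    have hη2 : ContDiff ℝ 2 η := hη.of_le (WithTop.coe_le_coe.2 le_top)
    have hη1 : ContDiff ℝ 1 η := hη.of_le (by exact_mod_cast le_top)
    obtain ⟨ρ₁, hρ₁, hc₁⟩ := Metric.continuousAt_iff.1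
      ((continuous_laplacian hη2).continuousAt (x := x)) (δ / 4) (by linarith)
    obtain ⟨ρ₂, hρ₂, hc₂⟩ := Metric.continuousAt_iff.1
      ((continuous_gradient hη1).continuousAt (x := x)) (δ / 2) (by linarith)
    obtain ⟨s, hs, y, hy, v, r, hst, hyx, hv, hr, hop⟩ := hu.exists_discrete_test hσ h hw _ C hη hz
      hstrict hx (ρ := min (min ρ₁ ρ₂) (min (δ / 2) e))
      (lt_min (lt_min hρ₁ hρ₂) (lt_min (by linarith) he))
    have l1 : min (min ρ₁ ρ₂) (min (δ / 2) e) ≤ ρ₁ := (min_le_left _ _).trans (min_le_left _ _)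
    have l2 : min (min ρ₁ ρ₂) (min (δ / 2) e) ≤ ρ₂ := (min_le_left _ _).trans (min_le_right _ _)
    have l3 : min (min ρ₁ ρ₂) (min (δ / 2) e) ≤ δ / 2 :=
      (min_le_right _ _).trans (min_le_left _ _)
    have l4 : min (min ρ₁ ρ₂) (min (δ / 2) e) ≤ e := (min_le_right _ _).trans (min_le_right _ _)
    have hsgn : ∀ a b : ℝ, |σ * a - b| = |a - σ * b| := fun a b => by
      rw [← one_mul |a - σ * b|, ← hσ1, ← abs_mul, mul_sub, ← mul_assoc σ σ, hσσ, one_mul]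
    refine hball (a := (s, y, σ * Laplacian.laplacian η y, σ • gradient η y, σ * r, σ * v))
      ⟨?_, ⟨hs.1, hs.2.le⟩, subset_closure hy⟩ ?_
    · have d1 : |σ * Laplacian.laplacian η y - Laplacian.laplacian (fun y => ψ (t, y)) x| < δ := by
        rw [hsgn]
        have h1 := hc₁ (hyx.trans_le l1)
        rw [Real.dist_eq] at h1
        exact (abs_sub_le _ _ _).trans_lt (by linarith)
      have d2 : dist (σ • gradient η y) (gradient (fun y => ψ (t, y)) x) < δ := by
        have h1 := hc₂ (hyx.trans_le l2)
        rw [hgrad, dist_eq_norm] at h1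
        have h2 : σ • gradient η y - gradient (fun y => ψ (t, y)) x =
            σ • (gradient η y - σ • gradient (fun y => ψ (t, y)) x) := by
          rw [smul_sub, smul_smul, hσσ, one_smul]
        rw [dist_eq_norm, h2, norm_smul, Real.norm_eq_abs, hσ1, one_mul]
        linarith
      have d3 : |σ * r - deriv (fun s => ψ (s, x)) t| < δ := by
        rw [hsgn]
        linarith
      have d4 : |σ * v - σ * u (t, x)| < δ := by
        rw [hsgn, ← mul_assoc, hσσ, one_mul]
        linarith
      simp only [jet, Metric.mem_ball, Prod.dist_eq, max_lt_iff]
      exact ⟨by rw [Real.dist_eq]; linarith, by linarith, d1, d2, d3, d4⟩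
    · refine (opF_sign hσ hs.2 hy _ _ _ _).trans_le ?_
      exact hop.trans l4
  -- Here `x` is a boundary point with `u ≤ σ g`. The boundary branch of the operator at the jet
  -- itself is already non-positive after multiplication by `σ`.
  · push Not at hx
    refine hball (a := jet ψ (t, x) (σ * u (t, x))) ⟨Metric.mem_ball_self hδ,
      Ico_subset_Icc_self hz.1, hz.2⟩ ?_
    have h1 : opF 𝓜 (jet ψ (t, x) (σ * u (t, x))) = σ * u (t, x) - 𝓜.g x :=
      (if_pos hz.1.2).trans (if_neg hx.1)
    change σ * opF 𝓜 (jet ψ (t, x) (σ * u (t, x))) ≤ e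
    rw [h1, mul_sub, ← mul_assoc, hσσ, one_mul]
    linarith [hx.2]

/-- An eventual lower bound of `f` cannot exceed a value that is frequently an upper bound. No lower
bound on `f` is needed, since the real supremum of the empty set is zero. -/
lemma lowerEnv_le_of_frequently {X : Type*} [TopologicalSpace X] {D : Set X} {f : X → ℝ} {x : X}
    (h : ∀ e > 0, ∃ᶠ y in 𝓝[D] x, f y ≤ e) : lowerEnv D f x ≤ 0 := by
  rw [lowerEnv, liminf, limsInf]
  refine Real.sSup_le (fun a ha => le_of_forall_pos_le_add fun e he => ?_) le_rfl
  obtain ⟨y, hy, hy'⟩ := ((h e he).and_eventually (eventually_map.1 ha)).exists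
  linarith

end Viscosity

/-! ## The final time condition and the boundary condition -/

section Strong

variable {d : ℕ} {A B : Type*} [MetricSpace A] [MetricSpace B] {𝓜 : IsaacsProblem d A B}
  {𝓓 : Discretisation d A B} {w : ℕ → ℕ → Eu d → ℝ} {u : ℝ × Eu d → ℝ} {σ : ℝ}

/-- Tietze extension from the closure, followed by smooth approximation on the whole space. -/
lemma exists_contDiff_near {Ω : Set (Eu d)} {φ : Eu d → ℝ} (hφ : ContinuousOn φ (closure Ω))
    {δ : ℝ} (hδ : 0 < δ) :
    ∃ η : Eu d → ℝ, ContDiff ℝ (⊤ : ℕ∞) η ∧ ∀ x ∈ closure Ω, |η x - φ x| < δ := by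
  obtain ⟨φ', hφ'⟩ := ContinuousMap.exists_restrict_eq isClosed_closure
    ⟨(closure Ω).domRestrict φ, hφ.domRestrict⟩
  obtain ⟨η, hη, hclose, -⟩ := φ'.continuous.exists_contDiff_approx ⊤
    (continuous_const (y := δ)) fun _ => hδ
  refine ⟨η, hη, fun x hx => ?_⟩
  have h1 : φ' x = φ x := congr($hφ' ⟨x, hx⟩)
  rw [← h1, ← Real.dist_eq]
  exact hclose x

lemma IsUpperLimit.le_final [CompactSpace A] [CompactSpace B] [Nonempty A] [Nonempty B]
    (hσ : σ = 1 ∨ σ = -1) (h : IsStableScheme 𝓜 𝓓) (hw : IsSignedSolution 𝓜 𝓓 σ w)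
    (hu : IsUpperLimit 𝓜 𝓓 w u) {x : Eu d} (hx : x ∈ closure 𝓜.Ω) :
    u (𝓜.T, x) ≤ σ * 𝓜.vT x := by
  refine le_of_forall_pos_le_add fun ε hε => ?_
  -- `η` lies between `σ vT + δ` and `σ vT + 3 δ`. The other four errors are the bound on `w`, the
  -- near-attainment of `u`, the continuity of `η` and the term `C (T - t)`.
  set δ := ε / 7 with hδdef
  have hδ : 0 < δ := by positivity
  obtain ⟨η, hη, hclose⟩ := exists_contDiff_near (φ := fun x => σ * 𝓜.vT x + 2 * δ)
    ((continuousOn_const.mul 𝓜.vT_mem.1).add continuousOn_const) hδ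
  obtain ⟨C, hC, hev⟩ := hw.le_of_final_lt h hσ hη hδ fun x hx => by
    linarith [(abs_lt.1 (hclose x hx)).1]
  obtain ⟨r, hr, hηr⟩ := Metric.continuousAt_iff.1 (hη.continuous.continuousAt (x := x)) δ hδ
  have hC1 : 0 < C + 1 := by positivity
  obtain ⟨i, hi, k, hk, y, hy, hd, hge⟩ := hu.frequently_ge (𝓜.T, x)
    ⟨right_mem_Icc.2 𝓜.T_pos.le, hx⟩ δ hδ (min r (δ / (C + 1))) (lt_min hr (div_pos hδ hC1)) hev
  rw [Prod.dist_eq, max_lt_iff] at hd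
  have h1 := hi k hk y hy
  have h2 := hηr (hd.2.trans_le (min_le_left _ _))
  have h3 := hd.1.trans_le (min_le_right _ _)
  rw [Real.dist_eq] at h2 h3
  rw [lt_div_iff₀ hC1] at h3
  have h4 : C * (𝓜.T - k * 𝓓.h i) ≤ δ := by
    have h5 : 𝓜.T - k * 𝓓.h i ≤ |k * 𝓓.h i - 𝓜.T| := by
      rw [abs_sub_comm]
      exact le_abs_self _
    have h6 := mul_le_mul_of_nonneg_left h5 hC
    linarith [abs_nonneg (k * 𝓓.h i - 𝓜.T)]
  linarith [(abs_lt.1 h2).2, (abs_lt.1 (hclose x hx)).2]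

lemma IsBarrierFamily.eventually_abs_P_sub_le {ζ : ℝ → ℝ → Eu d → ℝ}
    (hζ : IsBarrierFamily 𝓜 𝓓 ζ) (h : IsStableScheme 𝓜 𝓓) {ε : ℝ} (hε : 0 < ε) {e : ℝ}
    (he : 0 < e) : ∀ᶠ i in atTop, ∀ k ≤ 𝓓.steps i, ∀ x ∈ closure 𝓜.Ω,
      |𝓓.P i (ζ ε (k * 𝓓.h i)) x - ζ ε (k * 𝓓.h i) x| ≤ e := by
  obtain ⟨L, hL⟩ := hζ.lipschitz ε hε
  filter_upwards [(hζ.convergent ε hε).eventually_le_const (ENNReal.ofReal_pos.2 he)]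
    with i hi k hk
  have hlip : LipschitzOnWith L (ζ ε (k * 𝓓.h i)) (closure 𝓜.Ω) := fun x hx y hy => by
    have := hL (x := (k * 𝓓.h i, x)) ⟨h.time_mem hk, hx⟩ (y := (k * 𝓓.h i, y)) ⟨h.time_mem hk, hy⟩
    simpa [Prod.edist_eq] using this
  have hmem := mem_contH1_of_lipschitzOnWith 𝓜.domain.isOpen 𝓜.domain.isBounded hlip
  exact norm_le_of_supNorm_le 𝓜.domain.isOpen
    (((h.triangulates i).continuousOn (h.proj.isP1 i _ hmem)).sub hmem.1) he.le
    ((le_iSup₂_of_le k hk le_rfl).trans hi)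

/-- The value of `w - σ P ζ` at a node near `(t, y)` is dominated by its value at a boundary point,
where `w` is close to `σ g`. The Lipschitz continuity of `ζ` transfers both values to time `t`. -/
lemma IsUpperLimit.le_of_boundary_maximiser (hσ : σ = 1 ∨ σ = -1) (h : IsStableScheme 𝓜 𝓓)
    (hw : IsSignedSolution 𝓜 𝓓 σ w) (hu : IsUpperLimit 𝓜 𝓓 w u) {ζ : ℝ → ℝ → Eu d → ℝ}
    (hζ : IsBarrierFamily 𝓜 𝓓 ζ) {ε : ℝ} (hε : 0 < ε)
    (hmax : ∀ᶠ i in atTop, ∀ k ≤ 𝓓.steps i, ∃ z ∈ frontier 𝓜.Ω, ∀ x ∈ closure 𝓜.Ω,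
      w i k x - σ * 𝓓.P i (ζ ε (k * 𝓓.h i)) x ≤ w i k z - σ * 𝓓.P i (ζ ε (k * 𝓓.h i)) z)
    {t : ℝ} (ht : t ∈ Icc 0 𝓜.T) {y : Eu d} (hy : y ∈ frontier 𝓜.Ω) {N : ℝ}
    (hN : ∀ z ∈ frontier 𝓜.Ω, σ * 𝓜.g z - σ * ζ ε t z ≤ N) :
    u (t, y) ≤ N + σ * ζ ε t y := by
  have hσ1 := abs_of_sign hσ
  have hcl : ∀ z ∈ frontier 𝓜.Ω, z ∈ closure 𝓜.Ω := fun z hz => frontier_subset_closure hz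
  refine le_of_forall_pos_le_add fun e he => ?_
  set δ := e / 6 with hδdef
  have hδ : 0 < δ := by positivity
  obtain ⟨L, hL⟩ := hζ.lipschitz ε hε
  have hL1 : (0 : ℝ) < L + 1 := by positivity
  have hsgn : ∀ {a b : ℝ}, |a - b| ≤ δ → |σ * a - σ * b| ≤ δ := fun {a b} hab => by
    rwa [← mul_sub, abs_mul, hσ1, one_mul]
  obtain ⟨i, ⟨hP, hg, hT, hm⟩, k, hk, z, hz, hd, hge⟩ := hu.frequently_ge (t, y)
    ⟨ht, hcl y hy⟩ δ hδ (δ / (L + 1)) (div_pos hδ hL1)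
    ((hζ.eventually_abs_P_sub_le h hε hδ).and
      ((h.eventually_abs_P_sub_le 𝓜.g_mem h.proj.convergent_g hδ).and
        ((h.eventually_abs_P_sub_le 𝓜.vT_mem h.proj.convergent_vT hδ).and hmax)))
  have hs := h.time_mem hk
  set s : ℝ := k * 𝓓.h i with hsdef
  obtain ⟨q, hq, hqmax⟩ := hm k hk
  have hzcl := (h.triangulates i).mem_closure_of_mem_vertices hz
  have hlip : ∀ p ∈ cyl 𝓜, ∀ p' ∈ cyl 𝓜, dist p p' ≤ δ / (L + 1) →
      |σ * ζ ε p.1 p.2 - σ * ζ ε p'.1 p'.2| ≤ δ := fun p hp p' hp' hpp => by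
    refine hsgn ((hL.dist_le_mul p hp p' hp').trans ?_)
    rw [le_div_iff₀ hL1] at hpp
    linarith [dist_nonneg (x := p) (y := p')]
  have b1 := hlip (s, z) ⟨hs, hzcl⟩ (t, y) ⟨ht, hcl y hy⟩ hd.le
  have b2 := hlip (s, q) ⟨hs, hcl q hq⟩ (t, q) ⟨ht, hcl q hq⟩ (by
    rw [Prod.dist_eq] at hd ⊢
    simpa using ((le_max_left _ _).trans_lt hd).le)
  have b3 := hsgn (hP k hk z hzcl)
  have b4 := hsgn (hP k hk q (hcl q hq))
  have b5 : w i k q ≤ σ * 𝓜.g q + δ := by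
    -- At the last time level the solution is `P vT` instead of `P g` on the boundary; the two are
    -- close since `vT = g` there.
    rcases hk.lt_or_eq with hlt | rfl
    · rw [hw.boundary i k hlt q hq]
      linarith [(abs_le.1 (hsgn (hg q (hcl q hq)))).2]
    · rw [hw.final i q (hcl q hq), ← 𝓜.vT_eq_g q hq]
      linarith [(abs_le.1 (hsgn (hT q (hcl q hq)))).2]
  have b6 := hqmax z hzcl
  have b7 := hN q hq
  simp only at b1 b2
  linarith [(abs_le.1 b1).2, (abs_le.1 b2).1, (abs_le.1 b3).2, (abs_le.1 b4).1]

/-- The bound for fixed `ε` is taken with the maximiser `q ε`. As `ε → 0`, continuity of `g` and `q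
ε → y` leave only the limit `l`, whose sign is favourable. -/
lemma IsUpperLimit.le_boundary (hσ : σ = 1 ∨ σ = -1) (h : IsStableScheme 𝓜 𝓓)
    (hw : IsSignedSolution 𝓜 𝓓 σ w) (hu : IsUpperLimit 𝓜 𝓓 w u) {ζ : ℝ → ℝ → Eu d → ℝ}
    (hζ : IsBarrierFamily 𝓜 𝓓 ζ)
    (hmax : ∀ ε > 0, ∀ᶠ i in atTop, ∀ k ≤ 𝓓.steps i, ∃ z ∈ frontier 𝓜.Ω, ∀ x ∈ closure 𝓜.Ω,
      w i k x - σ * 𝓓.P i (ζ ε (k * 𝓓.h i)) x ≤ w i k z - σ * 𝓓.P i (ζ ε (k * 𝓓.h i)) z)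
    {t : ℝ} (ht : t ∈ Icc 0 𝓜.T) {y : Eu d} (hy : y ∈ frontier 𝓜.Ω) {q : ℝ → Eu d}
    (hq : ∀ ε > 0, ∀ z ∈ frontier 𝓜.Ω,
      σ * 𝓜.g z - σ * ζ ε t z ≤ σ * 𝓜.g (q ε) - σ * ζ ε t (q ε))
    (hqy : Tendsto q (𝓝[>] 0) (𝓝 y)) {l : ℝ} (hl : σ * l ≤ 0)
    (hlim : Tendsto (fun ε => ζ ε t y - ζ ε t (q ε)) (𝓝[>] 0) (𝓝 l)) :
    u (t, y) ≤ σ * 𝓜.g y := by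
  obtain ⟨L, hL⟩ := 𝓜.g_lipschitz
  have h1 : Tendsto (fun ε => σ * 𝓜.g (q ε) + σ * (ζ ε t y - ζ ε t (q ε))) (𝓝[>] 0)
      (𝓝 (σ * 𝓜.g y + σ * l)) :=
    (((hL.continuous.tendsto y).comp hqy).const_mul σ).add (hlim.const_mul σ)
  have h2 : u (t, y) ≤ σ * 𝓜.g y + σ * l := by
    refine ge_of_tendsto h1 ?_
    filter_upwards [self_mem_nhdsWithin] with ε hε
    have := hu.le_of_boundary_maximiser hσ h hw hζ hε (hmax ε hε) ht hy (hq ε hε)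
    linarith
  linarith

end Strong

/-! ## The envelopes of the numerical solutions -/

section Conclusion

variable {d : ℕ} {A B : Type*} [MetricSpace A] [MetricSpace B] {𝓜 : IsaacsProblem d A B}
  {𝓓 : Discretisation d A B} {w w' : ℕ → ℕ → Eu d → ℝ} {u u' : ℝ × Eu d → ℝ}

/-- As `-u'` is the lower envelope of `w`, this is the inequality between limit inferior and limit
superior; one discrete value close to `z` witnesses it. -/
lemma IsUpperLimit.neg_le (hu : IsUpperLimit 𝓜 𝓓 w u) (hu' : IsUpperLimit 𝓜 𝓓 w' u')
    (hww : ∀ i k y, w' i k y = - w i k y) {z : ℝ × Eu d} (hz : z ∈ cyl 𝓜) : - u z ≤ u' z := by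
  refine le_of_forall_pos_le_add fun ε hε => ?_
  obtain ⟨ρ, hρ, hev⟩ := hu'.eventually_le z hz (ε / 2) (half_pos hε)
  obtain ⟨ρ', hρ', hev'⟩ := hu.eventually_le z hz (ε / 2) (half_pos hε)
  obtain ⟨i, ⟨hi, hi'⟩, k, hk, y, hy, hd, -⟩ := hu.frequently_ge z hz 1 one_pos (min ρ ρ')
    (lt_min hρ hρ') (hev.and hev')
  have h1 := hi k hk y hy (hd.trans_le (min_le_left _ _))
  have h2 := hi' k hk y hy (hd.trans_le (min_le_right _ _))
  rw [hww] at h1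
  linarith

/-- Envelopes that have opposite bounds at `z` are continuous at `z`. -/
lemma IsUpperLimit.env_eq (hu : IsUpperLimit 𝓜 𝓓 w u) (hu' : IsUpperLimit 𝓜 𝓓 w' u')
    (hww : ∀ i k y, w' i k y = - w i k y) {M : ℝ} (hM : ∀ z ∈ cyl 𝓜, |u z| ≤ M)
    {z : ℝ × Eu d} (hz : z ∈ cyl 𝓜) {c : ℝ} (hc : u z ≤ c) (hc' : u' z ≤ - c) :
    upperEnv (cyl 𝓜) u z = c ∧ lowerEnv (cyl 𝓜) u z = c := by
  have heq : u z = c := le_antisymm hc (by linarith [hu.neg_le hu' hww hz])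
  refine ⟨(hu.upperEnv_eq hM hz).trans heq, neg_injective ?_⟩
  rw [← upperEnv_neg]
  refine le_antisymm (le_of_forall_pos_le_add fun δ hδ => ?_) ?_
  · obtain ⟨ρ, hρ, h⟩ := hu'.le_add hz hδ
    refine upperEnv_le hz (b := -M) ?_ ?_
    · filter_upwards [self_mem_nhdsWithin] with y hy
      linarith [(abs_le.1 (hM y hy)).2]
    · filter_upwards [self_mem_nhdsWithin, mem_nhdsWithin_of_mem_nhds (Metric.ball_mem_nhds z hρ)]
        with y hy hyd
      linarith [h y hy hyd, hu.neg_le hu' hww hy]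
  · refine le_upperEnv (b := M) ?_ fun hn => hn.self_of_nhdsWithin hz (neg_le_neg heq.le)
    filter_upwards [self_mem_nhdsWithin] with y hy
    linarith [(abs_le.1 (hM y hy)).1]

lemma env_congr {X : Type*} [TopologicalSpace X] {D : Set X} {f f' : X → ℝ} (h : EqOn f f' D)
    (x : X) : upperEnv D f x = upperEnv D f' x ∧ lowerEnv D f x = lowerEnv D f' x :=
  ⟨limsup_congr (h.eventuallyEq_of_mem self_mem_nhdsWithin),
    liminf_congr (h.eventuallyEq_of_mem self_mem_nhdsWithin)⟩

lemma lowerEnvelope_eq_neg {A B : Type*} (𝓓 : Discretisation d A B) (v : ℕ → ℕ → Eu d → ℝ) (z : ℝ × Eu d) :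
    lowerEnvelope 𝓓 v z = - upperEnvelope 𝓓 (fun i k => (-1 : ℝ) • v i k) z := by
  rw [upperEnvelope, lowerEnvelope, ← EReal.liminf_neg]
  congr 1
  funext q
  simp

/-- The envelopes satisfy the boundary condition at the points of `ω` strongly. -/
lemma HasBarriers.le_boundary {ω : Set (Eu d)} {v : ℕ → ℕ → Eu d → ℝ}
    (hω : HasBarriers 𝓜 𝓓 ω v) (h : IsStableScheme 𝓜 𝓓) (hv : IsNumericalSolution 𝓜 𝓓 v)
    {σ : ℝ} (hσ : σ = 1 ∨ σ = -1) (hu : IsUpperLimit 𝓜 𝓓 (fun i k => σ • v i k) u)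
    {t : ℝ} (ht : t ∈ Icc 0 𝓜.T) {y : Eu d} (hy : y ∈ ω) : u (t, y) ≤ σ * 𝓜.g y := by
  have hw := h.isSignedSolution hv hσ
  rcases hσ with rfl | rfl
  -- Maximisers of `v - P ξ` serve the sign `1`; after negation the minimisers of `v - P ζ` serve
  -- the sign `-1`.
  · obtain ⟨ξ, hξ⟩ := hω.lower y hy
    obtain ⟨q, hq, hqy, l, hl, hlim⟩ := hξ.limit t ht
    refine hu.le_boundary (Or.inl rfl) h hw hξ.family (fun ε hε => ?_) ht (hω.subset hy)
      (fun ε hε z hz => ?_) hqy (by linarith) hlim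
    · obtain ⟨i₀, hi₀⟩ := hξ.maximiser ε hε
      filter_upwards [eventually_ge_atTop i₀] with i hi k hk
      obtain ⟨z, hz, hmax⟩ := hi₀ i hi k hk
      refine ⟨z, hz, fun x hx => ?_⟩
      simpa using hmax hx
    · simpa using (hq ε hε).2 hz
  · obtain ⟨ζ, hζ⟩ := hω.upper y hy
    obtain ⟨q, hq, hqy, l, hl, hlim⟩ := hζ.limit t ht
    refine hu.le_boundary (Or.inr rfl) h hw hζ.family (fun ε hε => ?_) ht (hω.subset hy)
      (fun ε hε z hz => ?_) hqy (by linarith) hlim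
    · obtain ⟨i₀, hi₀⟩ := hζ.minimiser ε hε
      filter_upwards [eventually_ge_atTop i₀] with i hi k hk
      obtain ⟨z, hz, hmin⟩ := hi₀ i hi k hk
      refine ⟨z, hz, fun x hx => ?_⟩
      have := isMinOn_iff.1 hmin x hx
      simp only [Pi.smul_apply, smul_eq_mul]
      linarith
    · have := isMinOn_iff.1 (hq ε hε).2 z hz
      linarith

variable [CompactSpace A] [CompactSpace B] [Nonempty A] [Nonempty B]

lemma IsStableScheme.exists_eventually_abs_le (h : IsStableScheme 𝓜 𝓓)
    {v : ℕ → ℕ → Eu d → ℝ} (hv : IsNumericalSolution 𝓜 𝓓 v) :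
    ∃ M, ∀ᶠ i in atTop, ∀ k ≤ 𝓓.steps i, ∀ z ∈ nodes 𝓓 i, |v i k z| ≤ M := by
  obtain ⟨M, hM⟩ := (h.isSignedSolution hv (Or.inl rfl)).exists_eventually_le h (Or.inl rfl)
  obtain ⟨M', hM'⟩ := (h.isSignedSolution hv (Or.inr rfl)).exists_eventually_le h (Or.inr rfl)
  refine ⟨max M M', ?_⟩
  filter_upwards [hM, hM'] with i hi hi' k hk z hz
  have h1 := hi k hk z hz
  have h2 := hi' k hk z hz
  simp only [Pi.smul_apply, smul_eq_mul, one_mul, neg_one_mul] at h1 h2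
  exact abs_le'.2 ⟨h1.trans (le_max_left _ _), h2.trans (le_max_right _ _)⟩

/-- `u` is its own upper envelope, so the inequality concerns `u` directly. The strong conditions
need the bounds for both signs, because they also involve the lower envelope of `u`. -/
theorem isViscositySubsolution_upperEnvelope (h : IsStableScheme 𝓜 𝓓) {v : ℕ → ℕ → Eu d → ℝ}
    (hv : IsNumericalSolution 𝓜 𝓓 v) {ω : Set (Eu d)} (hω : HasBarriers 𝓜 𝓓 ω v)
    (hu : IsUpperLimit 𝓜 𝓓 (fun i k => (1 : ℝ) • v i k) u)
    (hu' : IsUpperLimit 𝓜 𝓓 (fun i k => (-1 : ℝ) • v i k) u') {M : ℝ}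
    (hM : ∀ z ∈ cyl 𝓜, |u z| ≤ M) : IsViscositySubsolution 𝓜 ω u := by
  have hw := h.isSignedSolution hv (Or.inl rfl)
  have hw' := h.isSignedSolution hv (Or.inr rfl)
  have henv : EqOn (upperEnv (cyl 𝓜) u) u (cyl 𝓜) := fun z hz => hu.upperEnv_eq hM hz
  have hsub : cyl' 𝓜 ⊆ cyl 𝓜 := fun z hz => ⟨Ico_subset_Icc_self hz.1, hz.2⟩
  have hneg : ∀ i k y, ((-1 : ℝ) • v i k) y = - ((1 : ℝ) • v i k) y := fun i k y => by simp
  refine ⟨⟨M, hM⟩, fun ψ hψ z hz hmax => ?_, fun x hx t ht => ?_, fun x hx => ?_⟩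
  · rw [henv (hsub hz)]
    refine lowerEnv_le_of_frequently fun e he => ?_
    have := hu.frequently_opF_le (Or.inl rfl) h hw hM hψ hz (hmax.congr ?_ hz) he
    · simpa using this
    · filter_upwards [self_mem_nhdsWithin] with y hy
      rw [henv (hsub hy), one_mul]
  · have hz : (t, x) ∈ cyl 𝓜 := ⟨ht, frontier_subset_closure (hω.subset hx)⟩
    rw [(env_congr henv _).1, (env_congr henv _).2]
    refine hu.env_eq hu' hneg hM hz ?_ ?_
    · simpa using hω.le_boundary h hv (Or.inl rfl) hu ht hx
    · simpa using hω.le_boundary h hv (Or.inr rfl) hu' ht hx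
  · have hz : (𝓜.T, x) ∈ cyl 𝓜 := ⟨right_mem_Icc.2 𝓜.T_pos.le, hx⟩
    rw [StrongFinal, (env_congr henv _).1, (env_congr henv _).2]
    refine hu.env_eq hu' hneg hM hz ?_ ?_
    · simpa using hu.le_final (Or.inl rfl) h hw hx
    · simpa using hu'.le_final (Or.inr rfl) h hw' hx

/-- The mirror image with sign `-1`: a minimum of `-u' - ψ` is a maximum of `u' + ψ`, and reflection
exchanges the envelopes of the operator. -/
theorem isViscositySupersolution_lowerEnvelope (h : IsStableScheme 𝓜 𝓓)
    {v : ℕ → ℕ → Eu d → ℝ} (hv : IsNumericalSolution 𝓜 𝓓 v) {ω : Set (Eu d)}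
    (hω : HasBarriers 𝓜 𝓓 ω v) (hu : IsUpperLimit 𝓜 𝓓 (fun i k => (1 : ℝ) • v i k) u)
    (hu' : IsUpperLimit 𝓜 𝓓 (fun i k => (-1 : ℝ) • v i k) u') {M : ℝ}
    (hM : ∀ z ∈ cyl 𝓜, |u' z| ≤ M) : IsViscositySupersolution 𝓜 ω fun z => - u' z := by
  have hw := h.isSignedSolution hv (Or.inl rfl)
  have hw' := h.isSignedSolution hv (Or.inr rfl)
  have henv : EqOn (lowerEnv (cyl 𝓜) fun z => - u' z) (fun z => - u' z) (cyl 𝓜) := fun z hz => by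
    rw [lowerEnv_neg, hu'.upperEnv_eq hM hz]
  have hsub : cyl' 𝓜 ⊆ cyl 𝓜 := fun z hz => ⟨Ico_subset_Icc_self hz.1, hz.2⟩
  have hneg : ∀ i k y, ((1 : ℝ) • v i k) y = - ((-1 : ℝ) • v i k) y := fun i k y => by simp
  have key : ∀ z ∈ cyl 𝓜, ∀ c, u z ≤ c → u' z ≤ - c →
      upperEnv (cyl 𝓜) (lowerEnv (cyl 𝓜) fun z => - u' z) z = c ∧
        lowerEnv (cyl 𝓜) (lowerEnv (cyl 𝓜) fun z => - u' z) z = c := fun z hz c hc hc' => by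
    obtain ⟨h1, h2⟩ := hu'.env_eq hu hneg hM hz hc' (by rwa [neg_neg])
    rw [(env_congr henv _).1, (env_congr henv _).2, upperEnv_neg, lowerEnv_neg, h1, h2, neg_neg]
    exact ⟨rfl, rfl⟩
  refine ⟨⟨M, fun z hz => (abs_neg _).trans_le (hM z hz)⟩, fun ψ hψ z hz hmin => ?_,
    fun x hx t ht => ?_, fun x hx => ?_⟩
  · rw [henv (hsub hz), ← neg_nonpos, ← lowerEnv_neg]
    refine lowerEnv_le_of_frequently fun e he => ?_
    have := hu'.frequently_opF_le (Or.inr rfl) h hw' hM hψ hz (hmin.neg.congr ?_ hz) he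
    · simpa using this
    · filter_upwards [self_mem_nhdsWithin] with y hy
      rw [henv (hsub hy)]
      ring
  · refine key _ ⟨ht, frontier_subset_closure (hω.subset hx)⟩ _ ?_ ?_
    · simpa using hω.le_boundary h hv (Or.inl rfl) hu ht hx
    · simpa using hω.le_boundary h hv (Or.inr rfl) hu' ht hx
  · refine key _ ⟨right_mem_Icc.2 𝓜.T_pos.le, hx⟩ _ ?_ ?_
    · simpa using hu.le_final (Or.inl rfl) h hw hx
    · simpa using hu'.le_final (Or.inr rfl) h hw' hx

end Conclusion

end IsaacsFEM

end

theorem mainTheorem2 {d : ℕ} (hd : 2 ≤ d) {A B : Type*}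
    [MetricSpace A] [CompactSpace A] [Nonempty A] [MetricSpace B] [CompactSpace B] [Nonempty B]
    (𝓜 : IsaacsFEM.IsaacsProblem d A B) (𝓓 : IsaacsFEM.Discretisation d A B)
    (hmesh : IsaacsFEM.IsMeshSequence 𝓜 𝓓) (hproj : IsaacsFEM.IsEllipticProjection 𝓜 𝓓)
    (hcons : IsaacsFEM.IsConsistent 𝓜 𝓓) (hmono : IsaacsFEM.IsMonotone 𝓜 𝓓)
    (v : ℕ → ℕ → IsaacsFEM.Eu d → ℝ) (hv : IsaacsFEM.IsNumericalSolution 𝓜 𝓓 v)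
    (ω : Set (IsaacsFEM.Eu d)) (hω : IsaacsFEM.HasBarriers 𝓜 𝓓 ω v) :
    (∃ u : ℝ × IsaacsFEM.Eu d → ℝ,
      (∀ z ∈ IsaacsFEM.cyl 𝓜, IsaacsFEM.upperEnvelope 𝓓 v z = (u z : EReal)) ∧
      IsaacsFEM.IsViscositySubsolution 𝓜 ω u) ∧
    (∃ u : ℝ × IsaacsFEM.Eu d → ℝ,
      (∀ z ∈ IsaacsFEM.cyl 𝓜, IsaacsFEM.lowerEnvelope 𝓓 v z = (u z : EReal)) ∧
      IsaacsFEM.IsViscositySupersolution 𝓜 ω u) := by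
  have h : IsaacsFEM.IsStableScheme 𝓜 𝓓 := ⟨hmesh, hproj, hcons, hmono⟩
  obtain ⟨M, hM⟩ := h.exists_eventually_abs_le hv
  obtain ⟨u, henv, hu, huM⟩ := IsaacsFEM.exists_isUpperLimit h
    (w := fun i k => (1 : ℝ) • v i k) (M := M) (by simpa using hM)
  obtain ⟨u', henv', hu', huM'⟩ := IsaacsFEM.exists_isUpperLimit h
    (w := fun i k => (-1 : ℝ) • v i k) (M := M) (by simpa using hM)
  refine ⟨⟨u, fun z hz => ?_,
      IsaacsFEM.isViscositySubsolution_upperEnvelope h hv hω hu hu' huM⟩,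
    ⟨fun z => - u' z, fun z hz => ?_,
      IsaacsFEM.isViscositySupersolution_lowerEnvelope h hv hω hu hu' huM'⟩⟩
  · simpa using henv z hz
  · rw [IsaacsFEM.lowerEnvelope_eq_neg, henv' z hz, EReal.coe_neg]
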